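/- **Setting.** Let $U\subseteq\mathbb R^n$ be open, $r\ge 0$. A *4-form twisted Courant algebroid* of rank $r$ over $U$, in a local frame with constant fibre metric, consists of a symmetric invertible matrix $\eta_{ab}$, smooth functions $\rho_a{}^\mu$ and totally antisymmetric smooth functions $C_{abc}$ on $U$, and a closed 4-form $H$ on $U$, such that (indices $a,b,\dots$ are raised with $\eta^{ab}$) $$\eta^{ab}\rho_a{}^\mu\rho_b{}^\nu=0,\qquad \rho_b{}^\mu\partial_\mu\rho_a{}^\nu-\rho_a{}^\mu\partial_\mu\rho_b{}^\nu+\eta^{ef}\rho_e{}^\nu C_{fab}=0,$$ $$\rho_d{}^\mu\partial_\mu C_{abc}-\rho_a{}^\mu\partial_\mu C_{bcd}+\rho_b{}^\mu\partial_\mu C_{cda}-\rho_c{}^\mu\partial_\mu C_{dab}+\eta^{ef}\big(C_{eab}C_{cdf}+C_{eac}C_{dbf}+C_{ead}C_{bcf}\big)=-\rho_d{}^\mu\rho_a{}^\nu\rho_b{}^\kappa\rho_c{}^\lambda H_{\mu\nu\kappa\lambda}.$$ Let $x^\alpha=(x^\mu,a^a,b_\mu)$ be graded coordinates of degrees $|\alpha|=0,1,2$,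 with left derivatives $\partial_\alpha$, and let the homological vector field $Q^H=Q^\alpha\partial_\alpha$ have the components $$Q^{\mu}=\rho_a{}^\mu a^a,\qquad Q^{a}=-\eta^{ab}\rho_b{}^\mu b_\mu-\tfrac12 C^a{}_{bc}a^ba^c,\qquad Q^{b_\mu}=-\partial_\mu\rho_a{}^\nu\, b_\nu a^a-\tfrac1{3!}\big(\partial_\mu C_{abc}+\rho_a{}^\nu\rho_b{}^\kappa\rho_c{}^\lambda H_{\mu\nu\kappa\lambda}\big)a^aa^ba^c .$$ The 4-form twisted Courant sigma model has the fields $\varphi^\alpha=(X^\mu,A^a,B_\mu)$, of (form, ghost) bidegrees $(|\alpha|,0)$, the ghosts $\varepsilon^\alpha=(0,\varepsilon^a,-\psi_\mu)$, of bidegrees $(|\alpha|-1,1)$, and the ghosts for ghosts $\tilde\varepsilon^\alpha=(0,0,-\tilde\psi_\mu)$, of bidegrees $(|\alpha|-2,2)$. On a closed membrane $\Sigma=\partial\hat\Sigma$ its classical action is $$S=\int_\Sigma\Big(-B_\mu\, dX^\mu+\tfrac12\eta_{ab}A^a dA^b+\rho_a{}^\mu(X)B_\mu A^a+\tfrac1{3!}C_{abc}(X)A^aA^bA^c\Big)+\int_{\hat\Sigma}X^*H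 .$$ *Local forms* are the elements of the free bigraded-commutative algebra over $C^\infty(U)\ni f(X)$ generated by $A,B,\varepsilon,\psi,\tilde\psi$ and by the exterior derivatives of all fields and ghosts, with the sign rule $xy=(-1)^{ff'+gg'}yx$ for bidegrees $(f,g)$ and $(f',g')$. Pull-back by $\varphi$ (that is, $x^\alpha\mapsto\varphi^\alpha$) of functions on the target is left implicit. Write $x\approx0$ ("$x$ vanishes on-shell") if $x$ lies in the two-sided ideal generated by the field equations $F^\alpha=d\varphi^\alpha-Q^\alpha$ and their exterior derivatives $dF^\alpha$. A *BRST operator* $s$ is an $\mathbb R$-linear left derivation of bidegree $(0,1)$ on local forms, signs being $s(xy)=(sx)y+(-1)^{g}x\,(sy)$ for $x$ of ghost degree $g$, with $s(f(X))=\partial_\mu f\,sX^\mu$ and $sd=ds$. *Trivial terms* are families $s_{\rm triv}\varphi^\alpha\approx0$ of bidegree $(|\alpha|,1)$ and $s_{\rm triv}\varepsilon^\alpha\approx0$ of bidegree $(|\alpha|-1,2)$. In the formulas below $\varepsilon^\beta\varepsilon^\gamma\partial_\beta\partial_\gamma$ and $\varepsilon^\beta\varepsilon^\gamma\varepsilon^\delta\partial_\beta\partial_\gamma\partial_\delta$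 denote the iterated operators $(\varepsilon^\beta\partial_\beta)(\varepsilon^\gamma\partial_\gamma)$ and $(\varepsilon^\beta\partial_\beta)(\varepsilon^\gamma\partial_\gamma)(\varepsilon^\delta\partial_\delta)$, ghosts being constant for $\partial$. That is, a sign $\sigma_{\beta\gamma}$ (respectively $\sigma_{\beta\gamma}\sigma_{\beta\delta}\sigma_{\gamma\delta}$) is included, with $\sigma_{\beta\gamma}=(-1)^{|\beta|(|\gamma|-1)}$; the same signs are included in contractions of $\varepsilon\varepsilon$ and $\varepsilon\varepsilon\varepsilon$ with other coefficients. **Proposition 3.1.** Consider the BRST transformations $$s_0\varphi^\alpha=d\varepsilon^\alpha+\varepsilon^\beta\partial_\beta Q^\alpha+s_{\rm triv}\varphi^\alpha,\tag{1}$$ $$s_0\varepsilon^\alpha=d\tilde\varepsilon^\alpha-\tilde\varepsilon^\beta\partial_\beta Q^\alpha-\tfrac12\varepsilon^\beta\varepsilon^\gamma\partial_\beta\partial_\gamma Q^\alpha+s_{\rm triv}\varepsilon^\alpha,\tag{2}$$ $$s_0\tilde\varepsilon^\alpha=\tilde\varepsilon^\beta\varepsilon^\gamma\partial_\beta\partial_\gamma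 Q^\alpha+\tfrac1{3!}\varepsilon^\beta\varepsilon^\gamma\varepsilon^\delta\partial_\beta\partial_\gamma\partial_\delta Q^\alpha.\tag{3}$$ (i) For all trivial terms $s_{\rm triv}\varphi^\alpha$, $s_{\rm triv}\varepsilon^\alpha$ there is exactly one BRST operator $s_0$ satisfying (1)–(3), and $s_0^2\approx0$, i.e. $s_0^2x\approx0$ for every local form $x$. (ii) There are trivial terms $s_{\rm triv}\varphi^\alpha$ such that the classical action is invariant under every BRST operator $s$ satisfying (1) with these trivial terms: with $L$ the Lagrangian 3-form, there are local forms $\Xi$, $J$ with $s(X^*H)=d\Xi$ and $sL+\Xi=dJ$. (iii) The coefficients in (2) and (3) are determined by $s_0^2\approx0$. Let $s$ be a BRST operator satisfying (1) with some trivial terms and $$s\varepsilon^\alpha=d\tilde\varepsilon^\alpha+\tilde\varepsilon^\beta\kappa^\alpha_\beta+\tfrac12\varepsilon^\beta\varepsilon^\gamma\lambda^\alpha_{\beta\gamma}+s_{\rm triv}\varepsilon^\alpha,$$ where $\kappa^\alpha_\beta$ and $\lambda^\alpha_{\beta\gamma}$ are (pull-backs of) functions on the target of degrees $|\alpha|+1-|\beta|$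 and $|\alpha|+1-|\beta|-|\gamma|$, and $\lambda$ is graded symmetric in its lower indices. If $s^2\varphi^\alpha\approx0$ for all $\alpha$, then $\kappa^\alpha_\beta=-\partial_\beta Q^\alpha$ for $\beta$ of type $b$, and $\lambda^\alpha_{\beta\gamma}=-\partial_\beta\partial_\gamma Q^\alpha$ for $\beta,\gamma$ of types $a$, $b$ (all components that are contracted with a non-zero ghost); hence (2) holds. If moreover $$s\tilde\varepsilon^\alpha=\tilde\varepsilon^\beta\varepsilon^\gamma\tilde\kappa^\alpha_{\beta\gamma}+\tfrac1{3!}\varepsilon^\beta\varepsilon^\gamma\varepsilon^\delta\tilde\lambda^\alpha_{\beta\gamma\delta},$$ where $\tilde\kappa$ and $\tilde\lambda$ are functions on the target of degrees $|\alpha|+1-|\beta|-|\gamma|$ and $|\alpha|+1-|\beta|-|\gamma|-|\delta|$, $\tilde\lambda$ is graded symmetric in its lower indices, and $s^2\varepsilon^\alpha\approx0$ for all $\alpha$, then $\tilde\kappa^\alpha_{\beta\gamma}=\partial_\beta\partial_\gamma Q^\alpha$ for $\beta$ of type $b$ and $\gamma$ of types $a$, $b$, and $\tilde\lambda^\alpha_{\beta\gamma\delta}=\partial_\beta\partial_\gamma\partial_\delta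 Q^\alpha$ for $\beta,\gamma,\delta$ of types $a$, $b$; hence (3) holds. -/

import Mathlib

open scoped ContDiff BigOperators

namespace TwistedCourant

noncomputable section

/-! ### Smooth functions on a coordinate patch -/

/-- The real algebra `C^∞(U)` of smooth functions on an open set `U ⊆ ℝⁿ`. -/
def smoothSubalgebra {n : ℕ} (U : TopologicalSpace.Opens (Fin n → ℝ)) : Subalgebra ℝ (U → ℝ) where
  carrier := {f | ContDiffOn ℝ ∞ (Function.extend (Subtype.val : U → (Fin n → ℝ)) f 0) U}
  mul_mem' := by
    intro f g hf hg
    refine (hf.mul hg).congr ?_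
    intro x hx
    have h : ∀ k : U → ℝ, Function.extend (Subtype.val : U → (Fin n → ℝ)) k 0 x = k ⟨x, hx⟩ :=
      fun k => Subtype.val_injective.extend_apply k 0 ⟨x, hx⟩
    simp [h]
  add_mem' := by
    intro f g hf hg
    refine (hf.add hg).congr ?_
    intro x hx
    have h : ∀ k : U → ℝ, Function.extend (Subtype.val : U → (Fin n → ℝ)) k 0 x = k ⟨x, hx⟩ :=
      fun k => Subtype.val_injective.extend_apply k 0 ⟨x, hx⟩
    simp [h]
  algebraMap_mem' := by
    intro c
    refine (contDiffOn_const (c := c)).congr ?_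
    intro x hx
    have h : ∀ k : U → ℝ, Function.extend (Subtype.val : U → (Fin n → ℝ)) k 0 x = k ⟨x, hx⟩ :=
      fun k => Subtype.val_injective.extend_apply k 0 ⟨x, hx⟩
    simp [h]

/-- `C^∞(U)` as a type; it is a commutative `ℝ`-algebra. -/
abbrev Smooth {n : ℕ} (U : TopologicalSpace.Opens (Fin n → ℝ)) : Type :=
  ↥(smoothSubalgebra U)

variable {n r : ℕ} {U : TopologicalSpace.Opens (Fin n → ℝ)}

/-- The extension by zero of a function on `U` to all of `ℝⁿ`; only its values on `U` matter. -/
def extendZero (f : U → ℝ) : (Fin n → ℝ) → ℝ :=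
  Function.extend (Subtype.val : U → (Fin n → ℝ)) f 0

theorem extendZero_apply (f : U → ℝ) (x : U) : extendZero f x = f x :=
  Subtype.val_injective.extend_apply f 0 x

theorem Smooth.contDiffOn (f : Smooth U) : ContDiffOn ℝ ∞ (extendZero (f : U → ℝ)) U := f.2

theorem Smooth.differentiableAt (f : Smooth U) (x : U) :
    DifferentiableAt ℝ (extendZero (f : U → ℝ)) x :=
  (f.contDiffOn.differentiableOn (by simp)).differentiableAt (U.isOpen.mem_nhds x.2)

theorem extendZero_eventuallyEq {f : U → ℝ} {g : (Fin n → ℝ) → ℝ} (x : U)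
    (h : ∀ y : U, f y = g y) : extendZero f =ᶠ[nhds (x : Fin n → ℝ)] g := by
  filter_upwards [U.isOpen.mem_nhds x.2] with y hy
  exact (extendZero_apply f ⟨y, hy⟩).trans (h ⟨y, hy⟩)

/-- The partial derivative `∂_μ f` of a smooth function on `U`. -/
def pdFun (μ : Fin n) (f : Smooth U) : Smooth U :=
  ⟨fun x => fderiv ℝ (extendZero (f : U → ℝ)) x (Pi.single μ (1 : ℝ)), by
    have h1 : ContDiffOn ℝ ∞ (fderiv ℝ (extendZero (f : U → ℝ))) U :=
      f.contDiffOn.fderiv_of_isOpen U.isOpen (by simp)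
    have h2 : ContDiffOn ℝ ∞
        (fun x => fderiv ℝ (extendZero (f : U → ℝ)) x (Pi.single μ (1 : ℝ))) U :=
      h1.clm_apply contDiffOn_const
    refine h2.congr ?_
    intro x hx
    exact extendZero_apply _ (⟨x, hx⟩ : U)⟩

theorem pdFun_apply (μ : Fin n) (f : Smooth U) (x : U) :
    (pdFun μ f : U → ℝ) x = fderiv ℝ (extendZero (f : U → ℝ)) x (Pi.single μ (1 : ℝ)) := rfl

/-- The partial derivative `∂_μ` as a derivation of `C^∞(U)`. -/
def pd (μ : Fin n) : Derivation ℝ (Smooth U) (Smooth U) :=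
  Derivation.mk'
    { toFun := pdFun μ
      map_add' := by
        intro f g
        apply Subtype.ext
        funext x
        have h := (extendZero_eventuallyEq (f := ((f + g : Smooth U) : U → ℝ))
          (g := extendZero (f : U → ℝ) + extendZero (g : U → ℝ)) x
          (by intro y; simp [extendZero_apply])).fderiv_eq (𝕜 := ℝ)
        simp only [pdFun_apply, h]
        rw [fderiv_add (f.differentiableAt x) (g.differentiableAt x)]
        rfl
      map_smul' := by
        intro c f
        apply Subtype.ext
        funext x
        have h := (extendZero_eventuallyEq (f := ((c • f : Smooth U) : U → ℝ))
          (g := c • extendZero (f : U → ℝ)) x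
          (by intro y; simp [extendZero_apply])).fderiv_eq (𝕜 := ℝ)
        simp only [pdFun_apply, h]
        rw [fderiv_const_smul (f.differentiableAt x) c]
        rfl }
    (by
      intro f g
      apply Subtype.ext
      funext x
      have h := (extendZero_eventuallyEq (f := ((f * g : Smooth U) : U → ℝ))
        (g := extendZero (f : U → ℝ) * extendZero (g : U → ℝ)) x
        (by intro y; simp [extendZero_apply])).fderiv_eq (𝕜 := ℝ)
      change (pdFun μ (f * g) : U → ℝ) x = _
      rw [pdFun_apply, h, fderiv_mul (f.differentiableAt x) (g.differentiableAt x)]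
      simp [extendZero_apply, pdFun_apply])

/-- The coordinate function `x^μ` on `U`. -/
def coord (U : TopologicalSpace.Opens (Fin n → ℝ)) (μ : Fin n) : Smooth U :=
  ⟨fun x => (x : Fin n → ℝ) μ, by
    refine (contDiff_apply ℝ ℝ μ).contDiffOn.congr ?_
    intro x hx
    exact extendZero_apply _ (⟨x, hx⟩ : U)⟩

/-! ### Free bigraded-commutative algebras

All objects carry a bidegree `(form degree, ghost degree)`; the sign rule is Deligne's:
`x y = (-1)^(f f' + g g') y x` for bidegrees `(f, g)` of `x` and `(f', g')` of `y`. -/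

/-- The commutation sign `(-1)^(p₁ q₁ + p₂ q₂)` of objects of bidegrees `p` and `q`. -/
def sgn (p q : ℤ × ℤ) : ℤˣ := Int.negOnePow (p.1 * q.1 + p.2 * q.2)

theorem sgn_comm (p q : ℤ × ℤ) : sgn p q = sgn q p := by
  unfold sgn
  rw [mul_comm p.1, mul_comm p.2]

theorem sgn_add_left (p p' q : ℤ × ℤ) : sgn (p + p') q = sgn p q * sgn p' q := by
  unfold sgn
  rw [← Int.negOnePow_add]
  congr 1
  simp only [Prod.fst_add, Prod.snd_add]
  ring

theorem sgn_mul_self (p q : ℤ × ℤ) : sgn p q * sgn p q = 1 :=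
  Int.units_mul_self _

section GradedAlgebra

variable {R : Type} [CommRing R] {ι : Type}

/-- The bigraded commutation relations between the generators. -/
inductive CommRel (R : Type) [CommRing R] {ι : Type} (deg : ι → ℤ × ℤ) :
    FreeAlgebra R ι → FreeAlgebra R ι → Prop
  | swap (i j : ι) : CommRel R deg (FreeAlgebra.ι R i * FreeAlgebra.ι R j)
      (sgn (deg i) (deg j) • (FreeAlgebra.ι R j * FreeAlgebra.ι R i))

/-- The free bigraded-commutative algebra over `R` (sitting in bidegree `(0, 0)`) on generators
of prescribed bidegrees. -/
def GCAlg (R : Type) [CommRing R] {ι : Type} (deg : ι → ℤ × ℤ) : Type :=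
  RingQuot (CommRel R deg)

variable {deg : ι → ℤ × ℤ}

instance : Ring (GCAlg R deg) := inferInstanceAs (Ring (RingQuot (CommRel R deg)))

instance : Algebra R (GCAlg R deg) := inferInstanceAs (Algebra R (RingQuot (CommRel R deg)))

instance [Algebra ℝ R] : Algebra ℝ (GCAlg R deg) :=
  inferInstanceAs (Algebra ℝ (RingQuot (CommRel R deg)))

instance [Algebra ℝ R] : IsScalarTower ℝ R (GCAlg R deg) :=
  inferInstanceAs (IsScalarTower ℝ R (RingQuot (CommRel R deg)))

/-- The projection from the free algebra. -/
def GCAlg.mk (R : Type) [CommRing R] {ι : Type} (deg : ι → ℤ × ℤ) :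
    FreeAlgebra R ι →ₐ[R] GCAlg R deg :=
  RingQuot.mkAlgHom R (CommRel R deg)

/-- The generators. -/
def gen (R : Type) [CommRing R] {ι : Type} (deg : ι → ℤ × ℤ) (i : ι) : GCAlg R deg :=
  GCAlg.mk R deg (FreeAlgebra.ι R i)

theorem gen_mul_gen (i j : ι) :
    gen R deg i * gen R deg j = sgn (deg i) (deg j) • (gen R deg j * gen R deg i) := by
  have h : GCAlg.mk R deg _ = GCAlg.mk R deg _ :=
    RingQuot.mkAlgHom_rel R (CommRel.swap (R := R) (deg := deg) i j)
  rw [map_mul, Units.smul_def, map_zsmul, map_mul] at h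
  exact h

theorem gcalg_induction {P : GCAlg R deg → Prop} (halg : ∀ f : R, P (algebraMap R _ f))
    (hgen : ∀ i, P (gen R deg i)) (hadd : ∀ x y, P x → P y → P (x + y))
    (hmul : ∀ x y, P x → P y → P (x * y)) (x : GCAlg R deg) : P x := by
  obtain ⟨y, rfl⟩ : ∃ y, GCAlg.mk R deg y = x :=
    RingQuot.mkAlgHom_surjective R (CommRel R deg) x
  induction y using FreeAlgebra.induction with
  | grade0 f => rw [AlgHom.commutes (GCAlg.mk R deg)]; exact halg f
  | grade1 i => exact hgen i
  | mul a b ha hb => rw [map_mul]; exact hmul _ _ ha hb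
  | add a b ha hb => rw [map_add]; exact hadd _ _ ha hb

/-- The universal property of the free bigraded-commutative algebra. -/
def lift {B : Type} [Ring B] [Algebra R B] (v : ι → B)
    (hv : ∀ i j, v i * v j = sgn (deg i) (deg j) • (v j * v i)) : GCAlg R deg →ₐ[R] B :=
  RingQuot.liftAlgHom R ⟨FreeAlgebra.lift R v, by
    rintro _ _ ⟨i, j⟩
    rw [map_mul, Units.smul_def, map_zsmul, map_mul, FreeAlgebra.lift_ι_apply,
      FreeAlgebra.lift_ι_apply, hv i j, Units.smul_def]⟩

@[simp] theorem lift_gen {B : Type} [Ring B] [Algebra R B] (v : ι → B)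
    (hv : ∀ i j, v i * v j = sgn (deg i) (deg j) • (v j * v i)) (i : ι) :
    lift v hv (gen R deg i) = v i := by
  refine (RingQuot.liftAlgHom_mkAlgHom_apply (S := R) _ _ (FreeAlgebra.ι R i)).trans ?_
  rw [FreeAlgebra.lift_ι_apply]

/-- The part of bidegree `p`: the `R`-span of the products of generators of total bidegree `p`. -/
def bideg (deg : ι → ℤ × ℤ) (p : ℤ × ℤ) : Submodule R (GCAlg R deg) :=
  Submodule.span R {x | ∃ l : List ι, (l.map deg).sum = p ∧ x = (l.map (gen R deg)).prod}

/-- The sign automorphism `x ↦ (-1)^(χ · deg x) x` picked up when an operator of bidegree `χ`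
passes `x`. -/
def twist (χ : ℤ × ℤ) : GCAlg R deg →ₐ[R] GCAlg R deg :=
  lift (fun i => sgn χ (deg i) • gen R deg i) (by
    intro i j
    simp only [smul_mul_assoc, mul_smul_comm, gen_mul_gen i j, smul_smul]
    congr 1
    generalize sgn χ (deg i) = u, sgn χ (deg j) = v, sgn (deg i) (deg j) = w
    rw [mul_left_comm v u w, mul_comm v w, mul_left_comm u w v])

@[simp] theorem twist_gen (χ : ℤ × ℤ) (i : ι) :
    twist χ (gen R deg i) = sgn χ (deg i) • gen R deg i := by
  simp [twist]

theorem mul_eq_twist_mul {p : ℤ × ℤ} {w : GCAlg R deg}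
    (hw : ∀ j, w * gen R deg j = sgn p (deg j) • (gen R deg j * w)) (x : GCAlg R deg) :
    w * x = twist p x * w := by
  induction x using gcalg_induction with
  | halg f => rw [AlgHom.commutes, ← Algebra.commutes]
  | hgen i => rw [twist_gen, hw, smul_mul_assoc]
  | hadd x y hx hy => rw [mul_add, hx, hy, map_add, add_mul]
  | hmul x y hx hy => rw [← mul_assoc, hx, mul_assoc, hy, map_mul, mul_assoc]

/-- Upper triangular matrices `[[twist χ x, y], [0, x]]`, an auxiliary ring used to construct
graded derivations from their values on generators. -/
def triRing (χ : ℤ × ℤ) : Subring (Matrix (Fin 2) (Fin 2) (GCAlg R deg)) where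
  carrier := {M | M 1 0 = 0 ∧ M 0 0 = twist χ (M 1 1)}
  mul_mem' := by
    rintro M N ⟨h1, h2⟩ ⟨h3, h4⟩
    simp [Matrix.mul_apply, Fin.sum_univ_two, h1, h2, h3, h4]
  one_mem' := by simp
  add_mem' := by
    rintro M N ⟨h1, h2⟩ ⟨h3, h4⟩
    simp [h1, h2, h3, h4]
  zero_mem' := by simp
  neg_mem' := by
    rintro M ⟨h1, h2⟩
    simp [h1, h2]

/-- The element `[[twist χ x, y], [0, x]]`. -/
def triMk (χ : ℤ × ℤ) (x y : GCAlg R deg) : triRing (R := R) (deg := deg) χ :=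
  ⟨!![twist χ x, y; 0, x], by simp [triRing]⟩

theorem triRing_ext {χ : ℤ × ℤ} {M N : triRing (R := R) (deg := deg) χ}
    (h1 : M.1 1 1 = N.1 1 1) (h2 : M.1 0 1 = N.1 0 1) : M = N := by
  obtain ⟨M, hM1, hM2⟩ := M
  obtain ⟨N, hN1, hN2⟩ := N
  apply Subtype.ext
  ext i j
  fin_cases i <;> fin_cases j
  · exact hM2.trans ((congrArg _ h1).trans hN2.symm)
  · exact h2
  · exact hM1.trans hN1.symm
  · exact h1

theorem triRing_mul_11 {χ : ℤ × ℤ} (M N : triRing (R := R) (deg := deg) χ) :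
    (M * N).1 1 1 = M.1 1 1 * N.1 1 1 := by
  have h := M.2.1
  simp [Matrix.mul_apply, Fin.sum_univ_two, h]

theorem triRing_mul_01 {χ : ℤ × ℤ} (M N : triRing (R := R) (deg := deg) χ) :
    (M * N).1 0 1 = M.1 0 1 * N.1 1 1 + twist χ (M.1 1 1) * N.1 0 1 := by
  have h := M.2.2
  simp [Matrix.mul_apply, Fin.sum_univ_two, h, add_comm]

variable [Algebra ℝ R]

/-- The `R`-algebra structure on `triRing` in which `f` acts as `[[f, δ f], [0, f]]`. -/
@[reducible] def triAlgebra (χ : ℤ × ℤ) (δ : Derivation ℝ R (GCAlg R deg))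
    (hδ : ∀ f j, δ f * gen R deg j = sgn χ (deg j) • (gen R deg j * δ f)) :
    Algebra R (triRing (R := R) (deg := deg) χ) :=
  RingHom.toAlgebra'
    { toFun := fun f => triMk χ (algebraMap R _ f) (δ f)
      map_one' := by
        apply triRing_ext <;> simp [triMk]
      map_zero' := by
        apply triRing_ext <;> simp [triMk]
      map_add' := by
        intro f g
        apply triRing_ext <;> simp [triMk]
      map_mul' := by
        intro f g
        apply triRing_ext
        · rw [triRing_mul_11]; simp [triMk]
        · rw [triRing_mul_01]
          simp only [triMk, Matrix.of_apply, Matrix.cons_val', Matrix.cons_val_zero,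
            Matrix.cons_val_one, AlgHom.commutes, Derivation.leibniz, Algebra.smul_def]
          rw [← Algebra.commutes g (δ f), add_comm] }
    (by
      intro f M
      apply triRing_ext
      · rw [triRing_mul_11, triRing_mul_11]
        exact Algebra.commutes f (M.1 1 1)
      · rw [triRing_mul_01, triRing_mul_01]
        have h := mul_eq_twist_mul (hδ f) (M.1 1 1)
        have h2 := Algebra.commutes f (M.1 0 1)
        simp only [RingHom.coe_mk, MonoidHom.coe_mk, OneHom.coe_mk, triMk, Matrix.of_apply,
          Matrix.cons_val', Matrix.cons_val_zero, Matrix.cons_val_one, AlgHom.commutes,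
          Matrix.cons_val_fin_one]
        rw [h, h2, add_comm])

/-- The ring homomorphism `x ↦ [[twist χ x, D x], [0, x]]` that encodes a graded derivation `D`. -/
def gderHom (χ : ℤ × ℤ) (δ : Derivation ℝ R (GCAlg R deg)) (v : ι → GCAlg R deg)
    (hδ : ∀ f j, δ f * gen R deg j = sgn χ (deg j) • (gen R deg j * δ f))
    (hv : ∀ i j, v i * gen R deg j = sgn (χ + deg i) (deg j) • (gen R deg j * v i)) :
    GCAlg R deg →+* triRing (R := R) (deg := deg) χ :=
  letI := triAlgebra χ δ hδ
  (lift (R := R) (fun i => triMk χ (gen R deg i) (v i)) (by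
    intro i j
    rw [Units.smul_def]
    apply triRing_ext
    · rw [triRing_mul_11]
      have h := triRing_mul_11 (triMk χ (gen R deg j) (v j)) (triMk χ (gen R deg i) (v i))
      have h' := gen_mul_gen (R := R) (deg := deg) i j
      rw [Units.smul_def] at h'
      rw [show (((sgn (deg i) (deg j) : ℤˣ) : ℤ) • (triMk χ (gen R deg j) (v j) *
        triMk χ (gen R deg i) (v i))).1 1 1 = ((sgn (deg i) (deg j) : ℤˣ) : ℤ) •
        ((triMk χ (gen R deg j) (v j) * triMk χ (gen R deg i) (v i)).1 1 1) from rfl, h]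
      simpa [triMk] using h'
    · rw [triRing_mul_01]
      have h := triRing_mul_01 (triMk χ (gen R deg j) (v j)) (triMk χ (gen R deg i) (v i))
      rw [show (((sgn (deg i) (deg j) : ℤˣ) : ℤ) • (triMk χ (gen R deg j) (v j) *
        triMk χ (gen R deg i) (v i))).1 0 1 = ((sgn (deg i) (deg j) : ℤˣ) : ℤ) •
        ((triMk χ (gen R deg j) (v j) * triMk χ (gen R deg i) (v i)).1 0 1) from rfl, h]
      have e1 := hv i j
      have e2 := hv j i
      simp only [triMk, Matrix.of_apply, Matrix.cons_val', Matrix.cons_val_zero,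
        Matrix.cons_val_one, Matrix.cons_val_fin_one, twist_gen, e1, e2, ← Units.smul_def,
        smul_mul_assoc]
      rw [sgn_add_left, sgn_add_left, sgn_comm (deg j) (deg i)]
      generalize sgn χ (deg i) = a, sgn χ (deg j) = b, sgn (deg i) (deg j) = c
      rcases Int.units_eq_one_or a with rfl | rfl <;> rcases Int.units_eq_one_or b with rfl | rfl <;>
        rcases Int.units_eq_one_or c with rfl | rfl <;> simp [Units.smul_def] <;> abel)).toRingHom

theorem gderHom_gen (χ : ℤ × ℤ) (δ : Derivation ℝ R (GCAlg R deg)) (v : ι → GCAlg R deg)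
    (hδ : ∀ f j, δ f * gen R deg j = sgn χ (deg j) • (gen R deg j * δ f))
    (hv : ∀ i j, v i * gen R deg j = sgn (χ + deg i) (deg j) • (gen R deg j * v i)) (i : ι) :
    gderHom χ δ v hδ hv (gen R deg i) = triMk χ (gen R deg i) (v i) := by
  let _ := triAlgebra χ δ hδ
  exact lift_gen (R := R) (fun i => triMk χ (gen R deg i) (v i)) _ i

theorem gderHom_algebraMap (χ : ℤ × ℤ) (δ : Derivation ℝ R (GCAlg R deg)) (v : ι → GCAlg R deg)
    (hδ : ∀ f j, δ f * gen R deg j = sgn χ (deg j) • (gen R deg j * δ f))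
    (hv : ∀ i j, v i * gen R deg j = sgn (χ + deg i) (deg j) • (gen R deg j * v i)) (f : R) :
    gderHom χ δ v hδ hv (algebraMap R _ f) = triMk χ (algebraMap R _ f) (δ f) := by
  let _ := triAlgebra χ δ hδ
  exact AlgHom.commutes (lift (R := R) (fun i => triMk χ (gen R deg i) (v i)) _) f

theorem gderHom_11 (χ : ℤ × ℤ) (δ : Derivation ℝ R (GCAlg R deg)) (v : ι → GCAlg R deg)
    (hδ : ∀ f j, δ f * gen R deg j = sgn χ (deg j) • (gen R deg j * δ f))
    (hv : ∀ i j, v i * gen R deg j = sgn (χ + deg i) (deg j) • (gen R deg j * v i))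
    (x : GCAlg R deg) : (gderHom χ δ v hδ hv x).1 1 1 = x := by
  induction x using gcalg_induction with
  | halg f => rw [gderHom_algebraMap]; simp [triMk]
  | hgen i => rw [gderHom_gen]; simp [triMk]
  | hadd x y hx hy =>
    rw [map_add]
    exact congrArg₂ (· + ·) hx hy
  | hmul x y hx hy => rw [map_mul, triRing_mul_11, hx, hy]

/-- The graded derivation of bidegree `χ` with prescribed values `δ` on `R` and `v` on the
generators. -/
def gder (χ : ℤ × ℤ) (δ : Derivation ℝ R (GCAlg R deg)) (v : ι → GCAlg R deg)
    (hδ : ∀ f j, δ f * gen R deg j = sgn χ (deg j) • (gen R deg j * δ f))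
    (hv : ∀ i j, v i * gen R deg j = sgn (χ + deg i) (deg j) • (gen R deg j * v i)) :
    GCAlg R deg →ₗ[ℝ] GCAlg R deg where
  toFun x := (gderHom χ δ v hδ hv x).1 0 1
  map_add' x y := by rw [map_add]; rfl
  map_smul' c x := by
    have h : c • x = algebraMap R (GCAlg R deg) (algebraMap ℝ R c) * x := by
      rw [← Algebra.smul_def, algebraMap_smul]
    rw [h, map_mul, triRing_mul_01, gderHom_11, gderHom_11, gderHom_algebraMap]
    simp only [triMk, Derivation.map_algebraMap, Matrix.of_apply, Matrix.cons_val',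
      Matrix.cons_val_zero, Matrix.cons_val_one, Matrix.cons_val_fin_one, zero_mul, zero_add,
      AlgHom.commutes, RingHom.id_apply]
    rw [← Algebra.smul_def, algebraMap_smul]

section gderLemmas

variable (χ : ℤ × ℤ) (δ : Derivation ℝ R (GCAlg R deg)) (v : ι → GCAlg R deg)
    (hδ : ∀ f j, δ f * gen R deg j = sgn χ (deg j) • (gen R deg j * δ f))
    (hv : ∀ i j, v i * gen R deg j = sgn (χ + deg i) (deg j) • (gen R deg j * v i))

theorem gder_gen (i : ι) : gder χ δ v hδ hv (gen R deg i) = v i := by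
  change (gderHom χ δ v hδ hv (gen R deg i)).1 0 1 = v i
  rw [gderHom_gen]; simp [triMk]

theorem gder_algebraMap (f : R) : gder χ δ v hδ hv (algebraMap R _ f) = δ f := by
  change (gderHom χ δ v hδ hv (algebraMap R _ f)).1 0 1 = δ f
  rw [gderHom_algebraMap]; simp [triMk]

theorem gder_mul (x y : GCAlg R deg) :
    gder χ δ v hδ hv (x * y) = gder χ δ v hδ hv x * y + twist χ x * gder χ δ v hδ hv y := by
  change (gderHom χ δ v hδ hv (x * y)).1 0 1 = _
  rw [map_mul, triRing_mul_01, gderHom_11, gderHom_11]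
  rfl

end gderLemmas

end GradedAlgebra

/-! ### The graded target manifold and its homological vector field -/

/-- The collective index `α` of the target coordinates `x^α = (x^μ, a^a, b_μ)`. -/
abbrev Idx (n r : ℕ) : Type := Fin n ⊕ Fin r ⊕ Fin n

/-- The index of `x^μ`. -/
abbrev ix (μ : Fin n) : Idx n r := Sum.inl μ
/-- The index of `a^a`. -/
abbrev ia (a : Fin r) : Idx n r := Sum.inr (Sum.inl a)
/-- The index of `b_μ`. -/
abbrev ib (μ : Fin n) : Idx n r := Sum.inr (Sum.inr μ)

/-- The degree `|α|` of the target coordinate `x^α`: `0` for `x^μ`, `1` for `a^a`, `2` for `b_μ`. -/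
def tdeg : Idx n r → ℤ
  | Sum.inl _ => 0
  | Sum.inr (Sum.inl _) => 1
  | Sum.inr (Sum.inr _) => 2

/-- Bidegrees of the generators `a^a` and `b_μ` of the functions on the target. -/
def targetDeg : Fin r ⊕ Fin n → ℤ × ℤ
  | Sum.inl _ => (1, 0)
  | Sum.inr _ => (2, 0)

/-- Functions on the graded target manifold over the patch `U`: the free graded-commutative
`C^∞(U)`-algebra on `a^a` (degree 1) and `b_μ` (degree 2). -/
abbrev Target (U : TopologicalSpace.Opens (Fin n → ℝ)) (r : ℕ) : Type :=
  GCAlg (Smooth U) (targetDeg (n := n) (r := r))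

/-- The coordinate `a^a`. -/
def ta (U : TopologicalSpace.Opens (Fin n → ℝ)) (a : Fin r) : Target U r :=
  gen (Smooth U) targetDeg (Sum.inl a)

/-- The coordinate `b_μ`. -/
def tb (U : TopologicalSpace.Opens (Fin n → ℝ)) (r : ℕ) (μ : Fin n) : Target U r :=
  gen (Smooth U) targetDeg (Sum.inr μ)

/-- The partial derivative `∂_β = ∂/∂x^β` on functions of the target, a left derivation of
degree `-|β|`. -/
def tder : Idx n r → (Target U r →ₗ[ℝ] Target U r)
  | Sum.inl μ => gder (0, 0)
      ((Algebra.linearMap (Smooth U) (Target U r)).compDer (pd μ)) (fun _ => 0)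
      (by intro f j; simpa [sgn] using Algebra.commutes (pd μ f) (gen (Smooth U) targetDeg j))
      (by intro i j; simp)
  | Sum.inr (Sum.inl a) => gder (-1, 0) 0 (fun i => if i = Sum.inl a then 1 else 0)
      (by intro f j; simp)
      (by
        intro i j
        by_cases h : i = Sum.inl a
        · subst h; simp [sgn, targetDeg]
        · simp [h])
  | Sum.inr (Sum.inr μ) => gder (-2, 0) 0 (fun i => if i = Sum.inr μ then 1 else 0)
      (by intro f j; simp)
      (by
        intro i j
        by_cases h : i = Sum.inr μ
        · subst h; simp [sgn, targetDeg]
        · simp [h])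

/-- A 4-form twisted Courant algebroid of rank `r` over a coordinate patch `U ⊆ ℝⁿ`, in a local
frame in which the fibre metric has constant components. `C a b c` is `C_{abc}` (all indices
lowered) and `H μ ν κ l` are the components of the 4-form. -/
structure TwistedCourantAlgebroid {n : ℕ} (U : TopologicalSpace.Opens (Fin n → ℝ)) (r : ℕ) where
  /-- fibre metric `η_{ab}` -/
  η : Matrix (Fin r) (Fin r) ℝ
  η_symm : η.IsSymm
  η_nondeg : IsUnit η.det
  /-- anchor `ρ_a^μ` -/
  ρ : Fin r → Fin n → Smooth U
  /-- structure functions `C_{abc}` of the bracket -/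
  C : Fin r → Fin r → Fin r → Smooth U
  C_swap₁ : ∀ a b c, C b a c = -C a b c
  C_swap₂ : ∀ a b c, C a c b = -C a b c
  /-- the 4-form -/
  H : Fin n → Fin n → Fin n → Fin n → Smooth U
  H_swap₁ : ∀ μ ν κ l, H ν μ κ l = -H μ ν κ l
  H_swap₂ : ∀ μ ν κ l, H μ κ ν l = -H μ ν κ l
  H_swap₃ : ∀ μ ν κ l, H μ ν l κ = -H μ ν κ l
  /-- `dH = 0` -/
  H_closed : ∀ θ μ ν κ l,
    pd θ (H μ ν κ l) - pd μ (H θ ν κ l) + pd ν (H θ μ κ l) - pd κ (H θ μ ν l)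
      + pd l (H θ μ ν κ) = 0
  /-- `η^{ab} ρ_a^μ ρ_b^ν = 0` -/
  anchor_null : ∀ μ ν, ∑ a, ∑ b, η⁻¹ a b • (ρ a μ * ρ b ν) = 0
  /-- the anchor is compatible with the brackets -/
  anchor_bracket : ∀ a b ν,
    ∑ μ, ρ b μ * pd μ (ρ a ν) - ∑ μ, ρ a μ * pd μ (ρ b ν)
      + ∑ e, ∑ f, η⁻¹ e f • (ρ e ν * C f a b) = 0
  /-- the Jacobi identity, twisted by the 4-form -/
  jacobi : ∀ a b c d,
    ∑ μ, ρ d μ * pd μ (C a b c) - ∑ μ, ρ a μ * pd μ (C b c d)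
      + ∑ μ, ρ b μ * pd μ (C c d a) - ∑ μ, ρ c μ * pd μ (C d a b)
      + ∑ e, ∑ f, η⁻¹ e f • (C e a b * C c d f + C e a c * C d b f + C e a d * C b c f)
    = -∑ μ, ∑ ν, ∑ κ, ∑ l, ρ d μ * ρ a ν * ρ b κ * ρ c l * H μ ν κ l

namespace TwistedCourantAlgebroid

variable (K : TwistedCourantAlgebroid U r)

/-- `H_{μabc} = ρ_a^ν ρ_b^κ ρ_c^l H_{μνκl}`. -/
def Hanchored (μ : Fin n) (a b c : Fin r) : Smooth U :=
  ∑ ν, ∑ κ, ∑ l, K.ρ a ν * K.ρ b κ * K.ρ c l * K.H μ ν κ l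

/-- The components `Q^α` of the homological vector field `Q^H`:
`Q^{x^μ} = ρ_a^μ a^a`,
`Q^{a^a} = -η^{ab} ρ_b^μ b_μ - ½ C^a_{bc} a^b a^c` with `C^a_{bc} = η^{ad} C_{dbc}`,
`Q^{b_μ} = -∂_μ ρ_a^ν b_ν a^a - (1/3!) (∂_μ C_{abc} + H_{μabc}) a^a a^b a^c`. -/
def Q : Idx n r → Target U r
  | Sum.inl μ => ∑ a, K.ρ a μ • ta U a
  | Sum.inr (Sum.inl a) =>
      -(∑ b, ∑ μ, (K.η⁻¹ a b • K.ρ b μ) • tb U r μ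
        + (1 / 2 : ℝ) • ∑ b, ∑ c, (∑ d, K.η⁻¹ a d • K.C d b c) • (ta U b * ta U c))
  | Sum.inr (Sum.inr μ) =>
      -(∑ a, ∑ ν, pd μ (K.ρ a ν) • (tb U r ν * ta U a)
        + (1 / 6 : ℝ) • ∑ a, ∑ b, ∑ c,
            (pd μ (K.C a b c) + K.Hanchored μ a b c) • (ta U a * ta U b * ta U c))

end TwistedCourantAlgebroid

/-! ### Local forms in the fields and ghosts of the sigma model -/

/-- Generators of the local forms on the world volume: the fields `A^a`, `B_μ`, the ghosts `ε^a`,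
`ψ_μ`, the ghosts for ghosts `ψ̃_μ`, and the exterior derivatives of all fields and ghosts
(including `X^μ`). -/
inductive FieldGen (n r : ℕ) : Type
  | A (a : Fin r) | B (μ : Fin n) | eps (a : Fin r) | psi (μ : Fin n) | psit (μ : Fin n)
  | dX (μ : Fin n)
  | dA (a : Fin r) | dB (μ : Fin n) | deps (a : Fin r) | dpsi (μ : Fin n) | dpsit (μ : Fin n)

/-- Bidegrees `(form degree, ghost degree)` of the generators. -/
def fieldDeg : FieldGen n r → ℤ × ℤ
  | .A _ => (1, 0) | .B _ => (2, 0) | .eps _ => (0, 1) | .psi _ => (1, 1) | .psit _ => (0, 2)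
  | .dX _ => (1, 0)
  | .dA _ => (2, 0) | .dB _ => (3, 0) | .deps _ => (1, 1) | .dpsi _ => (2, 1) | .dpsit _ => (1, 2)

/-- The algebra of local forms in the fields and ghosts: the free bigraded-commutative algebra
generated by the fields, ghosts and their exterior derivatives. The dependence on the scalars
`X^μ` is through smooth functions `f(X)`, `f ∈ C^∞(U)`. -/
abbrev LocalForms (U : TopologicalSpace.Opens (Fin n → ℝ)) (r : ℕ) : Type :=
  GCAlg (Smooth U) (fieldDeg (n := n) (r := r))

/-- A generator of the local forms. -/
abbrev fgen (U : TopologicalSpace.Opens (Fin n → ℝ)) (i : FieldGen n r) : LocalForms U r :=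
  gen (Smooth U) fieldDeg i

/-- The exterior derivative of `f(X)`: `d f = ∂_μ f dX^μ`. -/
def dFun (U : TopologicalSpace.Opens (Fin n → ℝ)) (r : ℕ) :
    Derivation ℝ (Smooth U) (LocalForms U r) :=
  ∑ μ, ((LinearMap.toSpanSingleton (Smooth U) (LocalForms U r) (fgen U (.dX μ))).compDer (pd μ))

theorem dFun_apply (f : Smooth U) :
    dFun U r f = ∑ μ, pd μ f • fgen (r := r) U (.dX μ) := by
  have h : ∀ (t : Finset (Fin n)) (D : Fin n → Derivation ℝ (Smooth U) (LocalForms U r)),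
      (∑ μ ∈ t, D μ) f = ∑ μ ∈ t, D μ f := fun t D =>
    map_sum (⟨⟨fun E => E f, rfl⟩, fun _ _ => rfl⟩ :
      Derivation ℝ (Smooth U) (LocalForms U r) →+ LocalForms U r) D t
  rw [dFun, h]
  rfl

/-- The values of the exterior derivative on the generators. -/
def dGen (U : TopologicalSpace.Opens (Fin n → ℝ)) : FieldGen n r → LocalForms U r
  | .A a => fgen U (.dA a)
  | .B μ => fgen U (.dB μ)
  | .eps a => fgen U (.deps a)
  | .psi μ => fgen U (.dpsi μ)
  | .psit μ => fgen U (.dpsit μ)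
  | _ => 0

/-- The exterior derivative `d` of the world volume on local forms, of bidegree `(1, 0)`. -/
def extd (U : TopologicalSpace.Opens (Fin n → ℝ)) (r : ℕ) :
    LocalForms U r →ₗ[ℝ] LocalForms U r :=
  gder (1, 0) (dFun U r) (dGen U)
    (by
      intro f j
      rw [dFun_apply, Finset.sum_mul, Finset.mul_sum, Finset.smul_sum]
      refine Finset.sum_congr rfl fun μ _ => ?_
      rw [smul_mul_assoc, gen_mul_gen, mul_smul_comm, smul_comm]
      rfl)
    (by
      intro i j
      cases i <;> simp only [dGen, zero_mul, mul_zero, smul_zero] <;>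
        exact gen_mul_gen _ _)

/-- The fields `φ^α = (X^μ, A^a, B_μ)`. -/
def phi (U : TopologicalSpace.Opens (Fin n → ℝ)) : Idx n r → LocalForms U r
  | Sum.inl μ => algebraMap (Smooth U) _ (coord U μ)
  | Sum.inr (Sum.inl a) => fgen U (.A a)
  | Sum.inr (Sum.inr μ) => fgen U (.B μ)

/-- The ghosts `ε^α = (0, ε^a, -ψ_μ)`, of bidegree `(|α| - 1, 1)`. -/
def ghost (U : TopologicalSpace.Opens (Fin n → ℝ)) : Idx n r → LocalForms U r
  | Sum.inl _ => 0
  | Sum.inr (Sum.inl a) => fgen U (.eps a)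
  | Sum.inr (Sum.inr μ) => -fgen U (.psi μ)

/-- The ghosts for ghosts `ε̃^α = (0, 0, -ψ̃_μ)`, of bidegree `(|α| - 2, 2)`. -/
def ghost2 (U : TopologicalSpace.Opens (Fin n → ℝ)) : Idx n r → LocalForms U r
  | Sum.inl _ => 0
  | Sum.inr (Sum.inl _) => 0
  | Sum.inr (Sum.inr μ) => -fgen U (.psit μ)

/-- The pull-back `φ^*` of functions on the target: `x^μ ↦ X^μ`, `a^a ↦ A^a`, `b_μ ↦ B_μ`. -/
def pull (U : TopologicalSpace.Opens (Fin n → ℝ)) (r : ℕ) : Target U r →ₐ[Smooth U] LocalForms U r :=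
  lift (fun i => match i with
    | Sum.inl a => fgen U (.A a)
    | Sum.inr μ => fgen U (.B μ))
    (by
      intro i j
      cases i <;> cases j <;> exact gen_mul_gen _ _)

/-- The sign of moving `∂_β` (bidegree `(-|β|, 0)`) past `ε^γ` (bidegree `(|γ| - 1, 1)`). -/
def passSign (β γ : Idx n r) : ℤˣ := sgn (-tdeg β, 0) (tdeg γ - 1, 1)

/-- `ε^β M_β` for a ghost-type family `ε^β` and coefficients `M_β` on the target. -/
def contr₁ (e : Idx n r → LocalForms U r) (M : Idx n r → Target U r) : LocalForms U r :=
  ∑ β, e β * pull U r (M β)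

/-- `ε^β ε^γ M_{βγ}`, with the sign that turns the case `M_{βγ} = ∂_β ∂_γ f` into
`(ε^β ∂_β) (ε^γ ∂_γ) f`, the ghosts being constants for `∂`. -/
def contr₂ (M : Idx n r → Idx n r → Target U r) : LocalForms U r :=
  ∑ β, ∑ γ, passSign β γ • (ghost U β * ghost U γ * pull U r (M β γ))

/-- `ε^β ε^γ ε^δ M_{βγδ}`, with the sign that turns the case `M_{βγδ} = ∂_β ∂_γ ∂_δ f` into
`(ε^β ∂_β) (ε^γ ∂_γ) (ε^δ ∂_δ) f`, the ghosts being constants for `∂`. -/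
def contr₃ (M : Idx n r → Idx n r → Idx n r → Target U r) : LocalForms U r :=
  ∑ β, ∑ γ, ∑ δ, (passSign β γ * passSign β δ * passSign γ δ) •
    (ghost U β * ghost U γ * ghost U δ * pull U r (M β γ δ))

/-- `ε̃^β ε^γ M_{βγ}` (no sign arises, since `ε̃^β ≠ 0` only if `|β| = 2`). -/
def contrMixed (M : Idx n r → Idx n r → Target U r) : LocalForms U r :=
  ∑ β, ∑ γ, ghost2 U β * ghost U γ * pull U r (M β γ)

/-- A BRST-type operator on local forms: a graded (left) derivation of bidegree `(0, 1)` that acts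
on functions of `X` by the chain rule and commutes with the exterior derivative. -/
structure IsBRSTOperator (s : LocalForms U r →ₗ[ℝ] LocalForms U r) : Prop where
  leibniz : ∀ x y, s (x * y) = s x * y + twist (0, 1) x * s y
  chain : ∀ f : Smooth U, s (algebraMap (Smooth U) _ f) = ∑ μ, pd μ f • s (phi U (ix μ))
  comm_d : ∀ x, s (extd U r x) = extd U r (s x)
  degree : ∀ p x, x ∈ bideg fieldDeg p → s x ∈ bideg fieldDeg (p + (0, 1))

namespace TwistedCourantAlgebroid

variable (K : TwistedCourantAlgebroid U r)

/-- The field strengths `F^α = dφ^α - φ^*(Q^α)`. The field equations are `F^α = 0`; explicitly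
`F^μ = dX^μ - ρ_a^μ A^a` and `G^a = dA^a + η^{ab} ρ_b^μ B_μ + ½ C^a_{bc} A^b A^c` for `B_μ` and
`A^a`, while the equation of `X^μ` is `F^{b_μ} = 0` up to terms proportional to `F^μ`. -/
def fieldStrength (α : Idx n r) : LocalForms U r :=
  extd U r (phi U α) - pull U r (K.Q α)

/-- The local forms that vanish on the stationary surface: the ideal generated by the field
equations and their exterior derivatives. -/
def stationaryIdeal : TwoSidedIdeal (LocalForms U r) :=
  TwoSidedIdeal.span (Set.range K.fieldStrength ∪ Set.range fun α => extd U r (K.fieldStrength α))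

/-- Weak equality `x ≈ 0`. -/
def WeaklyZero (x : LocalForms U r) : Prop := x ∈ K.stationaryIdeal

/-- Possible trivial terms `s_triv φ^α` (bidegree `(|α|, 1)`, vanishing on-shell). -/
def IsFieldTriv (τ : Idx n r → LocalForms U r) : Prop :=
  ∀ α, K.WeaklyZero (τ α) ∧ τ α ∈ bideg fieldDeg (tdeg α, 1)

/-- Possible trivial terms `s_triv ε^α` (bidegree `(|α| - 1, 2)`, vanishing on-shell). -/
def IsGhostTriv (τ : Idx n r → LocalForms U r) : Prop :=
  ∀ α, K.WeaklyZero (τ α) ∧ τ α ∈ bideg fieldDeg (tdeg α - 1, 2)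

/-- `s φ^α = dε^α + ε^β ∂_β Q^α + s_triv φ^α`. -/
def FieldLaw (s : LocalForms U r →ₗ[ℝ] LocalForms U r) (τ : Idx n r → LocalForms U r) : Prop :=
  ∀ α, s (phi U α) =
    extd U r (ghost U α) + contr₁ (ghost U) (fun β => tder β (K.Q α)) + τ α

/-- `s ε^α = dε̃^α - ε̃^β ∂_β Q^α - ½ ε^β ε^γ ∂_β ∂_γ Q^α + s_triv ε^α`. -/
def GhostLaw (s : LocalForms U r →ₗ[ℝ] LocalForms U r) (τ : Idx n r → LocalForms U r) : Prop :=
  ∀ α, s (ghost U α) =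
    extd U r (ghost2 U α) - contr₁ (ghost2 U) (fun β => tder β (K.Q α))
      - (1 / 2 : ℝ) • contr₂ (fun β γ => tder β (tder γ (K.Q α))) + τ α

/-- `s ε̃^α = ε̃^β ε^γ ∂_β ∂_γ Q^α + (1/3!) ε^β ε^γ ε^δ ∂_β ∂_γ ∂_δ Q^α`. -/
def Ghost2Law (s : LocalForms U r →ₗ[ℝ] LocalForms U r) : Prop :=
  ∀ α, s (ghost2 U α) =
    contrMixed (fun β γ => tder β (tder γ (K.Q α)))
      + (1 / 6 : ℝ) • contr₃ (fun β γ δ => tder β (tder γ (tder δ (K.Q α))))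

/-- The Lagrangian 3-form
`-B_μ dX^μ + ½ η_{ab} A^a dA^b + ρ_a^μ B_μ A^a + (1/3!) C_{abc} A^a A^b A^c`. -/
def lagrangian : LocalForms U r :=
  -∑ μ, fgen U (.B μ) * fgen U (.dX μ)
    + (1 / 2 : ℝ) • ∑ a, ∑ b, K.η a b • (fgen U (.A a) * fgen U (.dA b))
    + ∑ a, ∑ μ, K.ρ a μ • (fgen U (.B μ) * fgen U (.A a))
    + (1 / 6 : ℝ) • ∑ a, ∑ b, ∑ c, K.C a b c • (fgen U (.A a) * fgen U (.A b) * fgen U (.A c))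

/-- The Wess-Zumino 4-form `X^*H = (1/4!) H_{μνκl} dX^μ dX^ν dX^κ dX^l`. -/
def wessZumino : LocalForms U r :=
  (1 / 24 : ℝ) • ∑ μ, ∑ ν, ∑ κ, ∑ l, K.H μ ν κ l •
    (fgen U (.dX μ) * fgen U (.dX ν) * fgen U (.dX κ) * fgen U (.dX l))

/-- Invariance under `s` of the classical action `∫_Σ L + ∫_Σ̂ X^*H` on a closed membrane
`Σ = ∂Σ̂`: the variation of the Wess-Zumino term is a boundary term `dΞ`, and the integrand
`s L + Ξ` left on `Σ` is exact. -/
def ActionInvariant (s : LocalForms U r →ₗ[ℝ] LocalForms U r) : Prop :=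
  ∃ Ξ J : LocalForms U r,
    s K.wessZumino = extd U r Ξ ∧ s K.lagrangian + Ξ = extd U r J

end TwistedCourantAlgebroid

/-- The bidegree of the target coordinate `x^α`. -/
def cdeg (α : Idx n r) : ℤ × ℤ := (tdeg α, 0)

/-- Admissible coefficients with one lower index: `M^α_β` is a function on the target of degree
`|α| + 1 - |β|`, the degree of `∂_β Q^α`. -/
def IsCoeff₁ (M : Idx n r → Idx n r → Target U r) : Prop :=
  ∀ α β, M α β ∈ bideg targetDeg (tdeg α + 1 - tdeg β, 0)

/-- Admissible coefficients with two lower indices. -/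
def IsCoeff₂ (M : Idx n r → Idx n r → Idx n r → Target U r) : Prop :=
  ∀ α β γ, M α β γ ∈ bideg targetDeg (tdeg α + 1 - tdeg β - tdeg γ, 0)

/-- Admissible coefficients with three lower indices. -/
def IsCoeff₃ (M : Idx n r → Idx n r → Idx n r → Idx n r → Target U r) : Prop :=
  ∀ α β γ δ, M α β γ δ ∈ bideg targetDeg (tdeg α + 1 - tdeg β - tdeg γ - tdeg δ, 0)

/-- Graded symmetry in two lower indices, as for `∂_β ∂_γ`. -/
def IsGradedSymm₂ (M : Idx n r → Idx n r → Idx n r → Target U r) : Prop :=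
  ∀ α β γ, M α β γ = sgn (cdeg β) (cdeg γ) • M α γ β

/-- Graded symmetry in three lower indices, as for `∂_β ∂_γ ∂_δ`. -/
def IsGradedSymm₃ (M : Idx n r → Idx n r → Idx n r → Idx n r → Target U r) : Prop :=
  ∀ α β γ δ, M α β γ δ = sgn (cdeg β) (cdeg γ) • M α γ β δ ∧
    M α β γ δ = sgn (cdeg γ) (cdeg δ) • M α β δ γ

end

end TwistedCourant

open TwistedCourant

/-! The proof replaces weak equality by a computation in normal form. Let `onShell` be the algebra
map that substitutes Q^α for dφ^α and leaves fields, ghosts and differentials of ghosts alone. A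
form vanishes on-shell exactly if `onShell` kills it (`weaklyZero_iff`). That dF^α is killed as well
as F^α is the identity Q² = 0 (`vf_Q`). To obtain it, Q is expressed by the first derivatives of one
Hamiltonian `theta`, corrected by a 4-form term in Q^{b_μ}. The three algebroid axioms are the parts
of degree 2, 1 and 0 in b of a single master equation (`master`). Its derivatives give Q² = 0, where
the x-derivative also needs dH = 0.

Existence and uniqueness of the BRST operator hold because local forms are free on fields, ghosts
and their differentials. For nilpotency, d descends through `onShell` to a differential N with Nφ =
Q, and the laws without trivial terms are those of a commutator T = [Δ, N]. Here Δ is a derivation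
of bidegree (-1, 1) with φ ↦ ε ↦ 2ε̃ ↦ 0, so that Δ^k f / k! is the ghost Taylor coefficient `del₁`,
`del₂`, `del₃` of f for k = 1, 2, 3. This explains the factors ½ and 1/3! in the laws. The values of
Δ on dε and dε̃ are chosen so that [Δ, [Δ, N]] = 0 (`bracket₂_eq_zero`). Together with N² = 0 this
formally implies [T, N] = 0 and T² = 0. Trivial terms are invisible after projection, so s descends
to T and s² ≈ 0.

For the invariance of the action, dH = 0 makes the variation of the Wess-Zumino term exact
(`brst_wessZumino`). The variation of the Lagrangian is exact up to terms proportional to field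
strengths and one 4-form term (`brst_lagrangian`). Integrating the dε terms by parts, the Bianchi
identities and the symmetry of the second derivatives of `theta` cancel everything except 4-form
terms (`gauge_variation`). Writing dX = Q + F in these, the parts of order at most one in F cancel,
and the parts of order two and three are the trivial term `wzTriv` of B (`wz_cancel`).

For the uniqueness of the coefficients, a competing operator s is compared with the operator s₀
already constructed. The difference σ of their values on the ghosts contains no differentials of
ghosts, and weak nilpotency yields an equation Nσ + σ^β R_β = 0. Differentiating it with respect to
dε or dε̃ shows that σ is independent of all ghosts (`IsJetDerivative.closed_eq_zero`). Since σ is a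
polynomial without constant term in the ghosts, its graded symmetric coefficients vanish
(`closed₂_eq_zero`, `closed₃_eq_zero`). -/

namespace TwistedCourant

/-! ### Signs, bidegrees and graded derivations in free bigraded-commutative algebras. -/

section GradedLemmas

variable {R : Type} [CommRing R] {ι : Type} {deg : ι → ℤ × ℤ}

theorem sgn_add_right (p q q' : ℤ × ℤ) : sgn p (q + q') = sgn p q * sgn p q' := by
  rw [sgn_comm, sgn_add_left, sgn_comm q, sgn_comm q']

@[simp] theorem sgn_zero_left (p : ℤ × ℤ) : sgn 0 p = 1 := by simp [sgn]

@[simp] theorem sgn_zero_right (p : ℤ × ℤ) : sgn p 0 = 1 := by simp [sgn]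

theorem sgn_sum_right (χ : ℤ × ℤ) (l : List ι) :
    sgn χ (l.map deg).sum = (l.map fun i => sgn χ (deg i)).prod := by
  induction l with
  | nil => simp
  | cons i l ih => simp [sgn_add_right, ih]

theorem map_units_smul' {A B F : Type*} [AddCommGroup A] [AddCommGroup B] [FunLike F A B]
    [AddMonoidHomClass F A B] (D : F) (u : ℤˣ) (x : A) : D (u • x) = u • D x := by
  rw [Units.smul_def, Units.smul_def, map_zsmul]

theorem twist_algebraMap (χ : ℤ × ℤ) (f : R) :
    twist χ (algebraMap R (GCAlg R deg) f) = algebraMap R _ f := AlgHom.commutes _ _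

theorem algHom_ext_gen {B : Type} [Ring B] [Algebra R B] {S T : GCAlg R deg →ₐ[R] B}
    (h : ∀ i, S (gen R deg i) = T (gen R deg i)) : S = T := by
  ext x
  induction x using gcalg_induction with
  | halg f => simp
  | hgen i => exact h i
  | hadd x y hx hy => simp [hx, hy]
  | hmul x y hx hy => simp [hx, hy]

theorem twist_twist (χ χ' : ℤ × ℤ) (x : GCAlg R deg) :
    twist χ (twist χ' x) = twist (χ + χ') x := by
  have h : (twist χ).comp (twist χ') = twist (R := R) (deg := deg) (χ + χ') :=
    algHom_ext_gen fun i => by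
      simp [smul_smul, sgn_add_left, mul_comm]
  exact DFunLike.congr_fun h x

theorem twist_zero (x : GCAlg R deg) : twist 0 x = x := by
  have h : twist 0 = AlgHom.id R (GCAlg R deg) := algHom_ext_gen fun i => by simp
  exact DFunLike.congr_fun h x

theorem bideg_algebraMap (f : R) : algebraMap R (GCAlg R deg) f ∈ bideg deg 0 := by
  rw [Algebra.algebraMap_eq_smul_one]
  exact Submodule.smul_mem _ _ (Submodule.subset_span ⟨[], by simp⟩)

theorem bideg_one : (1 : GCAlg R deg) ∈ bideg deg 0 := by
  simpa using bideg_algebraMap (deg := deg) (1 : R)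

theorem bideg_gen (i : ι) : gen R deg i ∈ bideg deg (deg i) :=
  Submodule.subset_span ⟨[i], by simp⟩

theorem bideg_gen' {i : ι} {p : ℤ × ℤ} (h : deg i = p) : gen R deg i ∈ bideg deg p :=
  h ▸ bideg_gen i

theorem bideg_mul {p q s : ℤ × ℤ} {x y : GCAlg R deg} (hx : x ∈ bideg deg p)
    (hy : y ∈ bideg deg q) (h : p + q = s) : x * y ∈ bideg deg s := by
  subst h
  induction hx using Submodule.span_induction with
  | mem x hx =>
    obtain ⟨l, rfl, rfl⟩ := hx
    induction hy using Submodule.span_induction with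
    | mem y hy =>
      obtain ⟨l', rfl, rfl⟩ := hy
      exact Submodule.subset_span ⟨l ++ l', by simp⟩
    | zero => simp
    | add y y' _ _ h h' => rw [mul_add]; exact add_mem h h'
    | smul a y _ h => rw [mul_smul_comm]; exact Submodule.smul_mem _ _ h
  | zero => simp
  | add x x' _ _ h h' => rw [add_mul]; exact add_mem h h'
  | smul a x _ h => rw [smul_mul_assoc]; exact Submodule.smul_mem _ _ h

theorem bideg_units_smul {p : ℤ × ℤ} {x : GCAlg R deg} (u : ℤˣ) (hx : x ∈ bideg deg p) :
    u • x ∈ bideg deg p := by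
  rw [Units.smul_def]
  exact zsmul_mem hx _

theorem bideg_real_smul [Algebra ℝ R] {p : ℤ × ℤ} {x : GCAlg R deg} (c : ℝ)
    (hx : x ∈ bideg deg p) : c • x ∈ bideg deg p := by
  rw [← algebraMap_smul R c x]
  exact Submodule.smul_mem _ _ hx

/-- Products of homogeneous elements are homogeneous, so the homogeneous parts span the algebra.
Directness of the sum is not needed: additive identities with signs can be checked on homogeneous
elements. -/
theorem bideg_induction {P : GCAlg R deg → Prop} (hadd : ∀ x y, P x → P y → P (x + y))
    (hbideg : ∀ p, ∀ x ∈ bideg deg p, P x) (x : GCAlg R deg) : P x := by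
  have h : x ∈ ⨆ p, bideg (R := R) deg p := by
    induction x using gcalg_induction with
    | halg f => exact Submodule.mem_iSup_of_mem 0 (bideg_algebraMap f)
    | hgen i => exact Submodule.mem_iSup_of_mem (deg i) (bideg_gen i)
    | hadd x y hx hy => exact add_mem hx hy
    | hmul x y hx hy =>
      induction hx using Submodule.iSup_induction' with
      | mem p x hx =>
        induction hy using Submodule.iSup_induction' with
        | mem q y hy => exact Submodule.mem_iSup_of_mem (p + q) (bideg_mul hx hy rfl)
        | zero => simp
        | add y y' _ _ h h' => rw [mul_add]; exact add_mem h h'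
      | zero => simp
      | add x x' _ _ h h' => rw [add_mul]; exact add_mem h h'
  induction h using Submodule.iSup_induction' with
  | mem p x hx => exact hbideg p x hx
  | zero => exact hbideg 0 0 (zero_mem _)
  | add x y _ _ hx hy => exact hadd _ _ hx hy

theorem twist_of_mem {χ p : ℤ × ℤ} {x : GCAlg R deg} (hx : x ∈ bideg deg p) :
    twist χ x = sgn χ p • x := by
  induction hx using Submodule.span_induction with
  | mem x hx =>
    obtain ⟨l, rfl, rfl⟩ := hx
    rw [sgn_sum_right]
    induction l with
    | nil => simp
    | cons i l ih =>
      simp only [List.map_cons, List.prod_cons, map_mul, twist_gen, ih, smul_mul_assoc,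
        mul_smul_comm, smul_smul]
      congr 1
      exact mul_comm _ _
  | zero => simp
  | add x y _ _ hx hy => rw [map_add, hx, hy, smul_add]
  | smul a x _ hx => rw [map_smul, hx, smul_comm]

/-- For a product of generators the sign is collected one generator at a time, each step being the
defining relation. The second factor need not be homogeneous, because `twist` records the sign
termwise. -/
theorem mul_of_mem {p : ℤ × ℤ} {w : GCAlg R deg} (hw : w ∈ bideg deg p) (x : GCAlg R deg) :
    w * x = twist p x * w := by
  induction hw using Submodule.span_induction with
  | mem w hw =>
    obtain ⟨l, rfl, rfl⟩ := hw
    induction l generalizing x with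
    | nil => simp only [List.map_nil, List.prod_nil, List.sum_nil]; rw [twist_zero]; simp
    | cons i l ih =>
      simp only [List.map_cons, List.prod_cons, List.sum_cons]
      rw [mul_assoc, ih, ← mul_assoc, mul_eq_twist_mul (fun j => gen_mul_gen i j), twist_twist,
        mul_assoc]
  | zero => simp
  | add w w' _ _ h h' => rw [add_mul, h, h', mul_add]
  | smul a w _ h => rw [smul_mul_assoc, h, mul_smul_comm]

theorem mul_comm_of_mem {p q : ℤ × ℤ} {x y : GCAlg R deg} (hx : x ∈ bideg deg p)
    (hy : y ∈ bideg deg q) : x * y = sgn p q • (y * x) := by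
  rw [mul_of_mem hx, twist_of_mem hy, smul_mul_assoc]

theorem sgn_of_even {p : ℤ × ℤ} (h₁ : Even p.1) (h₂ : Even p.2) (q : ℤ × ℤ) : sgn p q = 1 :=
  Int.negOnePow_even _ ((h₁.mul_right _).add (h₂.mul_right _))

theorem twist_of_even {p : ℤ × ℤ} (h₁ : Even p.1) (h₂ : Even p.2) (x : GCAlg R deg) :
    twist p x = x := by
  have h : twist p = AlgHom.id R (GCAlg R deg) := algHom_ext_gen fun i => by
    simp [sgn_of_even h₁ h₂]
  exact DFunLike.congr_fun h x

theorem even_mul_comm {p : ℤ × ℤ} (h₁ : Even p.1) (h₂ : Even p.2) {x : GCAlg R deg}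
    (hx : x ∈ bideg deg p) (y : GCAlg R deg) : x * y = y * x := by
  rw [mul_of_mem hx, twist_of_even h₁ h₂]

theorem bideg_map {κ : Type} {deg' : κ → ℤ × ℤ} {F : GCAlg R deg →ₐ[R] GCAlg R deg'}
    (hF : ∀ i, F (gen R deg i) ∈ bideg deg' (deg i)) {p : ℤ × ℤ} {x : GCAlg R deg}
    (hx : x ∈ bideg deg p) : F x ∈ bideg deg' p := by
  induction hx using Submodule.span_induction with
  | mem x hx =>
    obtain ⟨l, rfl, rfl⟩ := hx
    induction l with
    | nil => simpa using bideg_one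
    | cons i l ih =>
      simp only [List.map_cons, List.prod_cons, List.sum_cons, map_mul]
      exact bideg_mul (hF i) ih rfl
  | zero => rw [map_zero]; exact zero_mem _
  | add x y _ _ hx hy => rw [map_add]; exact add_mem hx hy
  | smul a x _ hx => rw [map_smul]; exact Submodule.smul_mem _ _ hx

theorem twist_map {κ : Type} {deg' : κ → ℤ × ℤ} {F : GCAlg R deg →ₐ[R] GCAlg R deg'}
    (hF : ∀ i, F (gen R deg i) ∈ bideg deg' (deg i)) (χ : ℤ × ℤ) (x : GCAlg R deg) :
    twist χ (F x) = F (twist χ x) := by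
  have h : (twist χ).comp F = F.comp (twist χ) := algHom_ext_gen fun i => by
    rw [AlgHom.comp_apply, AlgHom.comp_apply, twist_gen, twist_of_mem (hF i), map_units_smul']
  exact DFunLike.congr_fun h x

/-- A product of generators has the sum of their form degrees, which cannot be negative. For local
forms this disposes of all components that the grading does not allow. -/
theorem bideg_eq_zero {p : ℤ × ℤ} (hdeg : ∀ i, 0 ≤ (deg i).1) (hp : p.1 < 0) {x : GCAlg R deg}
    (hx : x ∈ bideg deg p) : x = 0 := by
  induction hx using Submodule.span_induction with
  | mem x hx =>
    obtain ⟨l, rfl, rfl⟩ := hx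
    exfalso
    refine absurd hp (not_lt.mpr ?_)
    induction l with
    | nil => simp
    | cons i l ih => simpa using add_nonneg (hdeg i) (ih (lt_of_not_ge fun h => by
        have := hdeg i
        simp at hp
        omega))
  | zero => rfl
  | add x y _ _ hx hy => rw [hx, hy, add_zero]
  | smul a x _ hx => rw [hx, smul_zero]

/-- Maps that satisfy a Leibniz rule over the same pair of maps agree if they agree on scalars and
on generators. -/
theorem derivation_ext {B F G : Type*} [Ring B] [FunLike F (GCAlg R deg) B]
    [AddMonoidHomClass F (GCAlg R deg) B] [FunLike G (GCAlg R deg) B]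
    [AddMonoidHomClass G (GCAlg R deg) B] {S : F} {T : G} (a b : GCAlg R deg → B)
    (hS : ∀ x y, S (x * y) = S x * a y + b x * S y)
    (hT : ∀ x y, T (x * y) = T x * a y + b x * T y)
    (halg : ∀ f, S (algebraMap R _ f) = T (algebraMap R _ f))
    (hgen : ∀ i, S (gen R deg i) = T (gen R deg i)) (x : GCAlg R deg) : S x = T x := by
  induction x using gcalg_induction with
  | halg f => exact halg f
  | hgen i => exact hgen i
  | hadd x y hx hy => rw [map_add, map_add, hx, hy]
  | hmul x y hx hy => rw [hS, hT, hx, hy]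

theorem comm_gen_of_mem {p : ℤ × ℤ} {w : GCAlg R deg} (hw : w ∈ bideg deg p) (j : ι) :
    w * gen R deg j = sgn p (deg j) • (gen R deg j * w) :=
  mul_comm_of_mem hw (bideg_gen j)

variable [Algebra ℝ R]

/-- A graded derivation of bidegree `χ`. -/
structure IsGDer (χ : ℤ × ℤ) (D : GCAlg R deg →ₗ[ℝ] GCAlg R deg) : Prop where
  leibniz : ∀ x y, D (x * y) = D x * y + twist χ x * D y
  degree : ∀ {p x}, x ∈ bideg deg p → D x ∈ bideg deg (p + χ)

theorem isGDer_of_gen {χ : ℤ × ℤ} {D : GCAlg R deg →ₗ[ℝ] GCAlg R deg}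
    (leibniz : ∀ x y, D (x * y) = D x * y + twist χ x * D y)
    (halg : ∀ f, D (algebraMap R _ f) ∈ bideg deg χ)
    (hgen : ∀ i, D (gen R deg i) ∈ bideg deg (deg i + χ)) : IsGDer χ D := by
  refine ⟨leibniz, fun {p x} hx => ?_⟩
  induction hx using Submodule.span_induction with
  | mem x hx =>
    obtain ⟨l, rfl, rfl⟩ := hx
    induction l with
    | nil => simpa using halg 1
    | cons i l ih =>
      simp only [List.map_cons, List.prod_cons, List.sum_cons, leibniz]
      refine add_mem (bideg_mul (hgen i) (Submodule.subset_span ⟨l, rfl, rfl⟩) (by abel))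
        (bideg_mul ?_ ih (add_assoc _ _ _).symm)
      rw [twist_gen]
      exact bideg_units_smul _ (bideg_gen i)
  | zero => simp
  | add x y _ _ hx hy => rw [map_add]; exact add_mem hx hy
  | smul a x hx' hx =>
    rw [Algebra.smul_def, leibniz]
    refine add_mem (bideg_mul (halg a) hx' (add_comm _ _)) ?_
    rw [twist_algebraMap, ← Algebra.smul_def]
    exact Submodule.smul_mem _ _ hx

theorem isGDer_gder {χ : ℤ × ℤ} {δ : Derivation ℝ R (GCAlg R deg)} {v : ι → GCAlg R deg}
    (hδ : ∀ f j, δ f * gen R deg j = sgn χ (deg j) • (gen R deg j * δ f))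
    (hv : ∀ i j, v i * gen R deg j = sgn (χ + deg i) (deg j) • (gen R deg j * v i))
    (hδ' : ∀ f, δ f ∈ bideg deg χ) (hv' : ∀ i, v i ∈ bideg deg (deg i + χ)) :
    IsGDer χ (gder χ δ v hδ hv) :=
  isGDer_of_gen (gder_mul χ δ v hδ hv) (fun f => by rw [gder_algebraMap]; exact hδ' f)
    (fun i => by rw [gder_gen]; exact hv' i)

/-- The graded derivation with prescribed values of the right bidegree. -/
theorem exists_gder (χ : ℤ × ℤ) (δ : Derivation ℝ R (GCAlg R deg)) (v : ι → GCAlg R deg)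
    (hδ : ∀ f, δ f ∈ bideg deg χ) (hv : ∀ i, v i ∈ bideg deg (deg i + χ)) :
    ∃ D : GCAlg R deg →ₗ[ℝ] GCAlg R deg, IsGDer χ D ∧ (∀ f, D (algebraMap R _ f) = δ f) ∧
      ∀ i, D (gen R deg i) = v i :=
  ⟨gder χ δ v (fun f j => comm_gen_of_mem (hδ f) j)
    (fun i j => add_comm (deg i) χ ▸ comm_gen_of_mem (hv i) j),
    isGDer_gder _ _ hδ hv, gder_algebraMap _ _ _ _ _, gder_gen _ _ _ _ _⟩

namespace IsGDer

variable {χ χ' : ℤ × ℤ} {D D' : GCAlg R deg →ₗ[ℝ] GCAlg R deg}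

theorem map_one (h : IsGDer χ D) : D 1 = 0 := by
  have := h.leibniz 1 1
  simpa using this

theorem smul_eq (h : IsGDer χ D) (f : R) (x : GCAlg R deg) :
    D (f • x) = D (algebraMap R _ f) * x + f • D x := by
  rw [Algebra.smul_def, h.leibniz, twist_algebraMap, ← Algebra.smul_def]

theorem twist_apply (h : IsGDer χ D) (θ : ℤ × ℤ) (x : GCAlg R deg) :
    twist θ (D x) = sgn θ χ • D (twist θ x) := by
  induction x using bideg_induction with
  | hadd x y hx hy => simp only [map_add, hx, hy, smul_add]
  | hbideg p x hx =>
    rw [twist_of_mem (h.degree hx), twist_of_mem hx, map_units_smul', smul_smul, sgn_add_right,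
      mul_comm]

theorem mul_of_mem' (h : IsGDer χ D) {p : ℤ × ℤ} {x : GCAlg R deg} (hx : x ∈ bideg deg p)
    (y : GCAlg R deg) : D (x * y) = D x * y + sgn χ p • (x * D y) := by
  rw [h.leibniz, twist_of_mem hx, smul_mul_assoc]

/-- The mixed terms, in which D hits one factor and D' the other, occur with opposite signs and
cancel. Hence identities such as d² = 0, N² = 0, [s, d] = 0 or [Δ, [Δ, N]] = 0 only have to be
verified on generators. -/
theorem gcomm (h : IsGDer χ D) (h' : IsGDer χ' D') :
    IsGDer (χ + χ') (D ∘ₗ D' - (sgn χ χ' : ℤ) • (D' ∘ₗ D)) := by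
  have key : ∀ x, (D ∘ₗ D' - (sgn χ χ' : ℤ) • (D' ∘ₗ D)) x =
      D (D' x) - sgn χ χ' • D' (D x) := fun x => rfl
  refine ⟨fun x y => ?_, fun {p x} hx => ?_⟩
  · simp only [key, h.leibniz, h'.leibniz, map_add, twist_twist, h.twist_apply, h'.twist_apply,
      smul_add, smul_smul, smul_mul_assoc, sub_mul, mul_sub, mul_smul_comm,
      add_comm χ' χ, sgn_mul_self, sgn_comm χ' χ, one_smul]
    abel
  · rw [key]
    refine sub_mem ?_ (bideg_units_smul _ ?_)
    · rw [add_comm χ, ← add_assoc]; exact h.degree (h'.degree hx)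
    · rw [← add_assoc]; exact h'.degree (h.degree hx)

theorem sub (h : IsGDer χ D) (h' : IsGDer χ D') : IsGDer χ (D - D') := by
  refine ⟨fun x y => ?_, fun hx => sub_mem (h.degree hx) (h'.degree hx)⟩
  simp only [LinearMap.sub_apply, h.leibniz, h'.leibniz, sub_mul, mul_sub]
  abel

theorem ext (h : IsGDer χ D) (h' : IsGDer χ D')
    (halg : ∀ f, D (algebraMap R _ f) = D' (algebraMap R _ f))
    (hgen : ∀ i, D (gen R deg i) = D' (gen R deg i)) : D = D' :=
  LinearMap.ext <| derivation_ext id (twist χ) h.leibniz h'.leibniz halg hgen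

theorem eq_zero (h : IsGDer χ D) (halg : ∀ f, D (algebraMap R _ f) = 0)
    (hgen : ∀ i, D (gen R deg i) = 0) : D = 0 :=
  LinearMap.ext <| derivation_ext id (twist χ) h.leibniz (T := (0 : GCAlg R deg →ₗ[ℝ] GCAlg R deg))
    (by simp) (by simpa using halg) (by simpa using hgen)

end IsGDer

end GradedLemmas

/-! ### Smooth functions on the patch, functions on the target, and their pull-back. -/

noncomputable section

local instance {n : ℕ} {U : TopologicalSpace.Opens (Fin n → ℝ)} :
    @Algebra ℝ (Smooth U) _ (smoothSubalgebra U).toCommRing.toCommSemiring.toSemiring :=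
  Subalgebra.algebra _

local instance {n r : ℕ} {U : TopologicalSpace.Opens (Fin n → ℝ)} :
    Module ℝ (LocalForms U r) := inferInstance

local instance {n r : ℕ} {U : TopologicalSpace.Opens (Fin n → ℝ)} :
    Module ℝ (Target U r) := inferInstance

local instance {n r : ℕ} {U : TopologicalSpace.Opens (Fin n → ℝ)} :
    Module (Smooth U) (LocalForms U r) := inferInstance

local instance {n r : ℕ} {U : TopologicalSpace.Opens (Fin n → ℝ)} :
    Module (Smooth U) (Target U r) := inferInstance

section

variable {n r : ℕ} {U : TopologicalSpace.Opens (Fin n → ℝ)}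

/-- Symmetry of the second Fréchet derivative. The extension by zero is smooth near each point of
the open set U, so iterated partial derivatives there are values of that bilinear form. -/
theorem pd_comm (μ ν : Fin n) (f : Smooth U) : pd μ (pd ν f) = pd ν (pd μ f) := by
  have key : ∀ (μ ν : Fin n) (x : U), (pd μ (pd ν f) : U → ℝ) x =
      fderiv ℝ (fderiv ℝ (extendZero (f : U → ℝ))) x (Pi.single μ 1) (Pi.single ν 1) := by
    intro μ ν x
    have h := (extendZero_eventuallyEq (f := (pdFun ν f : U → ℝ))
      (g := fun y => fderiv ℝ (extendZero (f : U → ℝ)) y (Pi.single ν 1)) x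
      (fun y => rfl)).fderiv_eq (𝕜 := ℝ)
    change (pdFun μ (pdFun ν f) : U → ℝ) x = _
    rw [pdFun_apply, h]
    have hd : DifferentiableAt ℝ (fderiv ℝ (extendZero (f : U → ℝ))) x :=
      ((f.contDiffOn.fderiv_of_isOpen (m := 1) U.isOpen (by norm_cast)).differentiableOn
        (by simp)).differentiableAt (U.isOpen.mem_nhds x.2)
    rw [fderiv_clm_apply hd (differentiableAt_const _)]
    simp
  apply Subtype.ext
  funext x
  rw [key, key]
  have hc : ContDiffAt ℝ 2 (extendZero (f : U → ℝ)) x :=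
    (f.contDiffOn.contDiffAt (U.isOpen.mem_nhds x.2)).of_le (by norm_cast)
  exact (hc.isSymmSndFDerivAt (by simp)).eq _ _

theorem pd_coord (μ ν : Fin n) : pd μ (coord U ν) = if μ = ν then 1 else 0 := by
  apply Subtype.ext
  funext x
  have h := (extendZero_eventuallyEq (f := (coord U ν : U → ℝ)) (g := fun y => y ν) x
    (fun y => rfl)).fderiv_eq (𝕜 := ℝ)
  change (pdFun μ (coord U ν) : U → ℝ) x = _
  rw [pdFun_apply, h, (hasFDerivAt_apply ν (x : Fin n → ℝ)).fderiv]
  by_cases hμ : μ = ν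
  · subst hμ; simp
  · simp [hμ]

/-! ### Functions on the target -/

theorem bideg_ta (a : Fin r) : ta U a ∈ bideg targetDeg (1, 0) :=
  bideg_gen (deg := targetDeg) (Sum.inl a)

theorem bideg_tb (μ : Fin n) : tb U r μ ∈ bideg targetDeg (2, 0) :=
  bideg_gen (deg := targetDeg) (Sum.inr μ)

theorem isGDer_tder (β : Idx n r) : IsGDer (-tdeg β, 0) (tder (U := U) β) := by
  rcases β with μ | a | μ
  · exact isGDer_gder _ _ (fun f => bideg_algebraMap _) (fun _ => zero_mem _)
  · refine isGDer_gder _ _ (fun f => zero_mem _) (fun i => ?_)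
    by_cases h : i = Sum.inl a
    · subst h; simp only [targetDeg, tdeg, if_true]; exact bideg_one
    · simp [h]
  · refine isGDer_gder _ _ (fun f => zero_mem _) (fun i => ?_)
    by_cases h : i = Sum.inr μ
    · subst h; simp only [targetDeg, tdeg, if_true]; exact bideg_one
    · simp [h]

theorem tder_ix_algebraMap (μ : Fin n) (f : Smooth U) :
    tder (U := U) (ix μ) (algebraMap (Smooth U) (Target U r) f) = algebraMap _ _ (pd μ f) :=
  gder_algebraMap _ _ _ _ _ f

theorem tder_inr_algebraMap (γ : Fin r ⊕ Fin n) (f : Smooth U) :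
    tder (U := U) (Sum.inr γ) (algebraMap (Smooth U) (Target U r) f) = 0 := by
  cases γ <;> exact gder_algebraMap _ _ _ _ _ f

theorem tder_ix_gen (μ : Fin n) (i : Fin r ⊕ Fin n) :
    tder (U := U) (ix μ) (gen (Smooth U) targetDeg i) = 0 :=
  gder_gen _ _ _ _ _ i

theorem tder_inr_gen (γ i : Fin r ⊕ Fin n) :
    tder (U := U) (Sum.inr γ) (gen (Smooth U) targetDeg i) = if i = γ then 1 else 0 := by
  cases γ <;> exact gder_gen _ _ _ _ _ i

theorem tder_inr_smul (γ : Fin r ⊕ Fin n) (f : Smooth U) (x : Target U r) :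
    tder (U := U) (Sum.inr γ) (f • x) = f • tder (U := U) (Sum.inr γ) x := by
  rw [(isGDer_tder _).smul_eq, tder_inr_algebraMap, zero_mul, zero_add]

theorem tder_ix_smul (μ : Fin n) (f : Smooth U) (x : Target U r) :
    tder (U := U) (ix μ) (f • x) = pd μ f • x + f • tder (U := U) (ix μ) x := by
  rw [(isGDer_tder _).smul_eq, tder_ix_algebraMap, ← Algebra.smul_def]

theorem tder_ix_mul (μ : Fin n) (x y : Target U r) :
    tder (U := U) (ix μ) (x * y) = tder (U := U) (ix μ) x * y + x * tder (U := U) (ix μ) y := by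
  rw [(isGDer_tder _).leibniz]
  congr 2
  exact twist_zero x

/-- The graded commutator of two coordinate derivations is again a derivation. It kills every
coordinate, since a first derivative of a coordinate is constant, and it kills functions of x by
`pd_comm`. -/
theorem tder_comm (β γ : Idx n r) (f : Target U r) :
    tder (U := U) β (tder (U := U) γ f) = sgn (cdeg β) (cdeg γ) •
      tder (U := U) γ (tder (U := U) β f) := by
  have hs : sgn (-tdeg β, 0) (-tdeg γ, 0) = sgn (cdeg β) (cdeg γ) := by simp [sgn, cdeg]
  have h := ((isGDer_tder (U := U) β).gcomm (isGDer_tder γ)).eq_zero ?_ ?_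
  · have := DFunLike.congr_fun h f
    rw [hs] at this
    exact sub_eq_zero.mp this
  · intro f
    rw [hs]
    change tder (U := U) β (tder (U := U) γ _) - sgn (cdeg β) (cdeg γ) •
      tder (U := U) γ (tder (U := U) β _) = 0
    rcases β with μ | β <;> rcases γ with ν | γ <;>
      simp [tder_ix_algebraMap, tder_inr_algebraMap, sgn, cdeg, tdeg]
    rw [pd_comm, sub_self]
  · intro i
    have h : ∀ β γ : Idx n r, tder (U := U) β (tder (U := U) γ (gen (Smooth U) targetDeg i)) =
        0 := by
      intro β γ
      rcases γ with ν | γ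
      · rw [tder_ix_gen, map_zero]
      · rw [tder_inr_gen]
        split_ifs
        · exact (isGDer_tder β).map_one
        · exact map_zero _
    change tder (U := U) β (tder (U := U) γ _) - sgn _ _ • tder (U := U) γ (tder (U := U) β _) = 0
    rw [h, h, smul_zero, sub_zero]

/-! ### Local forms -/

theorem fieldDeg_nonneg (i : FieldGen n r) : 0 ≤ (fieldDeg i).1 := by
  cases i <;> simp [fieldDeg]

theorem local_eq_zero {p : ℤ × ℤ} (hp : p.1 < 0) {x : LocalForms U r}
    (hx : x ∈ bideg fieldDeg p) : x = 0 :=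
  bideg_eq_zero fieldDeg_nonneg hp hx

theorem bideg_fgen {p : ℤ × ℤ} {i : FieldGen n r} (h : fieldDeg i = p) :
    fgen U i ∈ bideg fieldDeg p := bideg_gen' h

theorem bideg_phi (α : Idx n r) : phi U α ∈ bideg fieldDeg (tdeg α, 0) := by
  rcases α with μ | a | μ
  · exact bideg_algebraMap _
  · exact bideg_fgen rfl
  · exact bideg_fgen rfl

theorem bideg_ghost (α : Idx n r) : ghost U α ∈ bideg fieldDeg (tdeg α - 1, 1) := by
  rcases α with μ | a | μ
  · exact zero_mem _
  · exact bideg_fgen rfl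
  · exact neg_mem (bideg_fgen rfl)

theorem bideg_ghost2 (α : Idx n r) : ghost2 U α ∈ bideg fieldDeg (tdeg α - 2, 2) := by
  rcases α with μ | a | μ
  · exact zero_mem _
  · exact zero_mem _
  · exact neg_mem (bideg_fgen rfl)

theorem extd_algebraMap (f : Smooth U) :
    extd U r (algebraMap _ _ f) = ∑ μ, pd μ f • fgen U (.dX μ) := by
  rw [extd, gder_algebraMap, dFun_apply]

theorem extd_gen (i : FieldGen n r) : extd U r (fgen U i) = dGen U i :=
  gder_gen _ _ _ _ _ i

theorem isGDer_extd : IsGDer (1, 0) (extd U r) := by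
  refine isGDer_gder _ _ (fun f => ?_) (fun i => ?_)
  · rw [dFun_apply]
    exact sum_mem fun μ _ => Submodule.smul_mem _ _ (bideg_fgen rfl)
  · cases i <;> first | exact zero_mem _ | exact bideg_fgen rfl

theorem extd_coord (μ : Fin n) : extd U r (algebraMap _ _ (coord U μ)) = fgen U (.dX μ) := by
  simp [extd_algebraMap, pd_coord]

theorem extd_chain (f : Smooth U) :
    extd U r (algebraMap _ _ f) = ∑ μ, pd μ f • extd U r (phi U (ix μ)) := by
  simp only [phi, extd_coord]
  exact extd_algebraMap f

theorem pull_algebraMap (f : Smooth U) :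
    pull U r (algebraMap _ _ f) = algebraMap _ _ f := AlgHom.commutes _ _

theorem pull_gen (i : Fin r ⊕ Fin n) :
    pull U r (gen (Smooth U) targetDeg i) = phi U (Sum.inr i) := by
  rw [pull, lift_gen]
  cases i <;> rfl

@[simp] theorem pull_ta (a : Fin r) : pull U r (ta U a) = fgen U (.A a) := pull_gen _

@[simp] theorem pull_tb (μ : Fin n) : pull U r (tb U r μ) = fgen U (.B μ) := pull_gen _

theorem pull_real_smul (c : ℝ) (f : Target U r) : pull U r (c • f) = c • pull U r f :=
  map_smul ((pull U r).restrictScalars ℝ) c f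

theorem bideg_pull_gen (i : Fin r ⊕ Fin n) :
    pull U r (gen (Smooth U) targetDeg i) ∈ bideg fieldDeg (targetDeg i) := by
  rw [pull_gen]
  rcases i with a | μ
  · exact bideg_phi (ia a)
  · exact bideg_phi (ib μ)

theorem bideg_pull {p : ℤ × ℤ} {f : Target U r} (hf : f ∈ bideg targetDeg p) :
    pull U r f ∈ bideg fieldDeg p := bideg_map bideg_pull_gen hf

theorem twist_pull (χ : ℤ × ℤ) (f : Target U r) :
    twist χ (pull U r f) = pull U r (twist χ f) := twist_map bideg_pull_gen χ f

/-- The chain rule for graded derivations on pull-backs of functions on the target. -/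
theorem chain_rule {χ : ℤ × ℤ} {D : LocalForms U r →ₗ[ℝ] LocalForms U r} (hD : IsGDer χ D)
    (hf : ∀ f : Smooth U, D (algebraMap _ _ f) = ∑ μ, pd μ f • D (phi U (ix μ)))
    (f : Target U r) : D (pull U r f) = ∑ β, D (phi U β) * pull U r (tder (U := U) β f) := by
  let S : Target U r →+ LocalForms U r := D.toAddMonoidHom.comp (pull U r).toRingHom.toAddMonoidHom
  let T : Target U r →+ LocalForms U r :=
    ∑ β, (AddMonoidHom.mulLeft (D (phi U β))).comp
      ((pull U r).toRingHom.toAddMonoidHom.comp (tder (U := U) β).toAddMonoidHom)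
  have hS : ∀ x, S x = D (pull U r x) := fun x => rfl
  have hT : ∀ x, T x = ∑ β, D (phi U β) * pull U r (tder (U := U) β x) := fun x => by
    simp only [T, AddMonoidHom.finsetSum_apply]
    rfl
  rw [← hS, ← hT]
  refine derivation_ext (pull U r) (fun x => twist χ (pull U r x)) ?_ ?_ ?_ ?_ f
  · intro x y
    rw [hS, hS, hS, map_mul, hD.leibniz]
  · intro x y
    rw [hT, hT, hT, Finset.sum_mul, Finset.mul_sum, ← Finset.sum_add_distrib]
    refine Finset.sum_congr rfl fun β _ => ?_
    rw [(isGDer_tder β).leibniz, map_add, map_mul, map_mul, mul_add, ← mul_assoc,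
      ← mul_assoc (D (phi U β)) (pull U r (twist (-tdeg β, 0) x)),
      mul_of_mem (hD.degree (bideg_phi β)) (pull U r (twist (-tdeg β, 0) x)), twist_pull,
      twist_pull, twist_twist, mul_assoc (pull U r (twist _ x))]
    -- Passing Dφ^β, of bidegree (|β|, 0) + χ, costs a twist whose |β| is undone by the twist in the
    -- Leibniz rule of ∂_β. What remains is the twist by χ, the same for every β.
    rw [show ((tdeg β, 0) + χ + (-tdeg β, 0) : ℤ × ℤ) = χ by ext <;> simp]
  · intro f
    rw [hS, hT, pull_algebraMap, hf, Fintype.sum_sum_type]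
    simp only [tder_ix_algebraMap, tder_inr_algebraMap, map_zero, mul_zero, Finset.sum_const_zero,
      add_zero, pull_algebraMap]
    exact Finset.sum_congr rfl fun μ _ => by rw [← Algebra.commutes, ← Algebra.smul_def]
  · intro i
    rw [hS, hT, Fintype.sum_sum_type]
    simp only [tder_ix_gen, tder_inr_gen, pull_gen, map_zero, mul_zero, Finset.sum_const_zero,
      zero_add, apply_ite (pull U r), map_one, mul_ite, mul_one, Finset.sum_ite_eq,
      Finset.mem_univ, if_true]

namespace IsBRSTOperator

variable {s : LocalForms U r →ₗ[ℝ] LocalForms U r}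

theorem isGDer (hs : IsBRSTOperator s) : IsGDer (0, 1) s := ⟨hs.leibniz, fun h => hs.degree _ _ h⟩

end IsBRSTOperator

end

noncomputable section

/-! ### Contraction of tensors with families of ring elements -/

section Contraction

variable {R A ι : Type} [CommRing R] [Ring A] [Algebra R A] [Fintype ι]

/-- `C_{abc} x^a y^b z^c`. -/
def tri (C : ι → ι → ι → R) (x y z : ι → A) : A :=
  ∑ a, ∑ b, ∑ c, C a b c • (x a * y b * z c)

/-- `H_{abcd} w^a x^b y^c z^d`. -/
def quad (H : ι → ι → ι → ι → R) (w x y z : ι → A) : A :=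
  ∑ a, ∑ b, ∑ c, ∑ d, H a b c d • (w a * x b * y c * z d)

theorem tri_swap₁ (C : ι → ι → ι → R) {x y : ι → A} (z : ι → A) {u : ℤˣ}
    (h : ∀ a b, x a * y b = u • (y b * x a)) :
    tri C x y z = u • tri (fun a b c => C b a c) y x z := by
  unfold tri
  rw [Finset.sum_comm]
  simp only [Finset.smul_sum, h, smul_mul_assoc, smul_comm u]

theorem tri_swap₂ (C : ι → ι → ι → R) (x : ι → A) {y z : ι → A} {u : ℤˣ}
    (h : ∀ a b, y a * z b = u • (z b * y a)) :
    tri C x y z = u • tri (fun a b c => C a c b) x z y := by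
  unfold tri
  rw [Finset.smul_sum]
  refine Finset.sum_congr rfl fun a _ => ?_
  rw [Finset.sum_comm]
  simp only [Finset.smul_sum, mul_assoc, h, mul_smul_comm, smul_comm u]

theorem quad_swap₁ (H : ι → ι → ι → ι → R) {w x : ι → A} (y z : ι → A) {u : ℤˣ}
    (h : ∀ a b, w a * x b = u • (x b * w a)) :
    quad H w x y z = u • quad (fun a b c d => H b a c d) x w y z := by
  unfold quad
  rw [Finset.sum_comm]
  simp only [Finset.smul_sum, h, smul_mul_assoc, smul_comm u]

theorem quad_swap₂ (H : ι → ι → ι → ι → R) (w : ι → A) {x y : ι → A} (z : ι → A) {u : ℤˣ}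
    (h : ∀ a b, x a * y b = u • (y b * x a)) :
    quad H w x y z = u • quad (fun a b c d => H a c b d) w y x z := by
  unfold quad
  rw [Finset.smul_sum]
  refine Finset.sum_congr rfl fun a _ => ?_
  rw [Finset.sum_comm]
  simp only [Finset.smul_sum, mul_assoc (w a), h, mul_smul_comm, smul_mul_assoc, smul_comm u]

theorem quad_swap₃ (H : ι → ι → ι → ι → R) (w x : ι → A) {y z : ι → A} {u : ℤˣ}
    (h : ∀ a b, y a * z b = u • (z b * y a)) :
    quad H w x y z = u • quad (fun a b c d => H a b d c) w x z y := by
  unfold quad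
  rw [Finset.smul_sum]
  refine Finset.sum_congr rfl fun a _ => ?_
  rw [Finset.smul_sum]
  refine Finset.sum_congr rfl fun b _ => ?_
  rw [Finset.sum_comm]
  simp only [Finset.smul_sum, mul_assoc, h, mul_smul_comm, smul_comm u]

/-- Contraction with four copies of an anticommuting family is an antisymmetrisation. Tensor
identities with permuted indices thus become numerical identities between the signs of the
permutations. -/
theorem quad_perm {q : ι → A} (h : ∀ a b, q a * q b = (-1 : ℤˣ) • (q b * q a))
    (F : ι → ι → ι → ι → R) :
    quad (fun a b c d => F b a c d) q q q q = -quad F q q q q ∧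
      quad (fun a b c d => F a c b d) q q q q = -quad F q q q q ∧
      quad (fun a b c d => F a b d c) q q q q = -quad F q q q q := by
  refine ⟨?_, ?_, ?_⟩
  · rw [quad_swap₁ _ _ _ h]; simp
  · rw [quad_swap₂ _ _ _ h]; simp
  · rw [quad_swap₃ _ _ _ h]; simp

theorem quad_add (H H' : ι → ι → ι → ι → R) (w x y z : ι → A) :
    quad (fun a b c d => H a b c d + H' a b c d) w x y z = quad H w x y z + quad H' w x y z := by
  simp only [quad, add_smul, Finset.sum_add_distrib]

theorem quad_neg (H : ι → ι → ι → ι → R) (w x y z : ι → A) :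
    quad (fun a b c d => -H a b c d) w x y z = -quad H w x y z := by
  simp only [quad, neg_smul, Finset.sum_neg_distrib]

theorem quad_sub (H H' : ι → ι → ι → ι → R) (w x y z : ι → A) :
    quad (fun a b c d => H a b c d - H' a b c d) w x y z = quad H w x y z - quad H' w x y z := by
  simp only [quad, sub_smul, Finset.sum_sub_distrib]

theorem tri_neg (C : ι → ι → ι → R) (x y z : ι → A) :
    tri (fun a b c => -C a b c) x y z = -tri C x y z := by
  simp only [tri, neg_smul, Finset.sum_neg_distrib]

theorem map_tri {B : Type} [Ring B] [Algebra R B] (F : A →ₐ[R] B) (C : ι → ι → ι → R)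
    (x y z : ι → A) :
    F (tri C x y z) = tri C (fun a => F (x a)) (fun a => F (y a)) (fun a => F (z a)) := by
  simp only [tri, map_sum, map_smul, map_mul]

theorem map_quad {B : Type} [Ring B] [Algebra R B] (F : A →ₐ[R] B) (H : ι → ι → ι → ι → R)
    (w x y z : ι → A) :
    F (quad H w x y z) = quad H (fun a => F (w a)) (fun a => F (x a)) (fun a => F (y a))
      (fun a => F (z a)) := by
  simp only [quad, map_sum, map_smul, map_mul]

theorem quad_eq_sum_tri (H : ι → ι → ι → ι → R) (w x y z : ι → A) :
    quad H w x y z = ∑ a, w a * tri (H a) x y z := by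
  simp only [quad, tri, Finset.mul_sum, mul_smul_comm, mul_assoc]

end Contraction

section ContractionDerivation

variable {R ι κ : Type} [CommRing R] [Algebra ℝ R] {deg : κ → ℤ × ℤ} [Fintype ι]
  {χ : ℤ × ℤ} {D : GCAlg R deg →ₗ[ℝ] GCAlg R deg}

theorem IsGDer.map_tri (hD : IsGDer χ D) (C : ι → ι → ι → R) {x y : ι → GCAlg R deg}
    (z : ι → GCAlg R deg) {p q : ℤ × ℤ} (hx : ∀ a, x a ∈ bideg deg p)
    (hy : ∀ a, y a ∈ bideg deg q) :
    D (tri C x y z) = (∑ a, ∑ b, ∑ c, D (algebraMap R _ (C a b c)) * (x a * y b * z c))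
      + tri C (fun a => D (x a)) y z + sgn χ p • tri C x (fun a => D (y a)) z
      + (sgn χ p * sgn χ q) • tri C x y (fun a => D (z a)) := by
  simp only [tri, map_sum, hD.smul_eq, hD.leibniz, map_mul, twist_of_mem (hx _),
    twist_of_mem (hy _), Finset.smul_sum, ← Finset.sum_add_distrib]
  refine Finset.sum_congr rfl fun a _ => Finset.sum_congr rfl fun b _ =>
    Finset.sum_congr rfl fun c _ => ?_
  simp only [add_mul, smul_add, smul_mul_assoc, mul_smul_comm, smul_smul, mul_assoc,
    smul_comm (sgn _ _) (C a b c), smul_comm (sgn _ _ * sgn _ _) (C a b c), add_assoc]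
  rw [mul_comm (sgn χ q)]

theorem IsGDer.map_quad (hD : IsGDer χ D) (H : ι → ι → ι → ι → R) {w x y : ι → GCAlg R deg}
    (z : ι → GCAlg R deg) {p q s : ℤ × ℤ} (hw : ∀ a, w a ∈ bideg deg p)
    (hx : ∀ a, x a ∈ bideg deg q) (hy : ∀ a, y a ∈ bideg deg s) :
    D (quad H w x y z) =
      (∑ a, ∑ b, ∑ c, ∑ d, D (algebraMap R _ (H a b c d)) * (w a * x b * y c * z d))
      + quad H (fun a => D (w a)) x y z + sgn χ p • quad H w (fun a => D (x a)) y z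
      + (sgn χ p * sgn χ q) • quad H w x (fun a => D (y a)) z
      + (sgn χ p * sgn χ q * sgn χ s) • quad H w x y (fun a => D (z a)) := by
  simp only [quad, map_sum, hD.smul_eq, hD.leibniz, map_mul, twist_of_mem (hx _),
    twist_of_mem (hy _), twist_of_mem (hw _), Finset.smul_sum, ← Finset.sum_add_distrib]
  refine Finset.sum_congr rfl fun a _ => Finset.sum_congr rfl fun b _ =>
    Finset.sum_congr rfl fun c _ => Finset.sum_congr rfl fun d _ => ?_
  simp only [add_mul, smul_add, smul_mul_assoc, mul_smul_comm, smul_smul, mul_assoc,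
    smul_comm (sgn _ _) (H a b c d), smul_comm (sgn _ _ * sgn _ _) (H a b c d),
    smul_comm (sgn _ _ * (sgn _ _ * sgn _ _)) (H a b c d), add_assoc]
  rw [mul_comm (sgn χ q) (sgn χ p), mul_comm (sgn χ s), mul_assoc]

/-- Odd families contracted with a totally antisymmetric tensor can be differentiated in the first
slot. -/
theorem IsGDer.map_tri_antisymm (hD : IsGDer χ D) {C : ι → ι → ι → R}
    (h₁ : ∀ a b c, C b a c = -C a b c) (h₂ : ∀ a b c, C a c b = -C a b c)
    {q : ι → GCAlg R deg} {p : ℤ × ℤ} (hp : sgn p p = -1) (hq : ∀ a, q a ∈ bideg deg p) :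
    D (tri C q q q) = (∑ a, ∑ b, ∑ c, D (algebraMap R _ (C a b c)) * (q a * q b * q c))
      + (3 : ℝ) • tri C (fun a => D (q a)) q q := by
  have hy : ∀ a b, q a * D (q b) = (-sgn χ p) • (D (q b) * q a) := fun a b => by
    rw [mul_comm_of_mem (hq a) (hD.degree (hq b)), sgn_add_right, hp, sgn_comm, neg_one_mul]
  have f₁ : (fun a b c => C b a c) = fun a b c => -C a b c := by funext a b c; exact h₁ a b c
  have f₂ : (fun a b c => C a c b) = fun a b c => -C a b c := by funext a b c; exact h₂ a b c
  have e₁ : tri C q (fun a => D (q a)) q = sgn χ p • tri C (fun a => D (q a)) q q := by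
    rw [tri_swap₁ C q hy]
    rw [f₁, tri_neg, smul_neg, Units.neg_smul, neg_neg]
  have e₂ : tri C q q (fun a => D (q a)) = tri C (fun a => D (q a)) q q := by
    rw [tri_swap₂ C q hy]
    rw [f₂, tri_neg, smul_neg, Units.neg_smul, neg_neg]
    rw [e₁, smul_smul, Int.units_mul_self, one_smul]
  rw [hD.map_tri C q hq hq, e₁, e₂, smul_smul, Int.units_mul_self, one_smul]
  module

/-- Bringing the differentiated slot to the front produces a sign from the oddness of q and the sign
of D passing q. Antisymmetry of H cancels the former and the Leibniz rule the latter, so all four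
slots contribute equally. -/
theorem IsGDer.map_quad_antisymm (hD : IsGDer χ D) {H : ι → ι → ι → ι → R}
    (h₁ : ∀ a b c d, H b a c d = -H a b c d) (h₂ : ∀ a b c d, H a c b d = -H a b c d)
    (h₃ : ∀ a b c d, H a b d c = -H a b c d)
    {q : ι → GCAlg R deg} {p : ℤ × ℤ} (hp : sgn p p = -1) (hq : ∀ a, q a ∈ bideg deg p) :
    D (quad H q q q q) =
      (∑ a, ∑ b, ∑ c, ∑ d, D (algebraMap R _ (H a b c d)) * (q a * q b * q c * q d))
      + (4 : ℝ) • quad H (fun a => D (q a)) q q q := by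
  have hy : ∀ a b, q a * D (q b) = (-sgn χ p) • (D (q b) * q a) := fun a b => by
    rw [mul_comm_of_mem (hq a) (hD.degree (hq b)), sgn_add_right, hp, sgn_comm, neg_one_mul]
  have f₁ : (fun a b c d => H b a c d) = fun a b c d => -H a b c d := by
    funext a b c d; exact h₁ a b c d
  have f₂ : (fun a b c d => H a c b d) = fun a b c d => -H a b c d := by
    funext a b c d; exact h₂ a b c d
  have f₃ : (fun a b c d => H a b d c) = fun a b c d => -H a b c d := by
    funext a b c d; exact h₃ a b c d
  have e₁ : quad H q (fun a => D (q a)) q q = sgn χ p • quad H (fun a => D (q a)) q q q := by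
    rw [quad_swap₁ H q q hy]
    rw [f₁, quad_neg, smul_neg, Units.neg_smul, neg_neg]
  have e₂ : quad H q q (fun a => D (q a)) q = quad H (fun a => D (q a)) q q q := by
    rw [quad_swap₂ H q q hy]
    rw [f₂, quad_neg, smul_neg, Units.neg_smul, neg_neg]
    rw [e₁, smul_smul, Int.units_mul_self, one_smul]
  have e₃ : quad H q q q (fun a => D (q a)) = sgn χ p • quad H (fun a => D (q a)) q q q := by
    rw [quad_swap₃ H q q hy]
    rw [f₃, quad_neg, smul_neg, Units.neg_smul, neg_neg]
    rw [e₂]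
  rw [hD.map_quad H q hq hq hq, e₁, e₂, e₃, smul_smul, smul_smul, Int.units_mul_self, one_mul,
    Int.units_mul_self, one_smul]
  module

end ContractionDerivation

theorem sum_comm₃ {ι κ M : Type} [Fintype ι] [Fintype κ] [AddCommMonoid M]
    (f : ι → ι → ι → κ → κ → κ → M) :
    ∑ a, ∑ b, ∑ c, ∑ x, ∑ y, ∑ z, f a b c x y z = ∑ x, ∑ y, ∑ z, ∑ a, ∑ b, ∑ c, f a b c x y z := by
  have h := Finset.sum_comm (s := (Finset.univ : Finset (ι × ι × ι)))
    (t := (Finset.univ : Finset (κ × κ × κ)))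
    (f := fun i j => f i.1 i.2.1 i.2.2 j.1 j.2.1 j.2.2)
  simpa only [Fintype.sum_prod_type] using h

theorem sum_comm₄ {ι κ M : Type} [Fintype ι] [Fintype κ] [AddCommMonoid M]
    (f : ι → ι → ι → ι → κ → κ → κ → κ → M) :
    ∑ a, ∑ b, ∑ c, ∑ d, ∑ x, ∑ y, ∑ z, ∑ w, f a b c d x y z w =
      ∑ x, ∑ y, ∑ z, ∑ w, ∑ a, ∑ b, ∑ c, ∑ d, f a b c d x y z w := by
  have h := Finset.sum_comm (s := (Finset.univ : Finset (ι × ι × ι × ι)))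
    (t := (Finset.univ : Finset (κ × κ × κ × κ)))
    (f := fun i j => f i.1 i.2.1 i.2.2.1 i.2.2.2 j.1 j.2.1 j.2.2.1 j.2.2.2)
  simpa only [Fintype.sum_prod_type] using h

section ContractionSubstitution

variable {R A ι κ : Type} [CommRing R] [Ring A] [Algebra R A] [Fintype ι] [Fintype κ]

theorem sum_mul_sum₃ (f g h : κ → A) :
    (∑ a, f a) * (∑ b, g b) * ∑ c, h c = ∑ a, ∑ b, ∑ c, f a * g b * h c := by
  rw [Finset.sum_mul_sum, Finset.sum_mul]
  refine Finset.sum_congr rfl fun a _ => ?_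
  rw [Finset.sum_mul]
  exact Finset.sum_congr rfl fun b _ => Finset.mul_sum _ _ _

theorem sum_mul_sum₄ (f g h k : κ → A) :
    (∑ a, f a) * (∑ b, g b) * (∑ c, h c) * ∑ d, k d =
      ∑ a, ∑ b, ∑ c, ∑ d, f a * g b * h c * k d := by
  rw [sum_mul_sum₃, Finset.sum_mul]
  refine Finset.sum_congr rfl fun a _ => ?_
  rw [Finset.sum_mul]
  refine Finset.sum_congr rfl fun b _ => ?_
  rw [Finset.sum_mul]
  exact Finset.sum_congr rfl fun c _ => Finset.mul_sum _ _ _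

theorem tri_subst (C : ι → ι → ι → R) (ρ : κ → ι → R) (t : κ → A) :
    tri C (fun μ => ∑ a, ρ a μ • t a) (fun μ => ∑ a, ρ a μ • t a) (fun μ => ∑ a, ρ a μ • t a) =
      tri (fun a b c => ∑ μ, ∑ ν, ∑ κ, ρ a μ * ρ b ν * ρ c κ * C μ ν κ) t t t := by
  simp only [tri, sum_mul_sum₃, Finset.smul_sum, Finset.sum_smul]
  rw [sum_comm₃]
  refine Finset.sum_congr rfl fun a _ => Finset.sum_congr rfl fun b _ =>
    Finset.sum_congr rfl fun c _ => Finset.sum_congr rfl fun μ _ => Finset.sum_congr rfl fun ν _ =>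
    Finset.sum_congr rfl fun κ _ => ?_
  simp only [smul_mul_assoc, mul_smul_comm, smul_smul]
  congr 1
  ring

theorem quad_subst (H : ι → ι → ι → ι → R) (ρ : κ → ι → R) (t : κ → A) :
    quad H (fun μ => ∑ a, ρ a μ • t a) (fun μ => ∑ a, ρ a μ • t a) (fun μ => ∑ a, ρ a μ • t a)
      (fun μ => ∑ a, ρ a μ • t a) =
      quad (fun a b c d => ∑ μ, ∑ ν, ∑ κ, ∑ l, ρ a μ * ρ b ν * ρ c κ * ρ d l * H μ ν κ l)
        t t t t := by
  simp only [quad, sum_mul_sum₄, Finset.smul_sum, Finset.sum_smul]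
  rw [sum_comm₄]
  refine Finset.sum_congr rfl fun a _ => Finset.sum_congr rfl fun b _ =>
    Finset.sum_congr rfl fun c _ => Finset.sum_congr rfl fun d _ =>
    Finset.sum_congr rfl fun μ _ => Finset.sum_congr rfl fun ν _ =>
    Finset.sum_congr rfl fun κ _ => Finset.sum_congr rfl fun l _ => ?_
  simp only [smul_mul_assoc, mul_smul_comm, smul_smul]
  congr 1
  ring

end ContractionSubstitution

end

/-! ### The Hamiltonian behind the homological vector field. -/

noncomputable section

variable {n r : ℕ} {U : TopologicalSpace.Opens (Fin n → ℝ)}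

theorem sum_comm₂ {ι κ M : Type} [Fintype ι] [Fintype κ] [AddCommMonoid M]
    (f : ι → ι → κ → κ → M) : ∑ a, ∑ b, ∑ x, ∑ y, f a b x y = ∑ x, ∑ y, ∑ a, ∑ b, f a b x y := by
  have h := Finset.sum_comm (s := (Finset.univ : Finset (ι × ι)))
    (t := (Finset.univ : Finset (κ × κ))) (f := fun i j => f i.1 i.2 j.1 j.2)
  simpa only [Fintype.sum_prod_type] using h

theorem sum_rotate {ι ι' κ M : Type} [Fintype ι] [Fintype ι'] [Fintype κ] [AddCommMonoid M]
    (f : κ → ι → ι' → M) : ∑ a, ∑ b, ∑ x, f x a b = ∑ x, ∑ a, ∑ b, f x a b := by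
  calc ∑ a, ∑ b, ∑ x, f x a b = ∑ a, ∑ x, ∑ b, f x a b :=
        Finset.sum_congr rfl fun a _ => Finset.sum_comm
    _ = _ := Finset.sum_comm

theorem ta_mul_ta (a b : Fin r) : ta U a * ta U b = (-1 : ℤˣ) • (ta U b * ta U a) :=
  mul_comm_of_mem (bideg_ta a) (bideg_ta b)

theorem tb_comm (μ : Fin n) (x : Target U r) : tb U r μ * x = x * tb U r μ :=
  even_mul_comm (p := (2, 0)) even_two Even.zero (bideg_tb μ) x

namespace TwistedCourantAlgebroid

variable (K : TwistedCourantAlgebroid U r)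

/-- `(1/3!) C_{abc} a^a a^b a^c`. -/
def cubic : Target U r := (1 / 6 : ℝ) • tri K.C (ta U) (ta U) (ta U)

/-- `½ C_{abc} a^b a^c`. -/
def cubicDer (a : Fin r) : Target U r :=
  (1 / 2 : ℝ) • ∑ b, ∑ c, K.C a b c • (ta U b * ta U c)

/-- The Hamiltonian `ρ_a^μ b_μ a^a + (1/3!) C_{abc} a^a a^b a^c`. -/
def theta : Target U r := ∑ μ, tb U r μ * K.Q (ix μ) + K.cubic

/-- `(1/3!) H_{μνκl} Q^ν Q^κ Q^l`. -/
def hForm (μ : Fin n) : Target U r :=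
  (1 / 6 : ℝ) • tri (K.H μ) (fun ν => K.Q (ix ν)) (fun ν => K.Q (ix ν)) (fun ν => K.Q (ix ν))

/-- `(1/4!) H_{μνκl} Q^μ Q^ν Q^κ Q^l`. -/
def hTop : Target U r :=
  (1 / 24 : ℝ) • quad K.H (fun ν => K.Q (ix ν)) (fun ν => K.Q (ix ν)) (fun ν => K.Q (ix ν))
    (fun ν => K.Q (ix ν))

theorem Q_ix (μ : Fin n) : K.Q (ix μ) = ∑ a, K.ρ a μ • ta U a := rfl

theorem bideg_Q_ix (μ : Fin n) : K.Q (ix μ) ∈ bideg targetDeg (1, 0) :=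
  sum_mem fun a _ => Submodule.smul_mem _ _ (bideg_ta a)

theorem bideg_Q (α : Idx n r) : K.Q α ∈ bideg targetDeg (tdeg α + 1, 0) := by
  rcases α with μ | a | μ
  · exact K.bideg_Q_ix μ
  · refine neg_mem (add_mem (sum_mem fun b _ => sum_mem fun μ _ =>
      Submodule.smul_mem _ _ (bideg_tb μ)) (bideg_real_smul _ (sum_mem fun b _ =>
      sum_mem fun c _ => Submodule.smul_mem _ _ (bideg_mul (bideg_ta b) (bideg_ta c) rfl))))
  · refine neg_mem (add_mem (sum_mem fun b _ => sum_mem fun μ _ =>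
      Submodule.smul_mem _ _ (bideg_mul (bideg_tb μ) (bideg_ta b) rfl)) (bideg_real_smul _
      (sum_mem fun a _ => sum_mem fun b _ => sum_mem fun c _ => Submodule.smul_mem _ _
        (bideg_mul (bideg_mul (bideg_ta a) (bideg_ta b) rfl) (bideg_ta c) rfl))))

theorem tder_inr_ta (γ : Fin r ⊕ Fin n) (a : Fin r) :
    tder (U := U) (Sum.inr γ) (ta U a) = if Sum.inl a = γ then 1 else 0 := tder_inr_gen γ _

theorem tder_inr_tb (γ : Fin r ⊕ Fin n) (μ : Fin n) :
    tder (U := U) (Sum.inr γ) (tb U r μ) = if Sum.inr μ = γ then 1 else 0 := tder_inr_gen γ _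

theorem tder_ix_ta (μ : Fin n) (a : Fin r) : tder (U := U) (ix μ) (ta U a) = 0 := tder_ix_gen μ _

theorem tder_ix_tb (μ ν : Fin n) : tder (U := U) (ix μ) (tb U r ν) = 0 := tder_ix_gen μ _

theorem tder_ib_Q_ix (μ ν : Fin n) : tder (U := U) (ib ν) (K.Q (ix μ)) = 0 := by
  simp only [Q_ix, map_sum, tder_inr_smul, tder_inr_ta]
  simp

theorem tder_ia_Q_ix (a : Fin r) (μ : Fin n) :
    tder (U := U) (ia a) (K.Q (ix μ)) = algebraMap _ _ (K.ρ a μ) := by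
  simp only [Q_ix, map_sum, tder_inr_smul, tder_inr_ta]
  simp [Algebra.algebraMap_eq_smul_one]

theorem tder_ix_Q_ix (μ ν : Fin n) :
    tder (U := U) (ix μ) (K.Q (ix ν)) = ∑ a, pd μ (K.ρ a ν) • ta U a := by
  simp only [Q_ix, map_sum, tder_ix_smul, tder_ix_ta, smul_zero, add_zero]

theorem tder_cubic (β : Idx n r) : tder (U := U) β K.cubic =
    (1 / 6 : ℝ) • ∑ a, ∑ b, ∑ c,
      tder (U := U) β (algebraMap _ _ (K.C a b c)) * (ta U a * ta U b * ta U c)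
    + (1 / 2 : ℝ) • ∑ b, tder (U := U) β (ta U b) * ∑ c, ∑ d, K.C b c d • (ta U c * ta U d) := by
  rw [cubic, map_smul, (isGDer_tder β).map_tri_antisymm K.C_swap₁ K.C_swap₂
    (p := (1, 0)) (by simp [sgn]) bideg_ta, smul_add, smul_smul]
  norm_num
  simp only [tri, Finset.mul_sum, mul_smul_comm, mul_assoc]

theorem tder_ib_theta (ν : Fin n) : tder (U := U) (ib ν) K.theta = K.Q (ix ν) := by
  rw [theta, map_add, map_sum, tder_cubic]
  simp only [(isGDer_tder _).mul_of_mem' (bideg_tb _), tder_inr_tb, tder_ib_Q_ix, tder_inr_ta,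
    tder_inr_algebraMap]
  simp

theorem tder_ia_theta (a : Fin r) :
    tder (U := U) (ia a) K.theta = ∑ μ, K.ρ a μ • tb U r μ + K.cubicDer a := by
  rw [theta, map_add, map_sum, tder_cubic, cubicDer]
  simp only [(isGDer_tder _).mul_of_mem' (bideg_tb _), tder_inr_tb, tder_ia_Q_ix, tder_inr_ta,
    tder_inr_algebraMap]
  simp [sgn, tdeg, ← Algebra.commutes, ← Algebra.smul_def, show Int.negOnePow 2 = 1 from rfl]

theorem tder_ix_theta (μ : Fin n) :
    tder (U := U) (ix μ) K.theta = ∑ ν, tb U r ν * tder (U := U) (ix μ) (K.Q (ix ν)) +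
      (1 / 6 : ℝ) • tri (fun a b c => pd μ (K.C a b c)) (ta U) (ta U) (ta U) := by
  rw [theta, map_add, map_sum, tder_cubic]
  simp only [tder_ix_mul, tder_ix_tb, tder_ix_ta, tder_ix_algebraMap, tri]
  simp [← Algebra.smul_def]

theorem Q_ia (a : Fin r) :
    K.Q (ia a) = -∑ b, K.η⁻¹ a b • tder (U := U) (ia b) K.theta := by
  simp only [tder_ia_theta, cubicDer]
  rw [Q]
  congr 1
  simp only [smul_add, Finset.sum_add_distrib, Finset.smul_sum, smul_assoc, Finset.sum_smul]
  congr 1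
  rw [sum_rotate]
  simp only [smul_comm (1 / 2 : ℝ)]

/-- The anchored components of H contracted with the odd coordinates are the components of H
contracted with Q^ν = ρ_a^ν a^a. The 4-form is therefore the only deviation of Q from a Hamiltonian
vector field. -/
theorem Q_ib (μ : Fin n) : K.Q (ib μ) = -tder (U := U) (ix μ) K.theta - K.hForm μ := by
  have h : tri (K.H μ) (fun ν => K.Q (ix ν)) (fun ν => K.Q (ix ν)) (fun ν => K.Q (ix ν)) =
      tri (K.Hanchored μ) (ta U) (ta U) (ta U) :=
    tri_subst _ K.ρ (ta U)
  rw [tder_ix_theta, hForm, h, Q, neg_add, neg_add, sub_eq_add_neg, add_assoc]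
  congr 1
  · simp only [tder_ix_Q_ix, Finset.mul_sum, mul_smul_comm]
    rw [Finset.sum_comm]
  · simp only [tri, add_smul, Finset.sum_add_distrib, smul_add, neg_add]

/-- Differentiating the four equal Q-slots turns 1/4! into 1/3! and so produces `hForm`. The
derivative of the coefficient H is kept apart, as it matters only for β of type x. -/
theorem tder_hTop (β : Idx n r) : tder (U := U) β K.hTop =
    (1 / 24 : ℝ) • ∑ a, ∑ b, ∑ c, ∑ d, tder (U := U) β (algebraMap _ _ (K.H a b c d)) *
      (K.Q (ix a) * K.Q (ix b) * K.Q (ix c) * K.Q (ix d))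
    + ∑ μ, tder (U := U) β (K.Q (ix μ)) * K.hForm μ := by
  rw [hTop, map_smul, (isGDer_tder β).map_quad_antisymm K.H_swap₁ K.H_swap₂ K.H_swap₃
    (p := (1, 0)) (by simp [sgn]) K.bideg_Q_ix, smul_add, smul_smul, quad_eq_sum_tri]
  norm_num
  simp only [hForm, mul_smul_comm, Finset.smul_sum]

/-- The anchor intertwines the brackets, contracted with odd coordinates. -/
theorem Q_ix_bracket (ν : Fin n) :
    ∑ μ, K.Q (ix μ) * tder (U := U) (ix μ) (K.Q (ix ν)) =
      ∑ a, ∑ b, (K.η⁻¹ a b • K.ρ a ν) • K.cubicDer b := by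
  let X : Fin r → Fin r → Smooth U := fun a b => ∑ μ, K.ρ a μ * pd μ (K.ρ b ν)
  have e₁ : ∑ μ, K.Q (ix μ) * tder (U := U) (ix μ) (K.Q (ix ν)) =
      ∑ a, ∑ b, X a b • (ta U a * ta U b) := by
    simp only [tder_ix_Q_ix]
    simp only [Q_ix, Finset.sum_mul_sum, X, Finset.sum_smul]
    rw [← sum_rotate]
    simp only [smul_mul_assoc, mul_smul_comm, smul_smul, mul_comm (K.ρ _ _)]
  have e₂ : ∑ a, ∑ b, X b a • (ta U a * ta U b) = -∑ a, ∑ b, X a b • (ta U a * ta U b) := by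
    rw [Finset.sum_comm, ← Finset.sum_neg_distrib]
    refine Finset.sum_congr rfl fun a _ => ?_
    rw [← Finset.sum_neg_distrib]
    refine Finset.sum_congr rfl fun b _ => ?_
    rw [ta_mul_ta]
    simp
  have e₃ : ∑ a, ∑ b, (K.η⁻¹ a b • K.ρ a ν) • K.cubicDer b = (1 / 2 : ℝ) •
      ∑ c, ∑ d, (∑ e, ∑ f, K.η⁻¹ e f • (K.ρ e ν * K.C f c d)) • (ta U c * ta U d) := by
    simp only [cubicDer, Finset.smul_sum, Finset.sum_smul]
    rw [sum_comm₂]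
    simp only [smul_comm _ (1 / 2 : ℝ), smul_assoc, mul_smul]
  have e₄ : ∀ c d, ∑ e, ∑ f, K.η⁻¹ e f • (K.ρ e ν * K.C f c d) = X c d - X d c := fun c d => by
    have := K.anchor_bracket c d ν
    simp only [X]
    linear_combination this
  rw [e₁, e₃]
  -- The axiom gives the antisymmetrisation of X. Contracted with a^a a^b it is twice the
  -- contraction of X, which absorbs the ½ of `cubicDer`.
  simp only [e₄, sub_smul, Finset.sum_sub_distrib]
  rw [e₂]
  module

/-- The twisted Jacobi identity, contracted with odd coordinates. -/
theorem cubic_jacobi :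
    (2 : ℝ) • ∑ μ, K.Q (ix μ) * ((1 / 6 : ℝ) • tri (fun a b c => pd μ (K.C a b c))
        (ta U) (ta U) (ta U))
      - ∑ a, ∑ b, K.η⁻¹ a b • (K.cubicDer a * K.cubicDer b) = (-2 : ℝ) • K.hTop := by
  let S := fun F : Fin r → Fin r → Fin r → Fin r → Smooth U =>
    quad F (ta U) (ta U) (ta U) (ta U)
  let Y : Fin r → Fin r → Fin r → Fin r → Smooth U := fun a b c d => ∑ μ, K.ρ a μ * pd μ (K.C b c d)
  let Z : Fin r → Fin r → Fin r → Fin r → Smooth U := fun a b c d =>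
    ∑ e, ∑ f, K.η⁻¹ e f • (K.C e a b * K.C f c d)
  let W : Fin r → Fin r → Fin r → Fin r → Smooth U := fun a b c d =>
    ∑ μ, ∑ ν, ∑ κ, ∑ l, K.ρ a μ * K.ρ b ν * K.ρ c κ * K.ρ d l * K.H μ ν κ l
  have s₁ : ∀ F, S (fun a b c d => F b a c d) = -S F := fun F => (quad_perm ta_mul_ta F).1
  have s₂ : ∀ F, S (fun a b c d => F a c b d) = -S F := fun F => (quad_perm ta_mul_ta F).2.1
  have s₃ : ∀ F, S (fun a b c d => F a b d c) = -S F := fun F => (quad_perm ta_mul_ta F).2.2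
  have rot : ∀ F, S (fun a b c d => F d a b c) = -S F := fun F => by
    rw [s₃ (fun a b c d => F c a b d), s₂ (fun a b c d => F b a c d), s₁, neg_neg]
  have hW : S W = (24 : ℝ) • K.hTop := by
    simp only [S, W, hTop, Q_ix, quad_subst]
    rw [smul_smul]
    norm_num
  have hY : ∑ μ, K.Q (ix μ) * tri (fun a b c => pd μ (K.C a b c)) (ta U) (ta U) (ta U) = S Y := by
    simp only [S, Y, quad, tri, Q_ix, Finset.sum_smul, Finset.sum_mul]
    rw [Finset.sum_comm]
    refine Finset.sum_congr rfl fun a _ => ?_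
    simp only [Finset.mul_sum]
    rw [Finset.sum_comm]
    refine Finset.sum_congr rfl fun b _ => ?_
    rw [sum_rotate (fun μ c d => (K.ρ a μ * pd μ (K.C b c d)) •
      (ta U a * ta U b * ta U c * ta U d))]
    simp only [smul_mul_assoc, mul_smul_comm, smul_smul, mul_assoc,
      mul_comm (K.ρ _ _)]
  have hZ : ∑ a, ∑ b, K.η⁻¹ a b • (K.cubicDer a * K.cubicDer b) = (1 / 4 : ℝ) • S Z := by
    have e : ∀ a b, K.η⁻¹ a b • (K.cubicDer a * K.cubicDer b) = ∑ c, ∑ d, ∑ e, ∑ f,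
        ((1 / 4 : ℝ) * K.η⁻¹ a b) • ((K.C a c d * K.C b e f) •
          (ta U c * ta U d * ta U e * ta U f)) := fun a b => by
      simp only [cubicDer, smul_mul_smul_comm, Finset.sum_mul_sum, Finset.smul_sum]
      refine Finset.sum_congr rfl fun c _ => ?_
      rw [Finset.sum_comm]
      refine Finset.sum_congr rfl fun d _ => Finset.sum_congr rfl fun e _ =>
        Finset.sum_congr rfl fun f _ => ?_
      rw [smul_smul, mul_assoc (ta U c * ta U d)]
      congr 1
      ring
    simp only [e, S, Z, quad, Finset.sum_smul, Finset.smul_sum]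
    rw [sum_comm₂]
    refine Finset.sum_congr rfl fun c _ => Finset.sum_congr rfl fun d _ => ?_
    rw [sum_comm₂]
    simp only [smul_assoc, smul_smul]
  -- The Jacobi axiom contracts the last index of the second C while Z contracts the first. A cyclic
  -- rotation of three antisymmetric indices is even, so the two agree.
  have cyc : ∀ a b c, K.C b c a = K.C a b c := fun a b c => by
    rw [K.C_swap₂, K.C_swap₁, neg_neg]
  have hJ : S (fun a b c d => Y d a b c - Y a b c d + Y b c d a - Y c d a b
      + (Z a b c d + Z a c d b + Z a d b c)) = S (fun a b c d => -W d a b c) := by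
    congr 1
    funext a b c d
    have := K.jacobi a b c d
    simp only [Y, Z, W]
    rw [← this]
    congr 1
    simp only [← cyc, smul_add, Finset.sum_add_distrib]
  -- After antisymmetrisation each of the four anchor terms equals -S Y, and each of the three terms
  -- quadratic in C equals S Z.
  have lin : S (fun a b c d => Y d a b c - Y a b c d + Y b c d a - Y c d a b
      + (Z a b c d + Z a c d b + Z a d b c)) = -(4 : ℝ) • S Y + (3 : ℝ) • S Z := by
    simp only [S, quad_add, quad_sub]
    change S (fun a b c d => Y d a b c) - S Y + S (fun a b c d => Y b c d a) -
      S (fun a b c d => Y c d a b) + (S Z + S (fun a b c d => Z a c d b) +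
        S (fun a b c d => Z a d b c)) = _
    have y₁ : S (fun a b c d => Y b c d a) = - S Y := by
      rw [s₁ (fun a b c d => Y a c d b), s₂ (fun a b c d => Y a b d c), s₃, neg_neg]
    have y₂ : S (fun a b c d => Y c d a b) = S Y := by
      rw [rot (fun a b c d => Y d a b c), rot, neg_neg]
    have z₁ : S (fun a b c d => Z a c d b) = S Z := by
      rw [s₂ (fun a b c d => Z a b d c), s₃, neg_neg]
    have z₂ : S (fun a b c d => Z a d b c) = S Z := by
      rw [s₃ (fun a b c d => Z a c b d), s₂, neg_neg]
    rw [rot, y₁, y₂, z₁, z₂]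
    module
  have hR : S (fun a b c d => -W d a b c) = (24 : ℝ) • K.hTop := by
    have : S (fun a b c d => -W d a b c) = -S (fun a b c d => W d a b c) := quad_neg _ _ _ _ _
    rw [this, rot, neg_neg, hW]
  rw [lin, hR] at hJ
  simp only [mul_smul_comm, ← Finset.smul_sum]
  rw [hY, hZ, ← sub_eq_zero]
  have h0 : -(4 : ℝ) • S Y + (3 : ℝ) • S Z - (24 : ℝ) • K.hTop = 0 := by rw [hJ, sub_self]
  -- The factor turns the coefficients -4, 3, -24 into 1/3, -1/4, 2. The first two are 2 · 1/6 for
  -- `cubic` and the square of the ½ in `cubicDer`.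
  have := congrArg (fun x => (-(1 / 12) : ℝ) • x) h0
  simp only [smul_zero] at this
  rw [← this]
  module

end TwistedCourantAlgebroid

end

/-! ### The master equation and Q² = 0. -/

noncomputable section

variable {n r : ℕ} {U : TopologicalSpace.Opens (Fin n → ℝ)}

namespace TwistedCourantAlgebroid

variable (K : TwistedCourantAlgebroid U r)

theorem bideg_theta : K.theta ∈ bideg targetDeg (3, 0) :=
  add_mem (sum_mem fun μ _ => bideg_mul (bideg_tb μ) (K.bideg_Q_ix μ) rfl)
    (bideg_real_smul _ (sum_mem fun a _ => sum_mem fun b _ => sum_mem fun c _ =>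
      Submodule.smul_mem _ _ (bideg_mul (bideg_mul (bideg_ta a) (bideg_ta b) rfl)
        (bideg_ta c) rfl)))

theorem bideg_tder_theta (β : Idx n r) :
    tder (U := U) β K.theta ∈ bideg targetDeg (3 - tdeg β, 0) := by
  have := (isGDer_tder β).degree K.bideg_theta
  simpa [sub_eq_add_neg] using this

/-- The classical master equation, up to the 4-form. -/
theorem master : (2 : ℝ) • ∑ μ, K.Q (ix μ) * tder (U := U) (ix μ) K.theta
    - ∑ a, ∑ b, K.η⁻¹ a b • (tder (U := U) (ia a) K.theta * tder (U := U) (ia b) K.theta) =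
      (-2 : ℝ) • K.hTop := by
  -- B is the part of ∂_a Θ linear in b, and the equation is sorted by degree in b. The quadratic
  -- part vanishes because the anchor is null (e₂), the linear part cancels by compatibility of
  -- anchor and bracket (e₃, e₄), and the part without b is `cubic_jacobi`.
  let B : Fin r → Target U r := fun a => ∑ μ, K.ρ a μ • tb U r μ
  have hB : ∀ a x, x * B a = B a * x := fun a x => by
    simp only [B, Finset.mul_sum, Finset.sum_mul, mul_smul_comm, smul_mul_assoc, tb_comm]
  have hb : ∀ μ (x y : Target U r), x * (tb U r μ * y) = tb U r μ * (x * y) := fun μ x y => by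
    rw [← mul_assoc, ← tb_comm, mul_assoc]
  have ht : ∀ a, tder (U := U) (ia a) K.theta = B a + K.cubicDer a := K.tder_ia_theta
  have hd : ∀ x y z w : Target U r, (x + y) * (z + w) = x * z + x * w + y * z + y * w :=
    fun x y z w => by noncomm_ring
  have e₁ : ∑ μ, K.Q (ix μ) * tder (U := U) (ix μ) K.theta =
      ∑ ν, tb U r ν * ∑ μ, K.Q (ix μ) * tder (U := U) (ix μ) (K.Q (ix ν)) +
        ∑ μ, K.Q (ix μ) * ((1 / 6 : ℝ) • tri (fun a b c => pd μ (K.C a b c))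
          (ta U) (ta U) (ta U)) := by
    simp only [tder_ix_theta, mul_add, Finset.sum_add_distrib, Finset.mul_sum]
    rw [Finset.sum_comm]
    simp only [hb]
  have e₂ : ∑ a, ∑ b, K.η⁻¹ a b • (B a * B b) = 0 := by
    simp only [B, Finset.sum_mul_sum, Finset.smul_sum, smul_mul_smul_comm]
    rw [sum_comm₂]
    refine Finset.sum_eq_zero fun μ _ => Finset.sum_eq_zero fun ν _ => ?_
    simp only [← smul_assoc, ← Finset.sum_smul, K.anchor_null, zero_smul]
  have e₃ : ∑ a, ∑ b, K.η⁻¹ a b • (B a * K.cubicDer b) =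
      ∑ ν, tb U r ν * ∑ μ, K.Q (ix μ) * tder (U := U) (ix μ) (K.Q (ix ν)) := by
    simp only [Q_ix_bracket, B, Finset.sum_mul, Finset.mul_sum, Finset.smul_sum]
    rw [sum_rotate]
    simp only [mul_smul_comm, smul_mul_assoc, smul_assoc]
  have e₄ : ∑ a, ∑ b, K.η⁻¹ a b • (K.cubicDer a * B b) =
      ∑ a, ∑ b, K.η⁻¹ a b • (B a * K.cubicDer b) := by
    rw [Finset.sum_comm]
    simp only [hB, K.η_symm.inv.apply]
  have e₅ : ∑ a, ∑ b, K.η⁻¹ a b • (tder (U := U) (ia a) K.theta * tder (U := U) (ia b) K.theta) =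
      ∑ a, ∑ b, K.η⁻¹ a b • (B a * B b) + ∑ a, ∑ b, K.η⁻¹ a b • (B a * K.cubicDer b) +
      ∑ a, ∑ b, K.η⁻¹ a b • (K.cubicDer a * B b) +
      ∑ a, ∑ b, K.η⁻¹ a b • (K.cubicDer a * K.cubicDer b) := by
    simp only [ht, hd, smul_add, Finset.sum_add_distrib]
  have := K.cubic_jacobi
  rw [e₅, e₄, e₃, e₂, e₁, ← this]
  module

/-- The homological vector field `Q^α ∂_α`. -/
def vf : Target U r →ₗ[ℝ] Target U r := ∑ α, LinearMap.mulLeft ℝ (K.Q α) ∘ₗ tder α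

theorem vf_apply (f : Target U r) : K.vf f = ∑ α, K.Q α * tder α f := by
  simp [vf, LinearMap.sum_apply]

theorem vf_apply' (f : Target U r) : K.vf f = ∑ μ, K.Q (ix μ) * tder (U := U) (ix μ) f
    + ∑ a, K.Q (ia a) * tder (U := U) (ia a) f + ∑ μ, K.Q (ib μ) * tder (U := U) (ib μ) f := by
  rw [vf_apply, Fintype.sum_sum_type, Fintype.sum_sum_type, add_assoc]

theorem isGDer_vf : IsGDer (1, 0) K.vf := by
  refine ⟨fun x y => ?_, fun {p x} hx => ?_⟩
  · simp only [vf_apply, Finset.sum_mul, Finset.mul_sum, ← Finset.sum_add_distrib]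
    refine Finset.sum_congr rfl fun α _ => ?_
    rw [(isGDer_tder α).leibniz, mul_add, ← mul_assoc, ← mul_assoc (K.Q α),
      mul_of_mem (K.bideg_Q α) (twist _ x), twist_twist, mul_assoc (twist _ x)]
    congr 3
    simp
  · rw [vf_apply]
    refine sum_mem fun α _ => bideg_mul (K.bideg_Q α) ((isGDer_tder α).degree hx) ?_
    ext <;> simp; ring

theorem tder_ia_theta_mul_comm (a : Fin r) (x : Target U r) :
    tder (U := U) (ia a) K.theta * x = x * tder (U := U) (ia a) K.theta :=
  even_mul_comm (p := (3 - 1, 0)) (by norm_num) Even.zero (K.bideg_tder_theta (ia a)) x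

theorem tder_tder_theta_mul (β : Idx n r) (a b : Fin r) :
    tder (U := U) β (tder (U := U) (ia a) K.theta * tder (U := U) (ia b) K.theta) =
      sgn (tdeg β, 0) (1, 0) •
      (tder (U := U) (ia b) K.theta * tder (U := U) (ia a) (tder (U := U) β K.theta) +
        tder (U := U) (ia a) K.theta * tder (U := U) (ia b) (tder (U := U) β K.theta)) := by
  have h : sgn (-tdeg β, 0) (3 - tdeg (ia a : Idx n r), 0) = 1 := by
    rw [sgn_comm]
    exact sgn_of_even (by norm_num [tdeg]) Even.zero _
  have h' : ∀ c : Fin r, sgn (cdeg β) (cdeg (ia c : Idx n r)) = sgn (tdeg β, 0) (1, 0) :=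
    fun c => rfl
  rw [(isGDer_tder β).mul_of_mem' (K.bideg_tder_theta (ia a)), h, one_smul,
    ← K.tder_ia_theta_mul_comm b, tder_comm β (ia a), tder_comm β (ia b), h', h', mul_smul_comm,
    mul_smul_comm, smul_add]

/-- The factors ∂_a Θ have degree 2 and commute. By symmetry of the inverse metric both Leibniz
terms coincide, and η^{ab} ∂_b Θ is -Q^a. -/
theorem tder_metric_term (β : Idx n r) :
    tder (U := U) β (∑ a, ∑ b, K.η⁻¹ a b •
      (tder (U := U) (ia a) K.theta * tder (U := U) (ia b) K.theta)) =
      -((2 : ℝ) • sgn (tdeg β, 0) (1, 0) • ∑ a,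
        K.Q (ia a) * tder (U := U) (ia a) (tder (U := U) β K.theta)) := by
  let F : Fin r → Fin r → Target U r := fun a b =>
    tder (U := U) (ia b) K.theta * tder (U := U) (ia a) (tder (U := U) β K.theta)
  have h₁ : ∑ a, K.Q (ia a) * tder (U := U) (ia a) (tder (U := U) β K.theta) = -∑ a, ∑ b,
      K.η⁻¹ a b • F a b := by
    simp only [Q_ia, neg_mul, Finset.sum_mul, smul_mul_assoc, Finset.sum_neg_distrib, F]
  have h₂ : ∑ a, ∑ b, K.η⁻¹ a b • F b a = ∑ a, ∑ b, K.η⁻¹ a b • F a b := by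
    rw [Finset.sum_comm]
    simp only [K.η_symm.inv.apply]
  have h₃ : ∀ a b, tder (U := U) β (tder (U := U) (ia a) K.theta * tder (U := U) (ia b) K.theta) =
      sgn (tdeg β, 0) (1, 0) • (F a b + F b a) := K.tder_tder_theta_mul β
  simp only [map_sum, map_smul, h₃, h₁]
  simp only [smul_comm _ (sgn (tdeg β, 0) (1, 0)), ← Finset.smul_sum, smul_add,
    Finset.sum_add_distrib, h₂, two_smul, smul_neg, neg_add, neg_neg]

theorem tder_anchor_term (β : Idx n r) :
    tder (U := U) β (∑ μ, K.Q (ix μ) * tder (U := U) (ix μ) K.theta) =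
      ∑ μ, tder (U := U) β (K.Q (ix μ)) * tder (U := U) (ix μ) K.theta
        + sgn (tdeg β, 0) (1, 0) • ∑ μ,
          K.Q (ix μ) * tder (U := U) (ix μ) (tder (U := U) β K.theta) := by
  have h : sgn (-tdeg β, 0) (1, 0) = sgn (tdeg β, 0) (1, 0) := by simp [sgn]
  rw [map_sum, Finset.smul_sum, ← Finset.sum_add_distrib]
  refine Finset.sum_congr rfl fun μ _ => ?_
  have h' : sgn (cdeg β) (cdeg (ix μ : Idx n r)) = 1 := by simp [sgn, cdeg, tdeg]
  rw [(isGDer_tder β).mul_of_mem' (K.bideg_Q_ix μ), h, tder_comm β (ix μ), h', one_smul]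

/-- Since ∂_{b_μ} is even, it can be moved past ∂_β without sign and turns Θ into Q^μ. Solving
`Q_ib` for ∂_μ Θ then expresses the b-part of Q by terms occurring in the differentiated master
equation. -/
theorem Q_ib_term (β : Idx n r) :
    ∑ μ, K.Q (ib μ) * tder (U := U) (ib μ) (tder (U := U) β K.theta) =
      sgn (tdeg β, 0) (1, 0) • (∑ μ, tder (U := U) β (K.Q (ix μ)) * tder (U := U) (ix μ) K.theta
        + ∑ μ, tder (U := U) β (K.Q (ix μ)) * K.hForm μ) := by
  rw [← Finset.sum_add_distrib, Finset.smul_sum]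
  refine Finset.sum_congr rfl fun μ _ => ?_
  have h₁ : tder (U := U) (ib μ) (tder (U := U) β K.theta) = tder (U := U) β (K.Q (ix μ)) := by
    rw [tder_comm, tder_ib_theta,
      sgn_of_even (p := cdeg (ib μ : Idx n r)) even_two Even.zero, one_smul]
  have h₂ : K.Q (ib μ) ∈ bideg targetDeg (3, 0) := K.bideg_Q (ib μ)
  have h₃ : sgn (3, 0) ((1, 0) + (-tdeg β, 0)) = -sgn (tdeg β, 0) (1, 0) := by
    rw [sgn_add_right]
    have : sgn (3, 0) (-tdeg β, 0) = sgn (tdeg β, 0) (1, 0) := by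
      simp only [sgn]
      rw [Int.negOnePow_eq_iff]
      exact ⟨-(2 * tdeg β), by ring⟩
    rw [this]
    simp [sgn, show Int.negOnePow 3 = -1 from rfl]
  rw [h₁, mul_comm_of_mem h₂ ((isGDer_tder β).degree (K.bideg_Q_ix μ)), h₃, Q_ib, mul_sub, mul_neg,
    Units.neg_smul, ← smul_neg]
  congr 1
  abel

/-- The derivative of the master equation along x^β is, up to sign and a factor 2, the action of Q
on ∂_β Θ. The `hForm` terms match the derivative of `hTop` through its Q-slots, so only the
derivative of the coefficients of H survives. For β of type a or b this is zero. -/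
theorem vf_tder_theta (β : Idx n r) : K.vf (tder (U := U) β K.theta) =
    -(sgn (tdeg β, 0) (1, 0) • (1 / 24 : ℝ) • ∑ a, ∑ b, ∑ c, ∑ d,
      tder (U := U) β (algebraMap _ _ (K.H a b c d)) *
      (K.Q (ix a) * K.Q (ix b) * K.Q (ix c) * K.Q (ix d))) := by
  have m := congrArg (tder (U := U) β) K.master
  rw [map_sub, map_smul, map_smul, tder_hTop, tder_metric_term, tder_anchor_term] at m
  rw [vf_apply', Q_ib_term]
  generalize (1 / 24 : ℝ) • ∑ a, ∑ b, ∑ c, ∑ d, tder (U := U) β (algebraMap _ _ (K.H a b c d)) *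
      (K.Q (ix a) * K.Q (ix b) * K.Q (ix c) * K.Q (ix d)) = T at m ⊢
  generalize ∑ μ, tder (U := U) β (K.Q (ix μ)) * tder (U := U) (ix μ) K.theta = A at m ⊢
  generalize ∑ μ, K.Q (ix μ) * tder (U := U) (ix μ) (tder (U := U) β K.theta) = B at m ⊢
  generalize ∑ a, K.Q (ia a) * tder (U := U) (ia a) (tder (U := U) β K.theta) = C at m ⊢
  generalize ∑ μ, tder (U := U) β (K.Q (ix μ)) * K.hForm μ = E at m ⊢
  rw [← sub_eq_zero] at m ⊢
  rcases Int.units_eq_one_or (sgn (tdeg β, 0) (1, 0)) with h | h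
  · rw [h] at m ⊢
    have := congrArg (fun x => (1 / 2 : ℝ) • x) m
    simp only [smul_zero, one_smul] at this ⊢
    rw [← this]
    module
  · rw [h] at m ⊢
    have := congrArg (fun x => (-(1 / 2) : ℝ) • x) m
    simp only [smul_zero, Units.neg_smul, one_smul] at this ⊢
    rw [← this]
    module

theorem vf_Q_inr (β : Fin r ⊕ Fin n) : K.vf (tder (U := U) (Sum.inr β) K.theta) = 0 := by
  rw [vf_tder_theta]
  simp only [tder_inr_algebraMap, zero_mul, Finset.sum_const_zero, smul_zero, neg_zero]

theorem vf_algebraMap (f : Smooth U) : K.vf (algebraMap _ _ f) = ∑ θ, pd θ f • K.Q (ix θ) := by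
  simp only [vf_apply', tder_ix_algebraMap, tder_inr_algebraMap, mul_zero, Finset.sum_const_zero,
    add_zero, ← Algebra.commutes, ← Algebra.smul_def]

theorem vf_hForm (hx : ∀ μ, K.vf (K.Q (ix μ)) = 0) (μ : Fin n) :
    K.vf (K.hForm μ) = (1 / 6 : ℝ) • quad (fun a b c d => pd a (K.H μ b c d))
      (fun ν => K.Q (ix ν)) (fun ν => K.Q (ix ν)) (fun ν => K.Q (ix ν)) (fun ν => K.Q (ix ν)) := by
  generalize hq : (fun ν => K.Q (ix ν)) = q
  have hq' : ∀ ν, K.Q (ix ν) = q ν := fun ν => congrFun hq ν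
  have hd : ∀ a b c, K.vf (algebraMap _ _ (K.H μ a b c)) * (q a * q b * q c) =
      ∑ θ, pd θ (K.H μ a b c) • (q θ * q a * q b * q c) := fun a b c => by
    rw [vf_algebraMap, Finset.sum_mul]
    simp only [smul_mul_assoc, mul_assoc, hq']
  have h0 : tri (K.H μ) (fun ν => K.vf (q ν)) q q = 0 := by
    simp only [tri, ← hq', hx, zero_mul, smul_zero, Finset.sum_const_zero]
  rw [hForm, hq, map_smul, K.isGDer_vf.map_tri_antisymm (K.H_swap₂ μ) (K.H_swap₃ μ)
    (p := (1, 0)) (by simp [sgn]) (fun a => hq' a ▸ K.bideg_Q_ix a), h0, smul_zero, add_zero]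
  have e : ∑ a, ∑ b, ∑ c, ∑ θ, pd θ (K.H μ a b c) • (q θ * q a * q b * q c) =
      ∑ θ, ∑ a, ∑ b, ∑ c, pd θ (K.H μ a b c) • (q θ * q a * q b * q c) := by
    rw [Finset.sum_congr rfl fun a _ => sum_rotate (fun θ b c =>
      pd θ (K.H μ a b c) • (q θ * q a * q b * q c))]
    exact Finset.sum_comm
  simp only [hd, quad, e]

/-- Closedness of the 4-form, contracted with anticommuting elements. -/
theorem quad_pd_H {A : Type} [Ring A] [Algebra (Smooth U) A] [Module ℝ A] {q : Fin n → A}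
    (hq : ∀ μ ν, q μ * q ν = (-1 : ℤˣ) • (q ν * q μ)) (μ : Fin n) :
    quad (fun a b c d => pd μ (K.H a b c d)) q q q q =
      (4 : ℝ) • quad (fun a b c d => pd a (K.H μ b c d)) q q q q := by
  let S := fun F : Fin n → Fin n → Fin n → Fin n → Smooth U => quad F q q q q
  let G : Fin n → Fin n → Fin n → Fin n → Smooth U := fun a b c d => pd a (K.H μ b c d)
  let P : Fin n → Fin n → Fin n → Fin n → Smooth U := fun a b c d => pd μ (K.H a b c d)
  have s₁ : ∀ F, S (fun a b c d => F b a c d) = -S F := fun F => (quad_perm hq F).1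
  have s₂ : ∀ F, S (fun a b c d => F a c b d) = -S F := fun F => (quad_perm hq F).2.1
  have s₃ : ∀ F, S (fun a b c d => F a b d c) = -S F := fun F => (quad_perm hq F).2.2
  -- In the contraction of dH = 0 the four derivatives along the contracted directions each
  -- contribute -S G, which balances S P.
  have hc : S (fun a b c d => P a b c d - G a b c d + G b a c d - G c a b d + G d a b c) = 0 := by
    simp only [P, G, K.H_closed, S, quad, zero_smul, Finset.sum_const_zero]
  have g₁ : S (fun a b c d => G c a b d) = S G := by
    rw [s₂ (fun a b c d => G b a c d), s₁, neg_neg]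
  have g₂ : S (fun a b c d => G d a b c) = -S G := by
    rw [s₃ (fun a b c d => G c a b d), g₁]
  simp only [S, quad_add, quad_sub] at hc
  change S P - S G + S (fun a b c d => G b a c d) - S (fun a b c d => G c a b d)
    + S (fun a b c d => G d a b c) = 0 at hc
  rw [s₁ G, g₁, g₂] at hc
  change S P = (4 : ℝ) • S G
  rw [← sub_eq_zero, ← hc]
  module

/-- `Q² = 0`. -/
theorem vf_Q (α : Idx n r) : K.vf (K.Q α) = 0 := by
  have hx : ∀ μ, K.vf (K.Q (ix μ)) = 0 := fun μ => by
    rw [← tder_ib_theta]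
    exact K.vf_Q_inr _
  rcases α with μ | a | μ
  · exact hx μ
  · rw [Q_ia, map_neg, map_sum, Finset.sum_eq_zero, neg_zero]
    intro b _
    rw [map_smul, vf_Q_inr, smul_zero]
  · have hq : ∀ μ ν, K.Q (ix μ) * K.Q (ix ν) = (-1 : ℤˣ) • (K.Q (ix ν) * K.Q (ix μ)) := fun μ ν =>
      mul_comm_of_mem (K.bideg_Q_ix μ) (K.bideg_Q_ix ν)
    rw [Q_ib, map_sub, map_neg, vf_tder_theta, K.vf_hForm hx μ]
    -- Closedness turns the 1/24 of `vf_tder_theta` into 4/24, which cancels the 1/6 of `vf_hForm`.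
    have h := K.quad_pd_H hq μ
    simp only [tder_ix_algebraMap, ← Algebra.smul_def, tdeg]
    change -(-(sgn (0, 0) (1, 0) • (1 / 24 : ℝ) • quad (fun a b c d => pd μ (K.H a b c d)) _ _ _ _))
      - _ = 0
    rw [h, show sgn (0, 0) (1, 0) = 1 by simp [sgn], one_smul]
    module

end TwistedCourantAlgebroid

end

/-! ### Derivations of local forms and their construction from values on fields and ghosts. -/

noncomputable section

variable {n r : ℕ} {U : TopologicalSpace.Opens (Fin n → ℝ)}

/-- A graded derivation of the local forms that acts on functions of `X` by the chain rule. -/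
structure IsLocalDer (χ : ℤ × ℤ) (D : LocalForms U r →ₗ[ℝ] LocalForms U r) : Prop
    extends IsGDer χ D where
  chain : ∀ f : Smooth U, D (algebraMap _ _ f) = ∑ μ, pd μ f • D (phi U (ix μ))

theorem isLocalDer_extd : IsLocalDer (1, 0) (extd U r) := ⟨isGDer_extd, extd_chain⟩

theorem IsBRSTOperator.isLocalDer {s : LocalForms U r →ₗ[ℝ] LocalForms U r}
    (hs : IsBRSTOperator s) : IsLocalDer (0, 1) s := ⟨hs.isGDer, hs.chain⟩

/-- Leibniz maps on local forms agree if they agree on functions, fields, ghosts and their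
exterior derivatives. -/
theorem local_ext {S T : LocalForms U r →ₗ[ℝ] LocalForms U r}
    (a b : LocalForms U r → LocalForms U r)
    (hS : ∀ x y, S (x * y) = S x * a y + b x * S y)
    (hT : ∀ x y, T (x * y) = T x * a y + b x * T y)
    (halg : ∀ f : Smooth U, S (algebraMap _ _ f) = T (algebraMap _ _ f))
    (hphi : ∀ α, S (phi U α) = T (phi U α))
    (hdphi : ∀ α, S (extd U r (phi U α)) = T (extd U r (phi U α)))
    (hgh : ∀ α, S (ghost U α) = T (ghost U α))
    (hdgh : ∀ α, S (extd U r (ghost U α)) = T (extd U r (ghost U α)))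
    (hgg : ∀ α, S (ghost2 U α) = T (ghost2 U α))
    (hdgg : ∀ α, S (extd U r (ghost2 U α)) = T (extd U r (ghost2 U α))) : S = T := by
  have hneg : ∀ x : LocalForms U r, S (-x) = T (-x) → S x = T x := fun x h => by
    rwa [map_neg, map_neg, neg_inj] at h
  refine LinearMap.ext (derivation_ext a b hS hT halg fun i => ?_)
  cases i with
  | A a => exact hphi (ia a)
  | B μ => exact hphi (ib μ)
  | eps a => exact hgh (ia a)
  | psi μ => exact hneg _ (hgh (ib μ))
  | psit μ => exact hneg _ (hgg (ib μ))
  | dX μ =>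
    have := hdphi (ix μ)
    rwa [phi, extd_coord] at this
  | dA a =>
    have := hdphi (ia a)
    rwa [phi, extd_gen] at this
  | dB μ =>
    have := hdphi (ib μ)
    rwa [phi, extd_gen] at this
  | deps a =>
    have := hdgh (ia a)
    rwa [ghost, extd_gen] at this
  | dpsi μ =>
    have := hdgh (ib μ)
    rw [ghost, map_neg, extd_gen] at this
    exact hneg _ this
  | dpsit μ =>
    have := hdgg (ib μ)
    rw [ghost2, map_neg, extd_gen] at this
    exact hneg _ this

theorem IsLocalDer.eq_zero {χ : ℤ × ℤ} {D : LocalForms U r →ₗ[ℝ] LocalForms U r}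
    (hD : IsLocalDer χ D) (hphi : ∀ α, D (phi U α) = 0)
    (hdphi : ∀ α, D (extd U r (phi U α)) = 0) (hgh : ∀ α, D (ghost U α) = 0)
    (hdgh : ∀ α, D (extd U r (ghost U α)) = 0) (hgg : ∀ α, D (ghost2 U α) = 0)
    (hdgg : ∀ α, D (extd U r (ghost2 U α)) = 0) : D = 0 :=
  local_ext id (twist χ) hD.leibniz (by simp)
    (fun f => by simp only [hD.chain, hphi, smul_zero, Finset.sum_const_zero, LinearMap.zero_apply])
    hphi hdphi hgh hdgh hgg hdgg

theorem IsLocalDer.sub {χ : ℤ × ℤ} {D D' : LocalForms U r →ₗ[ℝ] LocalForms U r}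
    (h : IsLocalDer χ D) (h' : IsLocalDer χ D') : IsLocalDer χ (D - D') :=
  ⟨h.toIsGDer.sub h'.toIsGDer, fun f => by
    simp only [LinearMap.sub_apply, h.chain, h'.chain, smul_sub, Finset.sum_sub_distrib]⟩

/-- The chain rule survives because the terms with second derivatives of f pair a symmetric Hessian
with the product of DX^ν and D'X^μ. They cancel in the graded commutator. -/
theorem IsLocalDer.gcomm {χ χ' : ℤ × ℤ} {D D' : LocalForms U r →ₗ[ℝ] LocalForms U r}
    (h : IsLocalDer χ D) (h' : IsLocalDer χ' D') :
    IsLocalDer (χ + χ') (D ∘ₗ D' - (sgn χ χ' : ℤ) • (D' ∘ₗ D)) := by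
  refine ⟨h.toIsGDer.gcomm h'.toIsGDer, fun f => ?_⟩
  have key : ∀ x, (D ∘ₗ D' - (sgn χ χ' : ℤ) • (D' ∘ₗ D)) x =
      D (D' x) - sgn χ χ' • D' (D x) := fun x => rfl
  have hX : ∀ μ, D (phi U (ix μ)) ∈ bideg fieldDeg χ := fun μ => by
    have := h.degree (bideg_phi (U := U) (r := r) (ix μ))
    rwa [show ((tdeg (ix μ : Idx n r), 0) + χ : ℤ × ℤ) = χ by ext <;> simp [tdeg]] at this
  have hX' : ∀ μ, D' (phi U (ix μ)) ∈ bideg fieldDeg χ' := fun μ => by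
    have := h'.degree (bideg_phi (U := U) (r := r) (ix μ))
    rwa [show ((tdeg (ix μ : Idx n r), 0) + χ' : ℤ × ℤ) = χ' by ext <;> simp [tdeg]] at this
  have e : ∑ μ, ∑ ν, pd ν (pd μ f) • (D' (phi U (ix ν)) * D (phi U (ix μ))) = sgn χ χ' •
      ∑ μ, ∑ ν, pd ν (pd μ f) • (D (phi U (ix ν)) * D' (phi U (ix μ))) := by
    rw [Finset.sum_comm, Finset.smul_sum]
    refine Finset.sum_congr rfl fun μ _ => ?_
    rw [Finset.smul_sum]
    refine Finset.sum_congr rfl fun ν _ => ?_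
    rw [mul_comm_of_mem (hX' _) (hX _), sgn_comm, pd_comm, smul_comm]
  simp only [key, h.chain, h'.chain, map_sum, h.smul_eq, h'.smul_eq, Finset.sum_mul, smul_mul_assoc,
    Finset.sum_add_distrib, e, smul_add, smul_smul, one_smul, smul_sub,
    Finset.sum_sub_distrib, Int.units_mul_self]
  simp only [Finset.smul_sum, smul_comm (sgn χ χ')]
  abel

/-- The derivation `f ↦ ∂_μ f w^μ`. -/
def chainDer (w : Fin n → LocalForms U r) : Derivation ℝ (Smooth U) (LocalForms U r) :=
  ∑ μ, ((LinearMap.toSpanSingleton (Smooth U) (LocalForms U r) (w μ)).compDer (pd μ))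

theorem chainDer_apply (w : Fin n → LocalForms U r) (f : Smooth U) :
    chainDer w f = ∑ μ, pd μ f • w μ := by
  have h : ∀ (t : Finset (Fin n)) (D : Fin n → Derivation ℝ (Smooth U) (LocalForms U r)),
      (∑ μ ∈ t, D μ) f = ∑ μ ∈ t, D μ f := fun t D =>
    map_sum (⟨⟨fun E => E f, rfl⟩, fun _ _ => rfl⟩ :
      Derivation ℝ (Smooth U) (LocalForms U r) →+ LocalForms U r) D t
  rw [chainDer, h]
  rfl

/-- Construction of derivations from their values on fields, ghosts and exterior derivatives. -/
theorem exists_localDer (χ : ℤ × ℤ) (w w' e e' g g' : Idx n r → LocalForms U r)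
    (hw : ∀ α, w α ∈ bideg fieldDeg ((tdeg α, 0) + χ))
    (hw' : ∀ α, w' α ∈ bideg fieldDeg ((tdeg α + 1, 0) + χ))
    (he : ∀ α, e α ∈ bideg fieldDeg ((tdeg α - 1, 1) + χ))
    (he' : ∀ α, e' α ∈ bideg fieldDeg ((tdeg α, 1) + χ))
    (hg : ∀ α, g α ∈ bideg fieldDeg ((tdeg α - 2, 2) + χ))
    (hg' : ∀ α, g' α ∈ bideg fieldDeg ((tdeg α - 1, 2) + χ))
    (he0 : ∀ μ, e (ix μ) = 0) (he0' : ∀ μ, e' (ix μ) = 0) (hg0 : ∀ μ, g (ix μ) = 0)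
    (hg0' : ∀ μ, g' (ix μ) = 0) (hg1 : ∀ a, g (ia a) = 0) (hg1' : ∀ a, g' (ia a) = 0) :
    ∃ D : LocalForms U r →ₗ[ℝ] LocalForms U r, IsLocalDer χ D ∧
      (∀ α, D (phi U α) = w α) ∧ (∀ α, D (extd U r (phi U α)) = w' α) ∧
      (∀ α, D (ghost U α) = e α) ∧ (∀ α, D (extd U r (ghost U α)) = e' α) ∧
      (∀ α, D (ghost2 U α) = g α) ∧ (∀ α, D (extd U r (ghost2 U α)) = g' α) := by
  let v : FieldGen n r → LocalForms U r := fun i => match i with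
    | .A a => w (ia a) | .B μ => w (ib μ) | .eps a => e (ia a) | .psi μ => -e (ib μ)
    | .psit μ => -g (ib μ) | .dX μ => w' (ix μ) | .dA a => w' (ia a) | .dB μ => w' (ib μ)
    | .deps a => e' (ia a) | .dpsi μ => -e' (ib μ) | .dpsit μ => -g' (ib μ)
  obtain ⟨D, hD, hf, hv⟩ := exists_gder χ (chainDer fun μ => w (ix μ)) v
    (fun f => by
      rw [chainDer_apply]
      refine sum_mem fun μ _ => Submodule.smul_mem _ _ ?_
      have := hw (ix μ)
      rwa [show ((tdeg (ix μ : Idx n r), 0) + χ : ℤ × ℤ) = χ by ext <;> simp [tdeg]] at this)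
    (fun i => by
      cases i with
      | A a => exact hw (ia a)
      | B μ => exact hw (ib μ)
      | eps a => exact he (ia a)
      | psi μ => exact neg_mem (he (ib μ))
      | psit μ => exact neg_mem (hg (ib μ))
      | dX μ => exact hw' (ix μ)
      | dA μ => exact hw' (ia μ)
      | dB μ => exact hw' (ib μ)
      | deps a => exact he' (ia a)
      | dpsi μ => exact neg_mem (he' (ib μ))
      | dpsit μ => exact neg_mem (hg' (ib μ)))
  have hX : ∀ μ, D (phi U (ix μ)) = w (ix μ) := fun μ => by
    change D (algebraMap _ _ (coord U μ)) = _
    rw [hf, chainDer_apply]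
    simp [pd_coord]
  refine ⟨D, ⟨hD, fun f => by simp only [hf, chainDer_apply, hX]⟩, ?_, ?_, ?_, ?_, ?_, ?_⟩ <;>
    rintro (μ | a | μ)
  · exact hX μ
  · exact hv (.A a)
  · exact hv (.B μ)
  · rw [phi, extd_coord]; exact hv (.dX μ)
  · rw [phi, extd_gen]; exact hv (.dA a)
  · rw [phi, extd_gen]; exact hv (.dB μ)
  · rw [he0, ghost, map_zero]
  · exact hv (.eps a)
  · rw [ghost, map_neg, hv]; exact neg_neg _
  · rw [he0', ghost, map_zero, map_zero]
  · rw [ghost, extd_gen]; exact hv (.deps a)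
  · rw [ghost, map_neg, extd_gen, map_neg]
    refine (congrArg _ (hv (.dpsi μ))).trans (neg_neg _)
  · rw [hg0, ghost2, map_zero]
  · rw [hg1, ghost2, map_zero]
  · rw [ghost2, map_neg, hv]; exact neg_neg _
  · rw [hg0', ghost2, map_zero, map_zero]
  · rw [hg1', ghost2, map_zero, map_zero]
  · rw [ghost2, map_neg, extd_gen, map_neg]
    refine (congrArg _ (hv (.dpsit μ))).trans (neg_neg _)

/-- For the odd operator d one has 2d² = [d, d], a derivation. It vanishes on functions by symmetry
of the Hessian and on the other generators by definition. -/
theorem extd_extd (x : LocalForms U r) : extd U r (extd U r x) = 0 := by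
  have h := (isLocalDer_extd (U := U) (r := r)).gcomm isLocalDer_extd
  have key : ∀ x, (extd U r ∘ₗ extd U r - (sgn (1, 0) (1, 0) : ℤ) • (extd U r ∘ₗ extd U r)) x =
      (2 : ℝ) • extd U r (extd U r x) := fun x => by
    have : sgn (1, 0) (1, 0) = -1 := by simp [sgn]
    rw [this, two_smul]
    simp
  have hd : ∀ α, extd U r (extd U r (phi U α)) = 0 ∧ extd U r (extd U r (ghost U α)) = 0 ∧
      extd U r (extd U r (ghost2 U α)) = 0 := by
    rintro (μ | a | μ)
    · refine ⟨?_, by simp [ghost], by simp [ghost2]⟩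
      rw [phi, extd_coord, extd_gen]; rfl
    · refine ⟨?_, ?_, by simp [ghost2]⟩ <;> simp only [phi, ghost, extd_gen, dGen]
    · refine ⟨?_, ?_, ?_⟩ <;> simp only [phi, ghost, ghost2, map_neg, extd_gen, dGen, neg_zero]
  have h0 := h.eq_zero (fun α => ?_) (fun α => ?_) (fun α => ?_) (fun α => ?_) (fun α => ?_)
    (fun α => ?_)
  · have := DFunLike.congr_fun h0 x
    rw [key] at this
    exact (smul_eq_zero_iff_right two_ne_zero).mp this
  all_goals rw [key]
  · rw [(hd α).1, smul_zero]
  · rw [(hd α).1, map_zero, smul_zero]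
  · rw [(hd α).2.1, smul_zero]
  · rw [(hd α).2.1, map_zero, smul_zero]
  · rw [(hd α).2.2, smul_zero]
  · rw [(hd α).2.2, map_zero, smul_zero]

end

/-! ### Taylor coefficients of target functions in the ghosts. -/

noncomputable section

variable {n r : ℕ} {U : TopologicalSpace.Opens (Fin n → ℝ)}

/-- `ε^β ∂_β f`. -/
def del₁ (f : Target U r) : LocalForms U r := contr₁ (ghost U) fun β => tder (U := U) β f

/-- `ε̃^β ∂_β f + ½ ε^β ε^γ ∂_β ∂_γ f`. -/
def del₂ (f : Target U r) : LocalForms U r :=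
  contr₁ (ghost2 U) (fun β => tder (U := U) β f) + (1 / 2 : ℝ) • contr₂ fun β γ =>
    tder (U := U) β (tder (U := U) γ f)

/-- `ε̃^β ε^γ ∂_β ∂_γ f + (1/3!) ε^β ε^γ ε^δ ∂_β ∂_γ ∂_δ f`. -/
def del₃ (f : Target U r) : LocalForms U r :=
  contrMixed (fun β γ => tder (U := U) β (tder (U := U) γ f)) +
    (1 / 6 : ℝ) • contr₃ fun β γ δ => tder (U := U) β (tder (U := U) γ (tder (U := U) δ f))

theorem bideg_tder {k : ℤ} {f : Target U r} (hf : f ∈ bideg targetDeg (k, 0)) (β : Idx n r) :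
    tder (U := U) β f ∈ bideg targetDeg (k - tdeg β, 0) := by
  have := (isGDer_tder (U := U) β).degree hf
  rwa [show ((k, 0) + (-tdeg β, 0) : ℤ × ℤ) = (k - tdeg β, 0) by ext <;> simp; ring] at this

theorem bideg_contr₁_ghost {k : ℤ} {M : Idx n r → Target U r}
    (hM : ∀ β, M β ∈ bideg targetDeg (k - tdeg β, 0)) :
    contr₁ (ghost U) M ∈ bideg fieldDeg (k - 1, 1) :=
  sum_mem fun β _ => bideg_mul (bideg_ghost β) (bideg_pull (hM β)) (by ext <;> simp)

theorem bideg_contr₁_ghost2 {k : ℤ} {M : Idx n r → Target U r}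
    (hM : ∀ β, M β ∈ bideg targetDeg (k - tdeg β, 0)) :
    contr₁ (ghost2 U) M ∈ bideg fieldDeg (k - 2, 2) :=
  sum_mem fun β _ => bideg_mul (bideg_ghost2 β) (bideg_pull (hM β)) (by ext <;> simp)

theorem bideg_contr₂ {k : ℤ} {M : Idx n r → Idx n r → Target U r}
    (hM : ∀ β γ, M β γ ∈ bideg targetDeg (k - tdeg β - tdeg γ, 0)) :
    contr₂ M ∈ bideg fieldDeg (k - 2, 2) :=
  sum_mem fun β _ => sum_mem fun γ _ => bideg_units_smul _ <|
    bideg_mul (bideg_mul (bideg_ghost β) (bideg_ghost γ) rfl) (bideg_pull (hM β γ))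
      (by ext <;> simp; ring)

theorem bideg_contr₃ {k : ℤ} {M : Idx n r → Idx n r → Idx n r → Target U r}
    (hM : ∀ β γ δ, M β γ δ ∈ bideg targetDeg (k - tdeg β - tdeg γ - tdeg δ, 0)) :
    contr₃ M ∈ bideg fieldDeg (k - 3, 3) :=
  sum_mem fun β _ => sum_mem fun γ _ => sum_mem fun δ _ => bideg_units_smul _ <|
    bideg_mul (bideg_mul (bideg_mul (bideg_ghost β) (bideg_ghost γ) rfl) (bideg_ghost δ) rfl)
      (bideg_pull (hM β γ δ)) (by ext <;> simp; ring)

theorem bideg_contrMixed {k : ℤ} {M : Idx n r → Idx n r → Target U r}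
    (hM : ∀ β γ, M β γ ∈ bideg targetDeg (k - tdeg β - tdeg γ, 0)) :
    contrMixed M ∈ bideg fieldDeg (k - 3, 3) :=
  sum_mem fun β _ => sum_mem fun γ _ =>
    bideg_mul (bideg_mul (bideg_ghost2 β) (bideg_ghost γ) rfl) (bideg_pull (hM β γ))
      (by ext <;> simp; ring)

theorem bideg_del₁ {k : ℤ} {f : Target U r} (hf : f ∈ bideg targetDeg (k, 0)) :
    del₁ f ∈ bideg fieldDeg (k - 1, 1) := bideg_contr₁_ghost fun β => bideg_tder hf β

theorem bideg_tder₂ {k : ℤ} {f : Target U r} (hf : f ∈ bideg targetDeg (k, 0)) (β γ : Idx n r) :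
    tder (U := U) β (tder (U := U) γ f) ∈ bideg targetDeg (k - tdeg β - tdeg γ, 0) := by
  rw [sub_right_comm]
  exact bideg_tder (bideg_tder hf γ) β

theorem bideg_tder₃ {k : ℤ} {f : Target U r} (hf : f ∈ bideg targetDeg (k, 0)) (β γ δ : Idx n r) :
    tder (U := U) β (tder (U := U) γ (tder (U := U) δ f)) ∈ bideg targetDeg (k - tdeg β - tdeg γ - tdeg δ, 0) := by
  have := bideg_tder (bideg_tder₂ hf γ δ) β
  rwa [show k - tdeg γ - tdeg δ - tdeg β = k - tdeg β - tdeg γ - tdeg δ by ring] at this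

theorem bideg_del₂ {k : ℤ} {f : Target U r} (hf : f ∈ bideg targetDeg (k, 0)) :
    del₂ f ∈ bideg fieldDeg (k - 2, 2) :=
  add_mem (bideg_contr₁_ghost2 fun β => bideg_tder hf β)
    (bideg_real_smul _ (bideg_contr₂ (bideg_tder₂ hf)))

theorem bideg_del₃ {k : ℤ} {f : Target U r} (hf : f ∈ bideg targetDeg (k, 0)) :
    del₃ f ∈ bideg fieldDeg (k - 3, 3) :=
  add_mem (bideg_contrMixed (bideg_tder₂ hf)) (bideg_real_smul _ (bideg_contr₃ (bideg_tder₃ hf)))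

theorem ghost2_mul_comm (β : Idx n r) (x : LocalForms U r) : ghost2 U β * x = x * ghost2 U β := by
  rcases β with μ | a | μ
  · simp [ghost2]
  · simp [ghost2]
  · exact even_mul_comm (p := (0, 2)) Even.zero even_two (bideg_ghost2 (ib μ)) x

theorem ghost2_smul_eq {β : Idx n r} {u v : ℤˣ} (h : ∀ μ, β = ib μ → u = v)
    (x : LocalForms U r) : u • (ghost2 U β * x) = v • (ghost2 U β * x) := by
  rcases β with μ | a | μ
  · simp [ghost2]
  · simp [ghost2]
  · rw [h μ rfl]

/-- Only the components of ε̃ of type b are non-zero, and the corresponding derivatives are even. -/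
theorem ghost2_tder_comm (β γ : Idx n r) (f : Target U r) (x : LocalForms U r) :
    ghost2 U β * (x * pull U r (tder (U := U) β (tder (U := U) γ f))) =
      ghost2 U β * (x * pull U r (tder (U := U) γ (tder (U := U) β f))) := by
  rcases β with μ | a | μ
  · simp [ghost2]
  · simp [ghost2]
  · rw [tder_comm, sgn_of_even (p := cdeg (ib μ : Idx n r)) even_two Even.zero, one_smul]

/-- The sign of moving a derivation of bidegree `(-1, 1)` past `ε^β`. -/
theorem sgn_ghost (β : Idx n r) : sgn (-1, 1) (tdeg β - 1, 1) = Int.negOnePow (tdeg β) := by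
  simp only [sgn]
  rw [Int.negOnePow_eq_iff]
  exact ⟨1 - tdeg β, by ring⟩

/-- The convention for contracting εε and the symmetry sign of ∂_β ∂_γ combine to the sign of moving
Δ past ε^β (`sgn_ghost`). This is why all signs disappear in the relations between `del₁`, `del₂`
and `del₃`. -/
theorem passSign_mul_sgn (β γ : Idx n r) :
    passSign β γ * sgn (cdeg β) (cdeg γ) = Int.negOnePow (tdeg β) := by
  simp only [sgn, passSign, cdeg]
  rw [← Int.negOnePow_add]
  congr 1
  ring

variable {Δ : LocalForms U r →ₗ[ℝ] LocalForms U r}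

section Shift

variable (hΔ : IsLocalDer (-1, 1) Δ) (hφ : ∀ α, Δ (phi U α) = ghost U α)
  (hε : ∀ α, Δ (ghost U α) = (2 : ℝ) • ghost2 U α) (hg : ∀ α, Δ (ghost2 U α) = 0)

include hΔ hφ in
theorem shift_pull (f : Target U r) : Δ (pull U r f) = del₁ f := by
  rw [chain_rule hΔ.toIsGDer hΔ.chain]
  simp only [hφ]
  rfl

include hΔ hφ hε in
-- `del₁`, `del₂`, `del₃` are the divided powers Δ^k f / k! of the shift Δ. The value 2ε̃ of Δ on ε
-- is normalised so that ε̃ enters `del₂` with coefficient 1.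
theorem shift_del₁ (f : Target U r) : Δ (del₁ f) = (2 : ℝ) • del₂ f := by
  have e : (2 : ℝ) • del₂ f = ∑ β, ((2 : ℝ) • (ghost2 U β * pull U r (tder (U := U) β f)) +
      ∑ γ, passSign β γ •
        (ghost U β * ghost U γ * pull U r (tder (U := U) β (tder (U := U) γ f)))) := by
    rw [del₂, smul_add, smul_smul, Finset.sum_add_distrib, contr₁, contr₂, Finset.smul_sum]
    norm_num
  rw [e, del₁, contr₁, map_sum]
  refine Finset.sum_congr rfl fun β _ => ?_
  rw [hΔ.mul_of_mem' (bideg_ghost β), hε, shift_pull hΔ hφ, smul_mul_assoc, add_right_inj, del₁,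
    contr₁, Finset.mul_sum, Finset.smul_sum]
  refine Finset.sum_congr rfl fun γ _ => ?_
  rw [tder_comm β γ, map_units_smul', mul_smul_comm, smul_smul, passSign_mul_sgn, sgn_ghost,
    mul_assoc]

include hΔ hφ hε hg in
-- The mixed term appears once from ε̃^β ∂_β f and four times, with weight ½, from the two ghosts in
-- εε∂∂f and the symmetry between them, hence 3 in total. The cubic term has weight ½ = 3 · 1/3!.
theorem shift_del₂ (f : Target U r) : Δ (del₂ f) = (3 : ℝ) • del₃ f := by
  have e₁ : Δ (contr₁ (ghost2 U) fun β => tder (U := U) β f) =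
      contrMixed fun β γ => tder (U := U) β (tder (U := U) γ f) := by
    simp only [contr₁, contrMixed, map_sum]
    refine Finset.sum_congr rfl fun β _ => ?_
    rw [hΔ.leibniz, hg, zero_mul, zero_add, shift_pull hΔ hφ, twist_of_mem (bideg_ghost2 β),
      smul_mul_assoc, ghost2_smul_eq (v := 1), one_smul]
    · simp only [del₁, contr₁, Finset.mul_sum, ← ghost2_tder_comm β, mul_assoc]
    · rintro μ rfl
      rw [sgn_comm]
      exact sgn_of_even (by simp [tdeg]) even_two _
  have e₂ : Δ (contr₂ fun β γ => tder (U := U) β (tder (U := U) γ f)) =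
      (4 : ℝ) • contrMixed (fun β γ => tder (U := U) β (tder (U := U) γ f)) +
        contr₃ fun β γ δ => tder (U := U) β (tder (U := U) γ (tder (U := U) δ f)) := by
    have t : ∀ β γ,
        Δ (passSign β γ • (ghost U β * ghost U γ * pull U r (tder (U := U) β (tder (U := U) γ f)))) =
        (2 : ℝ) • (ghost2 U β * ghost U γ * pull U r (tder (U := U) β (tder (U := U) γ f))) +
        (2 : ℝ) • (ghost2 U γ * ghost U β * pull U r (tder (U := U) γ (tder (U := U) β f))) +
        ∑ δ, (passSign β γ * passSign β δ * passSign γ δ) •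
          (ghost U β * ghost U γ * ghost U δ * pull U r (tder (U := U) β (tder (U := U) γ (tder (U := U) δ f)))) := by
      intro β γ
      rw [map_units_smul', mul_assoc, hΔ.mul_of_mem' (bideg_ghost β),
        hΔ.mul_of_mem' (bideg_ghost γ), hε, hε, shift_pull hΔ hφ, mul_add, smul_add, smul_add,
          smul_add,
        ← add_assoc, smul_mul_assoc, smul_comm _ (2 : ℝ), ghost2_smul_eq (v := 1), one_smul,
        mul_assoc (ghost2 U β)]
      · congr 1
        · congr 1
          rw [smul_mul_assoc, mul_smul_comm, smul_comm _ (2 : ℝ), smul_comm _ (2 : ℝ), ← mul_assoc,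
            ← ghost2_mul_comm, mul_assoc, ← ghost2_tder_comm, smul_smul, ghost2_smul_eq (v := 1),
            one_smul, mul_assoc]
          rintro μ rfl
          rw [sgn_ghost, passSign, sgn, ← Int.negOnePow_add]
          exact Int.negOnePow_even _ ⟨0, by simp [tdeg]⟩
        · rw [del₁, contr₁, mul_smul_comm, Finset.mul_sum, Finset.mul_sum, Finset.smul_sum,
            Finset.smul_sum, Finset.smul_sum]
          refine Finset.sum_congr rfl fun δ _ => ?_
          -- The chain rule for Δ puts ∂_δ outermost. Moving it inside gives signs which, with those
          -- of Δ passing ε^β and ε^γ, are the signs built into `contr₃`.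
          have hd : tder (U := U) β (tder (U := U) γ (tder (U := U) δ f)) =
              (sgn (cdeg γ) (cdeg δ) * sgn (cdeg β) (cdeg δ)) •
                tder (U := U) δ (tder (U := U) β (tder (U := U) γ f)) := by
            rw [tder_comm γ δ, map_units_smul', tder_comm β δ, smul_smul]
          have hs : passSign β γ * passSign β δ * passSign γ δ *
              (sgn (cdeg γ) (cdeg δ) * sgn (cdeg β) (cdeg δ)) = passSign β γ *
              sgn (-1, 1) (tdeg β - 1, 1) * sgn (-1, 1) (tdeg γ - 1, 1) := by
            rw [sgn_ghost, sgn_ghost, ← passSign_mul_sgn β δ, ← passSign_mul_sgn γ δ]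
            ac_rfl
          rw [hd, map_units_smul', mul_smul_comm, smul_smul, smul_smul, smul_smul, hs,
            mul_assoc, mul_assoc, mul_assoc]
      · rintro μ rfl
        exact sgn_of_even (by simp [tdeg]) Even.zero _
    simp only [contr₂, map_sum, t, Finset.sum_add_distrib, ← Finset.smul_sum]
    rw [Finset.sum_comm (f := fun β γ =>
      ghost2 U γ * ghost U β * pull U r (tder (U := U) γ (tder (U := U) β f)))]
    simp only [contrMixed, contr₃]
    module
  rw [del₂, map_add, map_smul, e₁, e₂, del₃]
  module

end Shift

theorem IsLocalDer.del_eq_zero {χ : ℤ × ℤ} {D : LocalForms U r →ₗ[ℝ] LocalForms U r}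
    (hD : IsLocalDer χ D) (hφ : ∀ α, D (phi U α) = 0) (hε : ∀ α, D (ghost U α) = 0)
    (hg : ∀ α, D (ghost2 U α) = 0) (f : Target U r) :
    D (pull U r f) = 0 ∧ D (del₁ f) = 0 ∧ D (del₂ f) = 0 := by
  have hp : ∀ f, D (pull U r f) = 0 := fun f => by
    rw [chain_rule hD.toIsGDer hD.chain]
    simp only [hφ, zero_mul, Finset.sum_const_zero]
  refine ⟨hp f, ?_, ?_⟩
  · simp only [del₁, contr₁, map_sum, hD.leibniz, hε, hp, zero_mul, mul_zero, add_zero,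
      Finset.sum_const_zero]
  · simp only [del₂, contr₁, contr₂, map_add, map_smul, map_units_smul', map_sum, hD.leibniz, hε,
      hg, hp, zero_mul, mul_zero, add_zero, smul_zero, Finset.sum_const_zero]

end

/-! ### The on-shell projection and the differential it induces. -/

noncomputable section

variable {n r : ℕ} {U : TopologicalSpace.Opens (Fin n → ℝ)}

namespace TwistedCourantAlgebroid

variable (K : TwistedCourantAlgebroid U r)

/-- The values of the on-shell projection on generators: `dφ^α ↦ Q^α`. -/
def onShellGen : FieldGen n r → LocalForms U r
  | .dX μ => pull U r (K.Q (ix μ))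
  | .dA a => pull U r (K.Q (ia a))
  | .dB μ => pull U r (K.Q (ib μ))
  | i => fgen U i

theorem bideg_onShellGen (i : FieldGen n r) : K.onShellGen i ∈ bideg fieldDeg (fieldDeg i) := by
  cases i with
  | dX μ => exact bideg_pull (K.bideg_Q (ix μ))
  | dA a => exact bideg_pull (K.bideg_Q (ia a))
  | dB μ => exact bideg_pull (K.bideg_Q (ib μ))
  | _ => exact bideg_gen _

/-- The on-shell projection, the algebra map `dφ^α ↦ Q^α` that fixes fields, ghosts and the
exterior derivatives of the ghosts. -/
def onShell : LocalForms U r →ₐ[Smooth U] LocalForms U r :=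
  lift K.onShellGen fun i j => mul_comm_of_mem (K.bideg_onShellGen i) (K.bideg_onShellGen j)

theorem onShell_gen (i : FieldGen n r) : K.onShell (fgen U i) = K.onShellGen i := lift_gen _ _ i

theorem onShell_real_smul (c : ℝ) (x : LocalForms U r) : K.onShell (c • x) = c • K.onShell x :=
  map_smul (K.onShell.restrictScalars ℝ) c x

theorem twist_onShell (χ : ℤ × ℤ) (x : LocalForms U r) :
    twist χ (K.onShell x) = K.onShell (twist χ x) :=
  twist_map (fun i => by rw [onShell_gen]; exact K.bideg_onShellGen i) χ x

theorem onShell_pull (f : Target U r) : K.onShell (pull U r f) = pull U r f := by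
  have h : K.onShell.comp (pull U r) = pull U r := algHom_ext_gen fun i => by
    rw [AlgHom.comp_apply, pull_gen]
    rcases i with a | μ
    · exact K.onShell_gen (.A a)
    · exact K.onShell_gen (.B μ)
  exact DFunLike.congr_fun h f

theorem onShell_phi (α : Idx n r) : K.onShell (phi U α) = phi U α := by
  rcases α with μ | a | μ
  · exact K.onShell.commutes _
  · exact K.onShell_gen (.A a)
  · exact K.onShell_gen (.B μ)

theorem onShell_ghost (α : Idx n r) : K.onShell (ghost U α) = ghost U α := by
  rcases α with μ | a | μ
  · exact map_zero _
  · exact K.onShell_gen (.eps a)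
  · rw [ghost, map_neg, onShell_gen]; rfl

theorem onShell_ghost2 (α : Idx n r) : K.onShell (ghost2 U α) = ghost2 U α := by
  rcases α with μ | a | μ
  · exact map_zero _
  · exact map_zero _
  · rw [ghost2, map_neg, onShell_gen]; rfl

theorem onShell_extd_phi (α : Idx n r) :
    K.onShell (extd U r (phi U α)) = pull U r (K.Q α) := by
  rcases α with μ | a | μ
  · rw [phi, extd_coord, onShell_gen]; rfl
  · rw [phi, extd_gen]; exact K.onShell_gen (.dA a)
  · rw [phi, extd_gen]; exact K.onShell_gen (.dB μ)

theorem onShell_extd_ghost (α : Idx n r) :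
    K.onShell (extd U r (ghost U α)) = extd U r (ghost U α) := by
  rcases α with μ | a | μ
  · simp [ghost]
  · rw [ghost, extd_gen]; exact K.onShell_gen (.deps a)
  · rw [ghost, map_neg, map_neg, extd_gen]; exact congrArg _ (K.onShell_gen (.dpsi μ))

theorem onShell_extd_ghost2 (α : Idx n r) :
    K.onShell (extd U r (ghost2 U α)) = extd U r (ghost2 U α) := by
  rcases α with μ | a | μ
  · simp [ghost2]
  · simp [ghost2]
  · rw [ghost2, map_neg, map_neg, extd_gen]; exact congrArg _ (K.onShell_gen (.dpsit μ))

theorem onShell_contr₁ {e : Idx n r → LocalForms U r} (he : ∀ β, K.onShell (e β) = e β)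
    (M : Idx n r → Target U r) : K.onShell (contr₁ e M) = contr₁ e M := by
  simp only [contr₁, map_sum, map_mul, he, onShell_pull]

theorem onShell_contr₂ (M : Idx n r → Idx n r → Target U r) :
    K.onShell (contr₂ M) = contr₂ M := by
  simp only [contr₂, map_sum, map_units_smul', map_mul, onShell_ghost, onShell_pull]

theorem onShell_contr₃ (M : Idx n r → Idx n r → Idx n r → Target U r) :
    K.onShell (contr₃ M) = contr₃ M := by
  simp only [contr₃, map_sum, map_units_smul', map_mul, onShell_ghost, onShell_pull]

theorem onShell_contrMixed (M : Idx n r → Idx n r → Target U r) :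
    K.onShell (contrMixed M) = contrMixed M := by
  simp only [contrMixed, map_sum, map_mul, onShell_ghost, onShell_ghost2, onShell_pull]

theorem onShell_del₁ (f : Target U r) : K.onShell (del₁ f) = del₁ f :=
  K.onShell_contr₁ K.onShell_ghost _

theorem onShell_del₂ (f : Target U r) : K.onShell (del₂ f) = del₂ f := by
  rw [del₂, map_add, onShell_real_smul, onShell_contr₂, K.onShell_contr₁ K.onShell_ghost2]

theorem onShell_del₃ (f : Target U r) : K.onShell (del₃ f) = del₃ f := by
  rw [del₃, map_add, onShell_real_smul, onShell_contr₃, onShell_contrMixed]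

theorem pull_vf (f : Target U r) :
    pull U r (K.vf f) = ∑ β, pull U r (K.Q β) * pull U r (tder (U := U) β f) := by
  rw [vf_apply, map_sum]
  exact Finset.sum_congr rfl fun β _ => map_mul _ _ _

theorem onShell_extd_pull (f : Target U r) :
    K.onShell (extd U r (pull U r f)) = pull U r (K.vf f) := by
  rw [chain_rule isGDer_extd extd_chain, map_sum, pull_vf]
  refine Finset.sum_congr rfl fun β _ => ?_
  rw [map_mul, onShell_extd_phi, onShell_pull]

theorem onShell_fieldStrength (α : Idx n r) : K.onShell (K.fieldStrength α) = 0 := by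
  rw [fieldStrength, map_sub, onShell_extd_phi, onShell_pull, sub_self]

/-- Here Q² = 0 enters: by d² = 0 the form dF^α is minus the differential of the pull-back of Q^α,
whose projection is the pull-back of Q(Q^α). -/
theorem onShell_extd_fieldStrength (α : Idx n r) :
    K.onShell (extd U r (K.fieldStrength α)) = 0 := by
  rw [fieldStrength, map_sub, map_sub, extd_extd, onShell_extd_pull, vf_Q, map_zero, map_zero,
    sub_zero]

theorem weaklyZero_zero : K.WeaklyZero 0 := zero_mem _

/-- On generators the difference is F^α or zero, and for products it telescopes. The forms dF^α are
not needed for this inclusion. -/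
theorem sub_onShell_mem (x : LocalForms U r) : K.WeaklyZero (x - K.onShell x) := by
  have hF : ∀ α, K.WeaklyZero (extd U r (phi U α) - pull U r (K.Q α)) := fun α =>
    TwoSidedIdeal.subset_span (Or.inl ⟨α, rfl⟩)
  induction x using gcalg_induction with
  | halg f =>
    rw [AlgHom.commutes, sub_self]
    exact K.weaklyZero_zero
  | hgen i =>
    rw [onShell_gen]
    cases i with
    | dX μ => have := hF (ix μ); rwa [phi, extd_coord] at this
    | dA a => have := hF (ia a); rwa [phi, extd_gen] at this
    | dB μ => have := hF (ib μ); rwa [phi, extd_gen] at this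
    | _ => exact (congrArg K.WeaklyZero (sub_self _)).mpr K.weaklyZero_zero
  | hadd x y hx hy =>
    rw [map_add, add_sub_add_comm]
    exact add_mem hx hy
  | hmul x y hx hy =>
    rw [map_mul, show x * y - K.onShell x * K.onShell y =
      (x - K.onShell x) * y + K.onShell x * (y - K.onShell y) by rw [sub_mul, mul_sub]; abel]
    exact add_mem (TwoSidedIdeal.mul_mem_right _ _ _ hx) (TwoSidedIdeal.mul_mem_left _ _ _ hy)

/-- The generators of the stationary ideal lie in the kernel of the projection, and conversely every
form is congruent to its projection. All weak equations below are decided through this criterion. -/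
theorem weaklyZero_iff (x : LocalForms U r) : K.WeaklyZero x ↔ K.onShell x = 0 := by
  constructor
  · intro hx
    have h : K.stationaryIdeal ≤ TwoSidedIdeal.ker K.onShell := by
      refine TwoSidedIdeal.span_le.mpr ?_
      rintro _ (⟨α, rfl⟩ | ⟨α, rfl⟩)
      · exact (TwoSidedIdeal.mem_ker _).mpr (K.onShell_fieldStrength α)
      · exact (TwoSidedIdeal.mem_ker _).mpr (K.onShell_extd_fieldStrength α)
    exact (TwoSidedIdeal.mem_ker _).mp (h hx)
  · intro hx
    have := K.sub_onShell_mem x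
    rwa [hx, sub_zero] at this

/-- A derivation intertwined with another one by the on-shell projection on the generators is
intertwined on all local forms. -/
theorem onShell_intertwine {χ : ℤ × ℤ} {D D' : LocalForms U r →ₗ[ℝ] LocalForms U r}
    (hD : IsLocalDer χ D) (hD' : IsLocalDer χ D')
    (h₁ : ∀ α, K.onShell (D (phi U α)) = D' (phi U α))
    (h₂ : ∀ α, K.onShell (D (extd U r (phi U α))) = D' (pull U r (K.Q α)))
    (h₃ : ∀ α, K.onShell (D (ghost U α)) = D' (ghost U α))
    (h₄ : ∀ α, K.onShell (D (extd U r (ghost U α))) = D' (extd U r (ghost U α)))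
    (h₅ : ∀ α, K.onShell (D (ghost2 U α)) = D' (ghost2 U α))
    (h₆ : ∀ α, K.onShell (D (extd U r (ghost2 U α))) = D' (extd U r (ghost2 U α)))
    (x : LocalForms U r) : K.onShell (D x) = D' (K.onShell x) := by
  let P : LocalForms U r →ₗ[ℝ] LocalForms U r := K.onShell.toLinearMap.restrictScalars ℝ
  have h : P ∘ₗ D = D' ∘ₗ P := local_ext K.onShell (fun x => twist χ (K.onShell x))
    (fun x y => ?_) (fun x y => ?_) (fun f => ?_) (fun α => ?_) (fun α => ?_) (fun α => ?_)
    (fun α => ?_) (fun α => ?_) (fun α => ?_)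
  · exact DFunLike.congr_fun h x
  · change K.onShell (D (x * y)) = K.onShell (D x) * K.onShell y + _ * K.onShell (D y)
    rw [hD.leibniz, map_add, map_mul, map_mul, twist_onShell]
  · change D' (K.onShell (x * y)) = D' (K.onShell x) * _ + _ * D' (K.onShell y)
    rw [map_mul, hD'.leibniz]
  · change K.onShell (D _) = D' (K.onShell _)
    rw [AlgHom.commutes, hD.chain, hD'.chain, map_sum]
    exact Finset.sum_congr rfl fun μ _ => by rw [map_smul, h₁]
  · exact (h₁ α).trans (congrArg D' (K.onShell_phi α).symm)
  · exact (h₂ α).trans (congrArg D' (K.onShell_extd_phi α).symm)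
  · exact (h₃ α).trans (congrArg D' (K.onShell_ghost α).symm)
  · exact (h₄ α).trans (congrArg D' (K.onShell_extd_ghost α).symm)
  · exact (h₅ α).trans (congrArg D' (K.onShell_ghost2 α).symm)
  · exact (h₆ α).trans (congrArg D' (K.onShell_extd_ghost2 α).symm)

/-- The differential induced by `d` on the on-shell forms: `φ^α ↦ Q^α`, the ghosts are kept with
their exterior derivatives. -/
structure IsOnShellDifferential (N : LocalForms U r →ₗ[ℝ] LocalForms U r) : Prop
    extends IsLocalDer (1, 0) N where
  phi : ∀ α, N (phi U α) = pull U r (K.Q α)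
  -- The differentials dφ do not occur in the image of the projection. The value 0 is a choice for
  -- which N² = 0 holds on the whole algebra.
  extd_phi : ∀ α, N (extd U r (TwistedCourant.phi U α)) = 0
  ghost : ∀ α, N (ghost U α) = extd U r (TwistedCourant.ghost U α)
  extd_ghost : ∀ α, N (extd U r (TwistedCourant.ghost U α)) = 0
  ghost2 : ∀ α, N (ghost2 U α) = extd U r (TwistedCourant.ghost2 U α)
  extd_ghost2 : ∀ α, N (extd U r (TwistedCourant.ghost2 U α)) = 0

theorem exists_onShellDifferential : ∃ N, K.IsOnShellDifferential N := by
  obtain ⟨N, hN, h₁, h₂, h₃, h₄, h₅, h₆⟩ := exists_localDer (1, 0) (fun α => pull U r (K.Q α)) 0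
    (fun α => extd U r (ghost U α)) 0 (fun α => extd U r (ghost2 U α)) 0
    (fun α => bideg_pull (K.bideg_Q α)) (fun _ => zero_mem _)
    (fun α => isGDer_extd.degree (bideg_ghost α)) (fun _ => zero_mem _)
    (fun α => isGDer_extd.degree (bideg_ghost2 α)) (fun _ => zero_mem _)
    (fun _ => map_zero _) (fun _ => rfl) (fun _ => map_zero _) (fun _ => rfl) (fun _ => map_zero _)
    (fun _ => rfl)
  exact ⟨N, hN, h₁, h₂, h₃, h₄, h₅, h₆⟩

variable {K}

namespace IsOnShellDifferential

variable {N : LocalForms U r →ₗ[ℝ] LocalForms U r} (hN : K.IsOnShellDifferential N)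

include hN

theorem pull (f : Target U r) : N (pull U r f) = TwistedCourant.pull U r (K.vf f) := by
  rw [chain_rule hN.toIsGDer hN.chain, pull_vf]
  simp only [hN.phi]

theorem onShell_extd (x : LocalForms U r) : K.onShell (extd U r x) = N (K.onShell x) :=
  K.onShell_intertwine isLocalDer_extd hN.toIsLocalDer
    (fun α => by rw [onShell_extd_phi, hN.phi])
    (fun α => by rw [TwistedCourant.extd_extd, map_zero, hN.pull, vf_Q, map_zero])
    (fun α => by rw [onShell_extd_ghost, hN.ghost])
    (fun α => by rw [TwistedCourant.extd_extd, map_zero, hN.extd_ghost])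
    (fun α => by rw [onShell_extd_ghost2, hN.ghost2])
    (fun α => by rw [TwistedCourant.extd_extd, map_zero, hN.extd_ghost2]) x

/-- As for d², it suffices to test [N, N] on fields, ghosts and differentials. The only non-trivial
case is that of the fields, where it is Q² = 0. -/
theorem square (x : LocalForms U r) : N (N x) = 0 := by
  have h := hN.toIsLocalDer.gcomm hN.toIsLocalDer
  have key : ∀ x, (N ∘ₗ N - (sgn (1, 0) (1, 0) : ℤ) • (N ∘ₗ N)) x = (2 : ℝ) • N (N x) := fun x => by
    have : sgn (1, 0) (1, 0) = -1 := by simp [sgn]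
    rw [this, two_smul]
    simp
  have h0 := h.eq_zero (fun α => ?_) (fun α => ?_) (fun α => ?_) (fun α => ?_) (fun α => ?_)
    (fun α => ?_)
  · have := DFunLike.congr_fun h0 x
    rw [key] at this
    exact (smul_eq_zero_iff_right two_ne_zero).mp this
  all_goals rw [key]
  · rw [hN.phi, hN.pull, vf_Q, map_zero, smul_zero]
  · rw [hN.extd_phi, map_zero, smul_zero]
  · rw [hN.ghost, hN.extd_ghost, smul_zero]
  · rw [hN.extd_ghost, map_zero, smul_zero]
  · rw [hN.ghost2, hN.extd_ghost2, smul_zero]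
  · rw [hN.extd_ghost2, map_zero, smul_zero]

end IsOnShellDifferential

end TwistedCourantAlgebroid

end

/-! ### The BRST operator on-shell as a commutator. -/

noncomputable section

variable {n r : ℕ} {U : TopologicalSpace.Opens (Fin n → ℝ)}

section Abstract

variable {E : Type*} [AddCommGroup E] [Module ℝ E] {Δ N : E →ₗ[ℝ] E}

/-- The effect of `[Δ, [Δ, N]] = 0` on a divided-power chain `q₀, …, q₃` of `Δ` with `N q₀ = 0`. -/
theorem divided_chain {q₀ q₁ q₂ q₃ : E} (h₀ : N q₀ = 0)
    (d₀ : Δ q₀ = q₁) (d₁ : Δ q₁ = (2 : ℝ) • q₂) (d₂ : Δ q₂ = (3 : ℝ) • q₃) (d₃ : Δ q₃ = 0)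
    (z₀ : Δ (Δ (N q₀) + N (Δ q₀)) + (Δ (N (Δ q₀)) + N (Δ (Δ q₀))) = 0)
    (z₁ : Δ (Δ (N q₁) + N (Δ q₁)) + (Δ (N (Δ q₁)) + N (Δ (Δ q₁))) = 0)
    (z₂ : Δ (Δ (N q₂) + N (Δ q₂)) + (Δ (N (Δ q₂)) + N (Δ (Δ q₂))) = 0) :
    Δ (N q₂) = (-2 : ℝ) • N q₃ ∧ Δ (N q₃) = 0 := by
  simp only [h₀, d₀, d₁, d₂, d₃, map_add, map_smul, map_zero] at z₀ z₁ z₂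
  -- With q₄ = 0 and the previous relation inserted, the k-th hypothesis reads (k+2)(ΔN q_{k+1} +
  -- (k+1) N q_{k+2}) = 0. This is the source of the factors 1/2, 1/3 and 1/4.
  have e₁ : Δ (N q₁) = -N q₂ := by linear_combination (norm := module) (1 / 2 : ℝ) • z₀
  rw [e₁, map_neg] at z₁
  have e₂ : Δ (N q₂) = (-2 : ℝ) • N q₃ := by linear_combination (norm := module) (1 / 3 : ℝ) • z₁
  refine ⟨e₂, ?_⟩
  rw [e₂, map_smul] at z₂
  linear_combination (norm := module) (1 / 4 : ℝ) • z₂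

/-- If `N² = 0` and `[Δ, [Δ, N]] = 0`, then `[Δ, N]² = 0`. -/
theorem bracket_square_eq_zero (hN : ∀ x, N (N x) = 0)
    (hZ : ∀ x, Δ (Δ (N x) + N (Δ x)) + (Δ (N (Δ x)) + N (Δ (Δ x))) = 0) (x : E) :
    Δ (N (Δ (N x) + N (Δ x))) + N (Δ (Δ (N x) + N (Δ x))) = 0 := by
  have h₁ := hZ (N x)
  have h₂ := congrArg N (hZ x)
  simp only [map_add, hN, map_zero, add_zero, zero_add] at h₁ h₂ ⊢
  -- With N² = 0 the square of the bracket is ΔNΔN + NΔΔN + NΔNΔ. The hypotheses give 2ΔNΔN + NΔΔN =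
  -- 0 and NΔΔN + 2NΔNΔ = 0.
  linear_combination (norm := module) (1 / 2 : ℝ) • h₁ + (1 / 2 : ℝ) • h₂

end Abstract

namespace TwistedCourantAlgebroid

variable (K : TwistedCourantAlgebroid U r)

/-- The derivation that generates the on-shell BRST operator as its commutator with the on-shell
differential. -/
structure IsGhostShift (Δ : LocalForms U r →ₗ[ℝ] LocalForms U r) : Prop
    extends IsLocalDer (-1, 1) Δ where
  phi : ∀ α, Δ (phi U α) = ghost U α
  extd_phi : ∀ α, Δ (extd U r (TwistedCourant.phi U α)) = 0
  ghost : ∀ α, Δ (ghost U α) = (2 : ℝ) • ghost2 U α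
  -- The values on dε and dε̃ are the solutions of [Δ, [Δ, N]]φ = 0 and [Δ, [Δ, N]]ε = 0.
  extd_ghost : ∀ α, Δ (extd U r (TwistedCourant.ghost U α)) =
    -extd U r (ghost2 U α) - del₂ (K.Q α)
  ghost2 : ∀ α, Δ (ghost2 U α) = 0
  extd_ghost2 : ∀ α, Δ (extd U r (TwistedCourant.ghost2 U α)) = del₃ (K.Q α)

theorem bideg_del₂_Q (α : Idx n r) : del₂ (K.Q α) ∈ bideg fieldDeg (tdeg α - 1, 2) := by
  have := bideg_del₂ (K.bideg_Q α)
  rwa [show tdeg α + 1 - 2 = tdeg α - 1 by ring] at this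

theorem bideg_del₃_Q (α : Idx n r) : del₃ (K.Q α) ∈ bideg fieldDeg (tdeg α - 2, 3) := by
  have := bideg_del₃ (K.bideg_Q α)
  rwa [show tdeg α + 1 - 3 = tdeg α - 2 by ring] at this

/-- The form degree would be -1. The components ε^μ, ε̃^μ and ε̃^a are zero, so Δ can have the
prescribed values on their differentials only because these vanish as well. -/
theorem del₂_Q_ix (μ : Fin n) : del₂ (K.Q (ix μ)) = 0 :=
  local_eq_zero (by simp [tdeg]) (K.bideg_del₂_Q (ix μ))

theorem del₃_Q_ix (μ : Fin n) : del₃ (K.Q (ix μ)) = 0 :=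
  local_eq_zero (by simp [tdeg]) (K.bideg_del₃_Q (ix μ))

theorem del₃_Q_ia (a : Fin r) : del₃ (K.Q (ia a)) = 0 :=
  local_eq_zero (by simp [tdeg]) (K.bideg_del₃_Q (ia a))

theorem bideg_extd_ghost2 (α : Idx n r) :
    extd U r (ghost2 U α) ∈ bideg fieldDeg (tdeg α - 1, 2) := by
  have := isGDer_extd.degree (bideg_ghost2 (U := U) α)
  rwa [show ((tdeg α - 2, 2) + (1, 0) : ℤ × ℤ) = (tdeg α - 1, 2) by ext <;> simp; ring] at this

theorem exists_ghostShift : ∃ Δ, K.IsGhostShift Δ := by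
  obtain ⟨Δ, hΔ, h₁, h₂, h₃, h₄, h₅, h₆⟩ := exists_localDer (-1, 1) (ghost U) 0
    (fun α => (2 : ℝ) • ghost2 U α) (fun α => -extd U r (ghost2 U α) - del₂ (K.Q α)) 0
    (fun α => del₃ (K.Q α))
    (fun α => by
      rw [show ((tdeg α, 0) + (-1, 1) : ℤ × ℤ) = (tdeg α - 1, 1) by ext <;> simp; ring]
      exact bideg_ghost α)
    (fun _ => zero_mem _)
    (fun α => by
      rw [show ((tdeg α - 1, 1) + (-1, 1) : ℤ × ℤ) = (tdeg α - 2, 2) by ext <;> simp; ring]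
      exact bideg_real_smul _ (bideg_ghost2 α))
    (fun α => by
      rw [show ((tdeg α, 1) + (-1, 1) : ℤ × ℤ) = (tdeg α - 1, 2) by ext <;> simp; ring]
      exact sub_mem (neg_mem (bideg_extd_ghost2 α)) (K.bideg_del₂_Q α))
    (fun _ => zero_mem _)
    (fun α => by
      rw [show ((tdeg α - 1, 2) + (-1, 1) : ℤ × ℤ) = (tdeg α - 2, 3) by ext <;> simp; ring]
      exact K.bideg_del₃_Q α)
    (fun _ => smul_zero _)
    (fun μ => by rw [del₂_Q_ix, ghost2, map_zero, neg_zero, sub_zero])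
    (fun _ => rfl) K.del₃_Q_ix (fun _ => rfl) K.del₃_Q_ia
  exact ⟨Δ, hΔ, h₁, h₂, h₃, h₄, h₅, h₆⟩

variable {K}

namespace IsGhostShift

variable {Δ N : LocalForms U r →ₗ[ℝ] LocalForms U r} (hΔ : K.IsGhostShift Δ)
  (hN : K.IsOnShellDifferential N)

include hΔ

theorem del₁ (f : Target U r) : Δ (pull U r f) = del₁ f := shift_pull hΔ.toIsLocalDer hΔ.phi f

theorem del₂ (f : Target U r) : Δ (TwistedCourant.del₁ f) = (2 : ℝ) • del₂ f :=
  shift_del₁ hΔ.toIsLocalDer hΔ.phi hΔ.ghost f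

theorem del₃ (f : Target U r) : Δ (TwistedCourant.del₂ f) = (3 : ℝ) • del₃ f :=
  shift_del₂ hΔ.toIsLocalDer hΔ.phi hΔ.ghost hΔ.ghost2 f

/-- The result would have form degree |α| - 3 < 0, so the chain of divided powers of Q^α ends with
the third. -/
theorem del₃_Q (α : Idx n r) : Δ (TwistedCourant.del₃ (K.Q α)) = 0 := by
  refine local_eq_zero ?_ (hΔ.degree (K.bideg_del₃_Q α))
  rcases α with μ | a | μ <;> simp [tdeg]

include hN

theorem isLocalDer_bracket : ∃ T, IsLocalDer (0, 1) T ∧ ∀ x, T x = Δ (N x) + N (Δ x) := by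
  refine ⟨_, hΔ.toIsLocalDer.gcomm hN.toIsLocalDer, fun x => ?_⟩
  have : sgn (-1, 1) (1, 0) = -1 := by simp [sgn]
  rw [this]
  simp

theorem isLocalDer_bracket₂ : ∃ Z, IsLocalDer (-1, 2) Z ∧
    ∀ x, Z x = Δ (Δ (N x) + N (Δ x)) + (Δ (N (Δ x)) + N (Δ (Δ x))) := by
  obtain ⟨T, hT, hT'⟩ := hΔ.isLocalDer_bracket hN
  refine ⟨_, hΔ.toIsLocalDer.gcomm hT, fun x => ?_⟩
  have : sgn (-1, 1) (0, 1) = -1 := by simp [sgn]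
  rw [this]
  simp [hT']

/-- The double bracket is a derivation Z. It vanishes on fields and ghosts by the choice of Δ on
differentials, hence on every `del₁`, `del₂` and on pull-backs. Applied to Q^α these three facts
feed `divided_chain`, which gives what is needed for Z to vanish on dε and dε̃. -/
theorem bracket₂_eq_zero (x : LocalForms U r) :
    Δ (Δ (N x) + N (Δ x)) + (Δ (N (Δ x)) + N (Δ (Δ x))) = 0 := by
  obtain ⟨Z, hZ, hZ'⟩ := hΔ.isLocalDer_bracket₂ hN
  have hφ : ∀ α, Z (TwistedCourant.phi U α) = 0 := fun α => by
    rw [hZ', hΔ.phi, hN.phi, hN.ghost, hΔ.del₁, map_add, hΔ.del₂, hΔ.extd_ghost, hΔ.ghost,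
      map_smul, hN.ghost2]
    module
  have hε : ∀ α, Z (TwistedCourant.ghost U α) = 0 := fun α => by
    rw [hZ', hN.ghost, hΔ.ghost, hΔ.extd_ghost, map_smul, hN.ghost2, map_smul, map_smul,
      hΔ.ghost2, map_add, map_sub, map_neg, map_smul, hΔ.extd_ghost2, hΔ.del₃, smul_zero, map_zero]
    module
  have hg : ∀ α, Z (TwistedCourant.ghost2 U α) = 0 := fun α => by
    rw [hZ', hN.ghost2, hΔ.ghost2, map_zero, map_zero, map_zero, hΔ.extd_ghost2, add_zero,
      hΔ.del₃_Q,
      zero_add, zero_add]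
  have hdel := fun f => hZ.del_eq_zero hφ hε hg f
  have hc : ∀ α, Δ (N (TwistedCourant.del₂ (K.Q α))) = (-2 : ℝ) • N (TwistedCourant.del₃ (K.Q α)) ∧
      Δ (N (TwistedCourant.del₃ (K.Q α))) = 0 := fun α =>
    divided_chain (by rw [hN.pull, vf_Q, map_zero]) (hΔ.del₁ _) (hΔ.del₂ _) (hΔ.del₃ _)
      (hΔ.del₃_Q α) ((hZ' _).symm.trans (hdel _).1) ((hZ' _).symm.trans (hdel _).2.1)
      ((hZ' _).symm.trans (hdel _).2.2)
  have h0 : Z = 0 := hZ.eq_zero hφ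
    (fun α => by
      rw [hZ', hN.extd_phi, hΔ.extd_phi]
      simp only [map_zero, add_zero])
    hε
    (fun α => by
      rw [hZ', hN.extd_ghost, hΔ.extd_ghost, map_zero, zero_add, map_sub, map_neg, hN.extd_ghost2,
        map_sub, map_neg, map_sub, map_neg, hΔ.extd_ghost2, hΔ.del₃, map_zero, (hc α).1, map_sub,
        map_neg, map_smul]
      module)
    hg
    (fun α => by
      rw [hZ', hN.extd_ghost2, hΔ.extd_ghost2, map_zero, zero_add, (hc α).2, hΔ.del₃_Q, map_zero,
        add_zero, add_zero])
  rw [← hZ', h0]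
  rfl

end IsGhostShift

variable (K)

/-- The BRST operator induced on the on-shell forms. -/
structure IsOnShellBRST (N T : LocalForms U r →ₗ[ℝ] LocalForms U r) : Prop
    extends IsLocalDer (0, 1) T where
  phi : ∀ α, T (phi U α) = extd U r (ghost U α) + del₁ (K.Q α)
  ghost : ∀ α, T (ghost U α) = extd U r (ghost2 U α) - del₂ (K.Q α)
  ghost2 : ∀ α, T (ghost2 U α) = del₃ (K.Q α)
  comm : ∀ x, T (N x) = N (T x)
  square : ∀ x, T (T x) = 0

variable {K}

/-- The operator is T = [Δ, N]. It commutes with N because N² = 0, and it squares to zero because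
[Δ, T] = 0. -/
theorem IsOnShellDifferential.exists_onShellBRST {N : LocalForms U r →ₗ[ℝ] LocalForms U r}
    (hN : K.IsOnShellDifferential N) : ∃ T, K.IsOnShellBRST N T := by
  obtain ⟨Δ, hΔ⟩ := K.exists_ghostShift
  obtain ⟨T, hT, hT'⟩ := hΔ.isLocalDer_bracket hN
  refine ⟨T, hT, fun α => ?_, fun α => ?_, fun α => ?_, fun x => ?_, fun x => ?_⟩
  · rw [hT', hN.phi, hΔ.phi, hN.ghost, hΔ.del₁, add_comm]
  · rw [hT', hN.ghost, hΔ.ghost, map_smul, hN.ghost2, hΔ.extd_ghost]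
    module
  · rw [hT', hN.ghost2, hΔ.ghost2, map_zero, add_zero, hΔ.extd_ghost2]
  · rw [hT', hT', map_add, hN.square, hN.square, map_zero, zero_add, add_zero]
  · rw [hT', hT']
    exact bracket_square_eq_zero hN.square (hΔ.bracket₂_eq_zero hN) x

end TwistedCourantAlgebroid

end

/-! ### Existence, uniqueness and weak nilpotency of the BRST operator. -/

noncomputable section

variable {n r : ℕ} {U : TopologicalSpace.Opens (Fin n → ℝ)}

/-- BRST operators are determined by their values on fields and ghosts. -/
theorem IsBRSTOperator.ext {s s' : LocalForms U r →ₗ[ℝ] LocalForms U r} (hs : IsBRSTOperator s)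
    (hs' : IsBRSTOperator s') (hφ : ∀ α, s (phi U α) = s' (phi U α))
    (hε : ∀ α, s (ghost U α) = s' (ghost U α)) (hg : ∀ α, s (ghost2 U α) = s' (ghost2 U α)) :
    s = s' :=
  local_ext id (twist (0, 1)) hs.leibniz hs'.leibniz
    (fun f => by simp only [hs.chain, hs'.chain, hφ])
    hφ (fun α => by rw [hs.comm_d, hs'.comm_d, hφ]) hε (fun α => by rw [hs.comm_d, hs'.comm_d, hε])
    hg (fun α => by rw [hs.comm_d, hs'.comm_d, hg])

/-- BRST operators have arbitrary values of the right bidegrees on fields and ghosts. -/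
theorem exists_brst (w e g : Idx n r → LocalForms U r)
    (hw : ∀ α, w α ∈ bideg fieldDeg (tdeg α, 1)) (he : ∀ α, e α ∈ bideg fieldDeg (tdeg α - 1, 2))
    (hg : ∀ α, g α ∈ bideg fieldDeg (tdeg α - 2, 3)) :
    ∃ s : LocalForms U r →ₗ[ℝ] LocalForms U r, IsBRSTOperator s ∧ (∀ α, s (phi U α) = w α) ∧
      (∀ α, s (ghost U α) = e α) ∧ ∀ α, s (ghost2 U α) = g α := by
  -- Negative form degree forces the prescribed values to vanish on the components of the ghosts
  -- that are identically zero. Otherwise no operator could attain them.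
  have he0 : ∀ μ, e (ix μ) = 0 := fun μ => local_eq_zero (by simp [tdeg]) (he (ix μ))
  have hg0 : ∀ μ, g (ix μ) = 0 := fun μ => local_eq_zero (by simp [tdeg]) (hg (ix μ))
  have hg1 : ∀ a, g (ia a) = 0 := fun a => local_eq_zero (by simp [tdeg]) (hg (ia a))
  have hd : ∀ {p q : ℤ × ℤ} {x : LocalForms U r}, x ∈ bideg fieldDeg p → p + (1, 0) = q →
      extd U r x ∈ bideg fieldDeg q := fun hx h => h ▸ isGDer_extd.degree hx
  obtain ⟨s, hs, h₁, h₂, h₃, h₄, h₅, h₆⟩ := exists_localDer (0, 1) w (fun α => extd U r (w α)) e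
    (fun α => extd U r (e α)) g (fun α => extd U r (g α))
    (fun α => by
      rw [show ((tdeg α, 0) + (0, 1) : ℤ × ℤ) = (tdeg α, 1) by ext <;> simp]
      exact hw α)
    (fun α => hd (hw α) (by ext <;> simp))
    (fun α => by
      rw [show ((tdeg α - 1, 1) + (0, 1) : ℤ × ℤ) = (tdeg α - 1, 2) by ext <;> simp]
      exact he α)
    (fun α => hd (he α) (by ext <;> simp))
    (fun α => by
      rw [show ((tdeg α - 2, 2) + (0, 1) : ℤ × ℤ) = (tdeg α - 2, 3) by ext <;> simp]
      exact hg α)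
    (fun α => hd (hg α) (by ext <;> simp; ring))
    he0 (fun μ => by rw [he0, map_zero]) hg0 (fun μ => by rw [hg0, map_zero])
    hg1 (fun a => by rw [hg1, map_zero])
  refine ⟨s, ⟨hs.leibniz, hs.chain, fun x => ?_, fun p x hx => hs.degree hx⟩, h₁, h₃, h₅⟩
  have key : ∀ x, (s ∘ₗ extd U r - (sgn (0, 1) (1, 0) : ℤ) • (extd U r ∘ₗ s)) x =
      s (extd U r x) - extd U r (s x) := fun x => by
    have : sgn (0, 1) (1, 0) = 1 := by simp [sgn]
    rw [this]
    simp
  have h0 := (hs.gcomm isLocalDer_extd).eq_zero (fun α => ?_) (fun α => ?_) (fun α => ?_)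
    (fun α => ?_) (fun α => ?_) (fun α => ?_)
  · have := DFunLike.congr_fun h0 x
    rw [key] at this
    exact sub_eq_zero.mp this
  all_goals rw [key]
  · rw [h₁, h₂, sub_self]
  · rw [h₂, extd_extd, extd_extd, map_zero, sub_zero]
  · rw [h₃, h₄, sub_self]
  · rw [h₄, extd_extd, extd_extd, map_zero, sub_zero]
  · rw [h₅, h₆, sub_self]
  · rw [h₆, extd_extd, extd_extd, map_zero, sub_zero]

namespace TwistedCourantAlgebroid

variable {K : TwistedCourantAlgebroid U r}

theorem FieldLaw.apply {s : LocalForms U r →ₗ[ℝ] LocalForms U r} {τ : Idx n r → LocalForms U r}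
    (h : K.FieldLaw s τ) (α : Idx n r) :
    s (phi U α) = extd U r (ghost U α) + del₁ (K.Q α) + τ α := h α

theorem ghostLaw_iff {s : LocalForms U r →ₗ[ℝ] LocalForms U r} {τ : Idx n r → LocalForms U r} :
    K.GhostLaw s τ ↔ ∀ α, s (ghost U α) = extd U r (ghost2 U α) - del₂ (K.Q α) + τ α :=
  forall_congr' fun α => by rw [sub_sub]; rfl

theorem ghost2Law_iff {s : LocalForms U r →ₗ[ℝ] LocalForms U r} :
    K.Ghost2Law s ↔ ∀ α, s (ghost2 U α) = del₃ (K.Q α) := Iff.rfl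

variable {N T : LocalForms U r →ₗ[ℝ] LocalForms U r}

/-- On-shell, a BRST operator with the right values on fields and ghosts is the on-shell one. -/
theorem IsOnShellBRST.onShell_brst (hT : K.IsOnShellBRST N T) (hN : K.IsOnShellDifferential N)
    {s : LocalForms U r →ₗ[ℝ] LocalForms U r} (hs : IsBRSTOperator s)
    (hφ : ∀ α, K.onShell (s (TwistedCourant.phi U α)) = T (TwistedCourant.phi U α))
    (hε : ∀ α, K.onShell (s (TwistedCourant.ghost U α)) = T (TwistedCourant.ghost U α))
    (hg : ∀ α, K.onShell (s (TwistedCourant.ghost2 U α)) = T (TwistedCourant.ghost2 U α))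
    (x : LocalForms U r) : K.onShell (s x) = T (K.onShell x) :=
  K.onShell_intertwine hs.isLocalDer hT.toIsLocalDer hφ
    (fun α => by rw [hs.comm_d, hN.onShell_extd, hφ, ← hT.comm, hN.phi]) hε
    (fun α => by rw [hs.comm_d, hN.onShell_extd, hε, ← hT.comm, hN.ghost]) hg
    (fun α => by rw [hs.comm_d, hN.onShell_extd, hg, ← hT.comm, hN.ghost2]) x

theorem onShell_fieldLaw (hT : K.IsOnShellBRST N T) {s : LocalForms U r →ₗ[ℝ] LocalForms U r}
    {τ : Idx n r → LocalForms U r} (hτ : K.IsFieldTriv τ) (h : K.FieldLaw s τ) (α : Idx n r) :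
    K.onShell (s (phi U α)) = T (phi U α) := by
  rw [h.apply, map_add, map_add, onShell_extd_ghost, onShell_del₁, (K.weaklyZero_iff _).mp (hτ α).1,
    add_zero, hT.phi]

theorem onShell_ghostLaw (hT : K.IsOnShellBRST N T) {s : LocalForms U r →ₗ[ℝ] LocalForms U r}
    {τ : Idx n r → LocalForms U r} (hτ : K.IsGhostTriv τ) (h : K.GhostLaw s τ) (α : Idx n r) :
    K.onShell (s (ghost U α)) = T (ghost U α) := by
  rw [ghostLaw_iff.mp h, map_add, map_sub, onShell_extd_ghost2, onShell_del₂,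
    (K.weaklyZero_iff _).mp (hτ α).1, add_zero, hT.ghost]

theorem onShell_ghost2Law (hT : K.IsOnShellBRST N T) {s : LocalForms U r →ₗ[ℝ] LocalForms U r}
    (h : K.Ghost2Law s) (α : Idx n r) : K.onShell (s (ghost2 U α)) = T (ghost2 U α) := by
  rw [ghost2Law_iff.mp h, onShell_del₃, hT.ghost2]

theorem bideg_extd_ghost (α : Idx n r) : extd U r (ghost U α) ∈ bideg fieldDeg (tdeg α, 1) := by
  have := isGDer_extd.degree (bideg_ghost (U := U) α)
  rwa [show ((tdeg α - 1, 1) + (1, 0) : ℤ × ℤ) = (tdeg α, 1) by ext <;> simp] at this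

theorem bideg_del₁_Q (α : Idx n r) : del₁ (K.Q α) ∈ bideg fieldDeg (tdeg α, 1) := by
  have := bideg_del₁ (K.bideg_Q α)
  rwa [add_sub_cancel_right] at this

/-- Existence, uniqueness and on-shell nilpotency of the BRST operator. -/
theorem exists_unique_brst {τφ τε : Idx n r → LocalForms U r} (hφ : K.IsFieldTriv τφ)
    (hε : K.IsGhostTriv τε) : ∃ s : LocalForms U r →ₗ[ℝ] LocalForms U r,
      IsBRSTOperator s ∧ K.FieldLaw s τφ ∧ K.GhostLaw s τε ∧ K.Ghost2Law s ∧
      (∀ x, K.WeaklyZero (s (s x))) ∧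
      ∀ s' : LocalForms U r →ₗ[ℝ] LocalForms U r, IsBRSTOperator s' → K.FieldLaw s' τφ →
        K.GhostLaw s' τε → K.Ghost2Law s' → s' = s := by
  obtain ⟨s, hs, h₁, h₂, h₃⟩ := exists_brst
    (fun α => extd U r (ghost U α) + del₁ (K.Q α) + τφ α)
    (fun α => extd U r (ghost2 U α) - del₂ (K.Q α) + τε α) (fun α => del₃ (K.Q α))
    (fun α => add_mem (add_mem (bideg_extd_ghost α) (bideg_del₁_Q α)) (hφ α).2)
    (fun α => add_mem (sub_mem (bideg_extd_ghost2 α) (K.bideg_del₂_Q α)) (hε α).2)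
    K.bideg_del₃_Q
  have l₁ : K.FieldLaw s τφ := h₁
  have l₂ : K.GhostLaw s τε := ghostLaw_iff.mpr h₂
  have l₃ : K.Ghost2Law s := h₃
  refine ⟨s, hs, l₁, l₂, l₃, fun x => ?_, fun s' hs' m₁ m₂ m₃ =>
    hs'.ext hs (fun α => (m₁ α).trans (l₁ α).symm) (fun α => (m₂ α).trans (l₂ α).symm)
      fun α => (m₃ α).trans (l₃ α).symm⟩
  obtain ⟨N, hN⟩ := K.exists_onShellDifferential
  obtain ⟨T, hT⟩ := hN.exists_onShellBRST
  -- Trivial terms project to zero, so s is intertwined with T and s² with T² = 0.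
  have h := hT.onShell_brst hN hs (onShell_fieldLaw hT hφ l₁) (onShell_ghostLaw hT hε l₂)
    (onShell_ghost2Law hT l₃)
  rw [weaklyZero_iff, h, h, hT.square]

end TwistedCourantAlgebroid

end

/-! ### Derivatives with respect to the ghosts. -/

noncomputable section

variable {n r : ℕ} {U : TopologicalSpace.Opens (Fin n → ℝ)}

/-- The left inverse of the pull-back. -/
theorem pull_injective : Function.Injective (pull U r) := by
  let v : FieldGen n r → Target U r := fun i => match i with
    | .A a => ta U a
    | .B μ => tb U r μ
    | _ => 0
  have hv : ∀ i, v i ∈ bideg targetDeg (fieldDeg i) := fun i => by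
    cases i with
    | A a => exact bideg_ta a
    | B μ => exact bideg_tb μ
    | _ => exact zero_mem _
  let G : LocalForms U r →ₐ[Smooth U] Target U r :=
    lift v fun i j => mul_comm_of_mem (hv i) (hv j)
  have h : G.comp (pull U r) = AlgHom.id (Smooth U) (Target U r) := algHom_ext_gen fun i => by
    rw [AlgHom.comp_apply, pull_gen]
    rcases i with a | μ
    · exact lift_gen _ _ (FieldGen.A a)
    · exact lift_gen _ _ (FieldGen.B μ)
  exact Function.LeftInverse.injective (g := G) fun f => DFunLike.congr_fun h f

theorem contr₁_add (e : Idx n r → LocalForms U r) (M M' : Idx n r → Target U r) :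
    contr₁ e (fun β => M β + M' β) = contr₁ e M + contr₁ e M' := by
  simp only [contr₁, map_add, mul_add, Finset.sum_add_distrib]

theorem contr₂_add (M M' : Idx n r → Idx n r → Target U r) :
    contr₂ (fun β γ => M β γ + M' β γ) = contr₂ M + contr₂ M' := by
  simp only [contr₂, map_add, mul_add, smul_add, Finset.sum_add_distrib]

theorem contr₃_sub (M M' : Idx n r → Idx n r → Idx n r → Target U r) :
    contr₃ (fun β γ δ => M β γ δ - M' β γ δ) = contr₃ M - contr₃ M' := by
  simp only [contr₃, map_sub, mul_sub, smul_sub, Finset.sum_sub_distrib]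

theorem contrMixed_sub (M M' : Idx n r → Idx n r → Target U r) :
    contrMixed (fun β γ => M β γ - M' β γ) = contrMixed M - contrMixed M' := by
  simp only [contrMixed, map_sub, mul_sub, Finset.sum_sub_distrib]

theorem contr₁_ghost2_eq_zero {M : Idx n r → Target U r} (h : ∀ μ, M (ib μ) = 0) :
    contr₁ (ghost2 U) M = 0 :=
  Finset.sum_eq_zero fun β _ => by
    rcases β with μ | a | μ
    · exact zero_mul _
    · exact zero_mul _
    · rw [h, map_zero, mul_zero]

theorem contrMixed_eq_zero {M : Idx n r → Idx n r → Target U r}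
    (h : ∀ μ γ, M (ib μ) (Sum.inr γ) = 0) : contrMixed M = 0 :=
  Finset.sum_eq_zero fun β _ => Finset.sum_eq_zero fun γ _ => by
    rcases β with μ | a | μ
    · simp only [ghost2, zero_mul]
    · simp only [ghost2, zero_mul]
    · rcases γ with ν | γ
      · simp only [ghost, mul_zero, zero_mul]
      · rw [h, map_zero, mul_zero]

theorem contr₂_eq_zero {M : Idx n r → Idx n r → Target U r}
    (h : ∀ β γ, M (Sum.inr β) (Sum.inr γ) = 0) : contr₂ M = 0 :=
  Finset.sum_eq_zero fun β _ => Finset.sum_eq_zero fun γ _ => by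
    rcases β with μ | β
    · simp only [ghost, zero_mul, smul_zero]
    · rcases γ with ν | γ
      · simp only [ghost, mul_zero, zero_mul, smul_zero]
      · rw [h, map_zero, mul_zero, smul_zero]

theorem contr₃_eq_zero {M : Idx n r → Idx n r → Idx n r → Target U r}
    (h : ∀ β γ δ, M (Sum.inr β) (Sum.inr γ) (Sum.inr δ) = 0) : contr₃ M = 0 :=
  Finset.sum_eq_zero fun β _ => Finset.sum_eq_zero fun γ _ => Finset.sum_eq_zero fun δ _ => by
    rcases β with μ | β
    · simp only [ghost, zero_mul, smul_zero]
    · rcases γ with ν | γ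
      · simp only [ghost, mul_zero, zero_mul, smul_zero]
      · rcases δ with κ | δ
        · simp only [ghost, mul_zero, zero_mul, smul_zero]
        · rw [h, map_zero, mul_zero, smul_zero]

namespace IsLocalDer

variable {χ : ℤ × ℤ} {E : LocalForms U r →ₗ[ℝ] LocalForms U r} (hE : IsLocalDer χ E)
  (hφ : ∀ α, E (phi U α) = 0) (hε : ∀ α, E (ghost U α) = 0) (hg : ∀ α, E (ghost2 U α) = 0)

include hE hφ

theorem pull_eq_zero (f : Target U r) : E (pull U r f) = 0 := by
  rw [chain_rule hE.toIsGDer hE.chain]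
  simp only [hφ, zero_mul, Finset.sum_const_zero]

theorem mul_pull (x : LocalForms U r) (f : Target U r) :
    E (x * pull U r f) = E x * pull U r f := by
  rw [hE.leibniz, hE.pull_eq_zero hφ, mul_zero, add_zero]

theorem contr₁ (e : Idx n r → LocalForms U r) (M : Idx n r → Target U r) :
    E (contr₁ e M) = TwistedCourant.contr₁ (fun β => E (e β)) M := by
  simp only [TwistedCourant.contr₁, map_sum, hE.mul_pull hφ]

include hε

theorem contr₂_eq_zero (M : Idx n r → Idx n r → Target U r) : E (contr₂ M) = 0 := by
  simp only [contr₂, map_sum, map_units_smul', hE.leibniz, hε, hE.pull_eq_zero hφ, zero_mul,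
    mul_zero, add_zero, smul_zero, Finset.sum_const_zero]

theorem contr₃_eq_zero (M : Idx n r → Idx n r → Idx n r → Target U r) : E (contr₃ M) = 0 := by
  simp only [contr₃, map_sum, map_units_smul', hE.leibniz, hε, hE.pull_eq_zero hφ, zero_mul,
    mul_zero, add_zero, smul_zero, Finset.sum_const_zero]

theorem contrMixed (M : Idx n r → Idx n r → Target U r) :
    E (contrMixed M) = ∑ β, E (ghost2 U β) * TwistedCourant.contr₁ (ghost U) (M β) := by
  simp only [TwistedCourant.contrMixed, TwistedCourant.contr₁, map_sum, hE.leibniz, hε,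
    hE.pull_eq_zero hφ, zero_mul, mul_zero, add_zero, Finset.mul_sum, mul_assoc]

end IsLocalDer

/-- A derivation that acts on fields and ghosts as `∂/∂ε^ε`. -/
structure IsGhostDerivative (ε : Fin r ⊕ Fin n) (E : LocalForms U r →ₗ[ℝ] LocalForms U r) : Prop
    extends IsLocalDer (1 - tdeg (Sum.inr ε : Idx n r), -1) E where
  phi : ∀ α, E (phi U α) = 0
  ghost : ∀ β, E (ghost U β) = if β = Sum.inr ε then 1 else 0
  ghost2 : ∀ α, E (ghost2 U α) = 0

/-- The sign of moving `∂/∂ε^ε` past `ε^β`. -/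
theorem sgn_ghostDerivative (ε : Fin r ⊕ Fin n) (β : Idx n r) :
    sgn (1 - tdeg (Sum.inr ε : Idx n r), -1) (tdeg β - 1, 1) * passSign β (Sum.inr ε) *
      sgn (cdeg β) (cdeg (Sum.inr ε)) = passSign (Sum.inr ε) β := by
  simp only [sgn, passSign, cdeg]
  rw [← Int.negOnePow_add, ← Int.negOnePow_add, Int.negOnePow_eq_iff]
  exact ⟨tdeg β - 1, by ring⟩

namespace IsGhostDerivative

variable {ε : Fin r ⊕ Fin n} {E : LocalForms U r →ₗ[ℝ] LocalForms U r}
  (hE : IsGhostDerivative ε E)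

include hE

theorem ghost_mul (β : Idx n r) (x : LocalForms U r) :
    E (TwistedCourant.ghost U β * x) = (if β = Sum.inr ε then x else 0) +
      sgn (1 - tdeg (Sum.inr ε : Idx n r), -1) (tdeg β - 1, 1) •
        (TwistedCourant.ghost U β * E x) := by
  rw [hE.mul_of_mem' (bideg_ghost β), hE.ghost, ite_mul, one_mul, zero_mul]

theorem contr₁ (M : Idx n r → Target U r) :
    E (contr₁ (TwistedCourant.ghost U) M) = pull U r (M (Sum.inr ε)) := by
  rw [hE.toIsLocalDer.contr₁ hE.phi]
  simp only [TwistedCourant.contr₁, hE.ghost, ite_mul, one_mul, zero_mul, Finset.sum_ite_eq',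
    Finset.mem_univ, if_true]

/-- The derivative of either ghost gives the same result: graded symmetry of L together with the
sign in `contr₂` undoes the sign of passing the first ghost. Hence the factor 2. -/
theorem contr₂ {L : Idx n r → Idx n r → Target U r}
    (hL : ∀ β γ, L β γ = sgn (cdeg β) (cdeg γ) • L γ β) :
    E (contr₂ L) = (2 : ℝ) • TwistedCourant.contr₁ (TwistedCourant.ghost U)
      fun γ => passSign (Sum.inr ε) γ • L (Sum.inr ε) γ := by
  have t : ∀ β γ, E (passSign β γ • (TwistedCourant.ghost U β * TwistedCourant.ghost U γ *
      pull U r (L β γ))) =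
      (if β = Sum.inr ε then TwistedCourant.ghost U γ *
        pull U r (passSign (Sum.inr ε) γ • L (Sum.inr ε) γ) else 0) +
      (if γ = Sum.inr ε then TwistedCourant.ghost U β *
        pull U r (passSign (Sum.inr ε) β • L (Sum.inr ε) β) else 0) := by
    intro β γ
    rw [map_units_smul', mul_assoc, hE.ghost_mul, hE.ghost_mul, hE.pull_eq_zero hE.phi, mul_zero,
      smul_zero, add_zero, smul_add]
    have e₁ : (passSign β γ • if β = Sum.inr ε then TwistedCourant.ghost U γ * pull U r (L β γ)
        else 0) = if β = Sum.inr ε then TwistedCourant.ghost U γ *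
        pull U r (passSign (Sum.inr ε) γ • L (Sum.inr ε) γ) else 0 := by
      split_ifs with h
      · rw [h, map_units_smul', mul_smul_comm]
      · exact smul_zero _
    have e₂ : passSign β γ • sgn (1 - tdeg (Sum.inr ε : Idx n r), -1) (tdeg β - 1, 1) •
        (TwistedCourant.ghost U β * if γ = Sum.inr ε then pull U r (L β γ) else 0) =
        if γ = Sum.inr ε then TwistedCourant.ghost U β *
        pull U r (passSign (Sum.inr ε) β • L (Sum.inr ε) β) else 0 := by
      split_ifs with h
      · rw [h, hL β, map_units_smul', map_units_smul', mul_smul_comm, mul_smul_comm, smul_smul,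
          smul_smul, ← sgn_ghostDerivative ε β, mul_comm (passSign β _)]
      · rw [mul_zero, smul_zero, smul_zero]
    rw [e₁, e₂]
  simp only [TwistedCourant.contr₂, map_sum, t, Finset.sum_add_distrib, Finset.sum_ite_eq',
    Finset.mem_univ, if_true]
  rw [Finset.sum_comm]
  simp only [Finset.sum_ite_eq', Finset.mem_univ, if_true]
  exact (two_smul ℝ _).symm

/-- Each of the three ghosts contributes the double sum of W, the differentiated index being brought
to the front by graded symmetry. The signs left in W are absorbed into the coefficients, so that the
result is again of the form `contr₂`. -/
theorem contr₃ {L : Idx n r → Idx n r → Idx n r → Target U r}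
    (hL : ∀ β γ δ, L β γ δ = sgn (cdeg β) (cdeg γ) • L γ β δ)
    (hL' : ∀ β γ δ, L β γ δ = sgn (cdeg γ) (cdeg δ) • L β δ γ) :
    E (contr₃ L) = (3 : ℝ) • TwistedCourant.contr₂
      fun γ δ => (passSign (Sum.inr ε) γ * passSign (Sum.inr ε) δ) • L (Sum.inr ε) γ δ := by
  let W : Idx n r → Idx n r → LocalForms U r := fun γ δ =>
    passSign γ δ • (TwistedCourant.ghost U γ * TwistedCourant.ghost U δ *
      pull U r ((passSign (Sum.inr ε) γ * passSign (Sum.inr ε) δ) • L (Sum.inr ε) γ δ))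
  have hW : ∀ γ δ, (passSign γ δ * (passSign (Sum.inr ε) γ * passSign (Sum.inr ε) δ)) •
      (TwistedCourant.ghost U γ * (TwistedCourant.ghost U δ * pull U r (L (Sum.inr ε) γ δ))) =
      W γ δ := fun γ δ => by
    simp only [W]
    rw [map_units_smul', mul_smul_comm, smul_smul, mul_assoc (TwistedCourant.ghost U γ)]
  have t : ∀ β γ δ, E ((passSign β γ * passSign β δ * passSign γ δ) •
      (TwistedCourant.ghost U β * TwistedCourant.ghost U γ * TwistedCourant.ghost U δ *
      pull U r (L β γ δ))) =
      (if β = Sum.inr ε then W γ δ else 0) + (if γ = Sum.inr ε then W β δ else 0) +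
      (if δ = Sum.inr ε then W β γ else 0) := by
    intro β γ δ
    rw [map_units_smul', mul_assoc (TwistedCourant.ghost U β * _),
      mul_assoc (TwistedCourant.ghost U β),
      hE.ghost_mul, hE.ghost_mul, hE.ghost_mul,
      hE.pull_eq_zero hE.phi, mul_zero, smul_zero, add_zero, mul_add, smul_add, smul_add, smul_add,
      ← add_assoc]
    have e₁ : ((passSign β γ * passSign β δ * passSign γ δ) • if β = Sum.inr ε then
        TwistedCourant.ghost U γ * (TwistedCourant.ghost U δ * pull U r (L β γ δ)) else 0) =
        if β = Sum.inr ε then W γ δ else 0 := by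
      split_ifs with h
      · rw [h, ← hW, mul_comm]
      · exact smul_zero _
    have e₂ : (passSign β γ * passSign β δ * passSign γ δ) •
        sgn (1 - tdeg (Sum.inr ε : Idx n r), -1) (tdeg β - 1, 1) •
        (TwistedCourant.ghost U β * if γ = Sum.inr ε then
          TwistedCourant.ghost U δ * pull U r (L β γ δ) else 0) =
        if γ = Sum.inr ε then W β δ else 0 := by
      split_ifs with h
      · rw [h, hL β, ← hW, map_units_smul', mul_smul_comm, mul_smul_comm, smul_smul, smul_smul,
          ← sgn_ghostDerivative ε β]
        refine congrArg (· • _) ?_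
        ac_rfl
      · rw [mul_zero, smul_zero, smul_zero]
    have e₃ : (passSign β γ * passSign β δ * passSign γ δ) •
        sgn (1 - tdeg (Sum.inr ε : Idx n r), -1) (tdeg β - 1, 1) •
        (TwistedCourant.ghost U β * sgn (1 - tdeg (Sum.inr ε : Idx n r), -1) (tdeg γ - 1, 1) •
          (TwistedCourant.ghost U γ * if δ = Sum.inr ε then pull U r (L β γ δ) else 0)) =
        if δ = Sum.inr ε then W β γ else 0 := by
      split_ifs with h
      · rw [h, hL' β, hL β, ← hW, smul_smul, map_units_smul', mul_smul_comm, mul_smul_comm,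
          mul_smul_comm, smul_smul, smul_smul, map_units_smul', mul_smul_comm, mul_smul_comm,
          smul_smul, ← sgn_ghostDerivative ε β, ← sgn_ghostDerivative ε γ]
        refine congrArg (· • _) ?_
        ac_rfl
      · rw [mul_zero, smul_zero, mul_zero, smul_zero, smul_zero]
    rw [e₁, e₂, e₃]
  simp only [TwistedCourant.contr₃, map_sum, t, Finset.sum_add_distrib, Finset.sum_ite_eq',
    Finset.mem_univ, if_true]
  have h₁ : ∑ β : Idx n r, ∑ γ : Idx n r, ∑ δ : Idx n r, (if β = Sum.inr ε then W γ δ else 0) =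
      ∑ γ, ∑ δ, W γ δ := by
    rw [Finset.sum_comm]
    refine Finset.sum_congr rfl fun γ _ => ?_
    rw [Finset.sum_comm]
    simp only [Finset.sum_ite_eq', Finset.mem_univ, if_true]
  have h₂ : ∑ β : Idx n r, ∑ γ : Idx n r, ∑ δ : Idx n r, (if γ = Sum.inr ε then W β δ else 0) =
      ∑ γ, ∑ δ, W γ δ := by
    refine Finset.sum_congr rfl fun γ _ => ?_
    rw [Finset.sum_comm]
    simp only [Finset.sum_ite_eq', Finset.mem_univ, if_true]
  rw [h₁, h₂]
  change ∑ γ, ∑ δ, W γ δ + ∑ γ, ∑ δ, W γ δ + ∑ γ, ∑ δ, W γ δ = (3 : ℝ) • ∑ γ, ∑ δ, W γ δ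
  module

end IsGhostDerivative

end

/-! ### Covariantly constant expressions in the ghosts. -/

noncomputable section

variable {n r : ℕ} {U : TopologicalSpace.Opens (Fin n → ℝ)}

/-- A derivation that acts on fields and ghosts as the derivative with respect to `ε̃^{b_μ}`. -/
structure IsGhost2Derivative (μ : Fin n) (E : LocalForms U r →ₗ[ℝ] LocalForms U r) : Prop
    extends IsLocalDer (0, -2) E where
  phi : ∀ α, E (phi U α) = 0
  ghost : ∀ α, E (ghost U α) = 0
  ghost2 : ∀ β, E (ghost2 U β) = if β = ib μ then 1 else 0

/-- A derivation that annihilates fields and ghosts. -/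
structure IsJetDerivative (χ : ℤ × ℤ) (E : LocalForms U r →ₗ[ℝ] LocalForms U r) : Prop
    extends IsLocalDer χ E where
  phi : ∀ α, E (phi U α) = 0
  ghost : ∀ α, E (ghost U α) = 0
  ghost2 : ∀ α, E (ghost2 U α) = 0

theorem bideg_ite {p : ℤ × ℤ} {c : Prop} [Decidable c] (h : c → p = 0) :
    (if c then 1 else 0 : LocalForms U r) ∈ bideg fieldDeg p := by
  split_ifs with hc
  · rw [h hc]
    exact bideg_one
  · exact zero_mem _

theorem exists_extdGhostDerivative (ε : Fin r ⊕ Fin n) :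
    ∃ E : LocalForms U r →ₗ[ℝ] LocalForms U r,
      IsJetDerivative (-tdeg (Sum.inr ε : Idx n r), -1) E ∧
      (∀ α, E (extd U r (ghost U α)) = if α = Sum.inr ε then 1 else 0) ∧
      ∀ α, E (extd U r (ghost2 U α)) = 0 := by
  obtain ⟨E, hE, h₁, h₂, h₃, h₄, h₅, h₆⟩ := exists_localDer (U := U)
    (-tdeg (Sum.inr ε : Idx n r), -1) 0 0 0 (fun α => if α = Sum.inr ε then 1 else 0) 0 0
    (fun _ => zero_mem _) (fun _ => zero_mem _) (fun _ => zero_mem _)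
    (fun α => bideg_ite fun h => by rw [h]; ext <;> simp) (fun _ => zero_mem _)
    (fun _ => zero_mem _) (fun _ => rfl) (fun _ => if_neg (by simp)) (fun _ => rfl)
    (fun _ => rfl) (fun _ => rfl) (fun _ => rfl)
  exact ⟨E, ⟨hE, h₁, h₃, h₅⟩, h₄, h₆⟩

theorem exists_extdGhost2Derivative (μ : Fin n) :
    ∃ E : LocalForms U r →ₗ[ℝ] LocalForms U r, IsJetDerivative (-1, -2) E ∧
      (∀ α, E (extd U r (ghost U α)) = 0) ∧
      ∀ α, E (extd U r (ghost2 U α)) = if α = ib μ then 1 else 0 := by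
  obtain ⟨E, hE, h₁, h₂, h₃, h₄, h₅, h₆⟩ := exists_localDer (U := U) (r := r)
    (-1, -2) 0 0 0 0 0 (fun α => if α = ib μ then 1 else 0)
    (fun _ => zero_mem _) (fun _ => zero_mem _) (fun _ => zero_mem _) (fun _ => zero_mem _)
    (fun _ => zero_mem _) (fun α => bideg_ite fun h => by rw [h]; ext <;> simp [tdeg])
    (fun _ => rfl) (fun _ => rfl) (fun _ => rfl) (fun _ => if_neg (by simp)) (fun _ => rfl)
    (fun _ => if_neg (by simp))
  exact ⟨E, ⟨hE, h₁, h₃, h₅⟩, h₄, h₆⟩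

variable {K : TwistedCourantAlgebroid U r} {N : LocalForms U r →ₗ[ℝ] LocalForms U r}

theorem IsJetDerivative.gcomm_apply {χ : ℤ × ℤ} {E : LocalForms U r →ₗ[ℝ] LocalForms U r}
    (_ : IsJetDerivative χ E) {x : LocalForms U r} (hx : E x = 0) :
    (E ∘ₗ N - (sgn χ (1, 0) : ℤ) • (N ∘ₗ E)) x = E (N x) := by
  rw [LinearMap.sub_apply, LinearMap.smul_apply, LinearMap.comp_apply, LinearMap.comp_apply, hx,
    map_zero, smul_zero, sub_zero]

namespace TwistedCourantAlgebroid.IsOnShellDifferential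

/-- Take E = ∂/∂(dε) and E' = [E, N]. As N sends ε to dε and φ to functions of φ alone, E' acts on
fields and ghosts as ∂/∂ε. On forms without dε the commutator reduces to EN, so a ghost derivative
can be read off from the dε-dependence of Nx. -/
theorem exists_ghostDerivative (hN : K.IsOnShellDifferential N) (ε : Fin r ⊕ Fin n) :
    ∃ E E' : LocalForms U r →ₗ[ℝ] LocalForms U r,
      IsJetDerivative (-tdeg (Sum.inr ε : Idx n r), -1) E ∧ IsGhostDerivative ε E' ∧
      ∀ x, E x = 0 → E' x = E (N x) := by
  obtain ⟨E, hE, h₁, h₂⟩ := exists_extdGhostDerivative (U := U) ε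
  have hE' := hE.toIsLocalDer.gcomm hN.toIsLocalDer
  rw [show ((-tdeg (Sum.inr ε : Idx n r), -1) + (1, 0) : ℤ × ℤ) =
    (1 - tdeg (Sum.inr ε : Idx n r), -1) by ext <;> simp; ring] at hE'
  refine ⟨E, _, hE, ⟨hE', fun α => ?_, fun α => ?_, fun α => ?_⟩, fun x hx => hE.gcomm_apply hx⟩
  · rw [hE.gcomm_apply (hE.phi α), hN.phi, hE.pull_eq_zero hE.phi]
  · rw [hE.gcomm_apply (hE.ghost α), hN.ghost, h₁]
  · rw [hE.gcomm_apply (hE.ghost2 α), hN.ghost2, h₂]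

theorem exists_ghost2Derivative (hN : K.IsOnShellDifferential N) (μ : Fin n) :
    ∃ E E' : LocalForms U r →ₗ[ℝ] LocalForms U r,
      IsJetDerivative (-1, -2) E ∧ IsGhost2Derivative μ E' ∧ ∀ x, E x = 0 → E' x = E (N x) := by
  obtain ⟨E, hE, h₁, h₂⟩ := exists_extdGhost2Derivative (U := U) (r := r) μ
  have hE' := hE.toIsLocalDer.gcomm hN.toIsLocalDer
  rw [show ((-1, -2) + (1, 0) : ℤ × ℤ) = (0, -2) by ext <;> simp] at hE'
  refine ⟨E, _, hE, ⟨hE', fun α => ?_, fun α => ?_, fun α => ?_⟩, fun x hx => hE.gcomm_apply hx⟩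
  · rw [hE.gcomm_apply (hE.phi α), hN.phi, hE.pull_eq_zero hE.phi]
  · rw [hE.gcomm_apply (hE.ghost α), hN.ghost, h₁]
  · rw [hE.gcomm_apply (hE.ghost2 α), hN.ghost2, h₂]

end TwistedCourantAlgebroid.IsOnShellDifferential

theorem contr₁_eq_zero_iff {M : Idx n r → Target U r} (hN : K.IsOnShellDifferential N)
    (h : contr₁ (ghost U) M = 0) (γ : Fin r ⊕ Fin n) : M (Sum.inr γ) = 0 := by
  obtain ⟨-, E, -, hE, -⟩ := hN.exists_ghostDerivative γ
  refine pull_injective ?_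
  rw [← hE.contr₁, h, map_zero, map_zero]

theorem units_smul_eq_zero {A : Type*} [AddCommGroup A] {u : ℤˣ} {x : A}
    (h : u • x = 0) : x = 0 := by
  rw [← one_smul ℤˣ x, ← Int.units_mul_self u, mul_smul, h, smul_zero]

/-- The coefficients of graded symmetric quadratic expressions in the ghosts are unique. -/
theorem coeff₂_eq_zero {L : Idx n r → Idx n r → Target U r}
    (hN : K.IsOnShellDifferential N) (hL : ∀ β γ, L β γ = sgn (cdeg β) (cdeg γ) • L γ β)
    (β : Fin r ⊕ Fin n) (h : ∀ E, IsGhostDerivative β E → E (contr₂ L) = 0)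
    (γ : Fin r ⊕ Fin n) : L (Sum.inr β) (Sum.inr γ) = 0 := by
  obtain ⟨-, E, -, hE, -⟩ := hN.exists_ghostDerivative β
  have := h E hE
  rw [hE.contr₂ hL] at this
  exact units_smul_eq_zero (contr₁_eq_zero_iff hN ((smul_eq_zero_iff_right two_ne_zero).mp this) γ)

/-- The coefficients of graded symmetric cubic expressions in the ghosts are unique. -/
theorem coeff₃_eq_zero {L : Idx n r → Idx n r → Idx n r → Target U r}
    (hN : K.IsOnShellDifferential N)
    (hL : ∀ β γ δ, L β γ δ = sgn (cdeg β) (cdeg γ) • L γ β δ)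
    (hL' : ∀ β γ δ, L β γ δ = sgn (cdeg γ) (cdeg δ) • L β δ γ)
    (β : Fin r ⊕ Fin n) (h : ∀ E, IsGhostDerivative β E → E (contr₃ L) = 0)
    (γ δ : Fin r ⊕ Fin n) : L (Sum.inr β) (Sum.inr γ) (Sum.inr δ) = 0 := by
  obtain ⟨-, E, -, hE, -⟩ := hN.exists_ghostDerivative β
  have := h E hE
  rw [hE.contr₃ hL hL', smul_eq_zero_iff_right three_ne_zero] at this
  refine units_smul_eq_zero (u := passSign (Sum.inr β) (Sum.inr γ) * passSign (Sum.inr β) (Sum.inr δ))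
    (coeff₂_eq_zero (L := fun γ δ => (passSign (Sum.inr β) γ * passSign (Sum.inr β) δ) •
      L (Sum.inr β) γ δ) hN (fun γ δ => ?_) γ (fun E' _ => ?_) δ)
  · rw [hL', smul_smul, smul_smul]
    refine congrArg (· • _) ?_
    ac_rfl
  · rw [this, map_zero]

/-- Every differentiated ghost in Nσ must cancel by itself, because σ^β R_β contains no
differentials of ghosts. In terms of derivations, E'σ = ENσ = -E(σ^β R_β) = 0. Thus a solution does
not depend on the ghost in question. -/
theorem IsJetDerivative.closed_eq_zero {χ : ℤ × ℤ} {E E' : LocalForms U r →ₗ[ℝ] LocalForms U r}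
    (hE : IsJetDerivative χ E) (h : ∀ x, E x = 0 → E' x = E (N x))
    {σ : Idx n r → LocalForms U r} (hσ : ∀ α, E (σ α) = 0) {R : Idx n r → Idx n r → Target U r}
    (hc : ∀ α, N (σ α) + contr₁ σ (R α) = 0) (α : Idx n r) : E' (σ α) = 0 := by
  rw [h _ (hσ α), eq_neg_of_add_eq_zero_left (hc α), map_neg, hE.toIsLocalDer.contr₁ hE.phi]
  simp only [hσ, contr₁, zero_mul, Finset.sum_const_zero, neg_zero]

theorem IsJetDerivative.contrMixed_eq_zero {χ : ℤ × ℤ} {E : LocalForms U r →ₗ[ℝ] LocalForms U r}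
    (hE : IsJetDerivative χ E) (M : Idx n r → Idx n r → Target U r) : E (contrMixed M) = 0 := by
  rw [hE.toIsLocalDer.contrMixed hE.phi hE.ghost]
  simp only [hE.ghost2, zero_mul, Finset.sum_const_zero]

theorem IsJetDerivative.contr₁_ghost2_eq_zero {χ : ℤ × ℤ}
    {E : LocalForms U r →ₗ[ℝ] LocalForms U r} (hE : IsJetDerivative χ E)
    (M : Idx n r → Target U r) : E (contr₁ (TwistedCourant.ghost2 U) M) = 0 := by
  rw [hE.toIsLocalDer.contr₁ hE.phi]
  simp only [hE.ghost2, contr₁, zero_mul, Finset.sum_const_zero]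

/-- Covariantly constant expressions in the ghosts of ghost number two vanish. -/
theorem closed₂_eq_zero (hN : K.IsOnShellDifferential N) {M : Idx n r → Idx n r → Target U r}
    {L : Idx n r → Idx n r → Idx n r → Target U r} (hL : IsGradedSymm₂ L)
    {σ : Idx n r → LocalForms U r}
    (hσ : ∀ α, σ α = contr₁ (ghost2 U) (M α) + (1 / 2 : ℝ) • contr₂ (L α))
    {R : Idx n r → Idx n r → Target U r} (hc : ∀ α, N (σ α) + contr₁ σ (R α) = 0) (α : Idx n r) :
    (∀ μ, M α (ib μ) = 0) ∧ ∀ β γ, L α (Sum.inr β) (Sum.inr γ) = 0 := by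
  have hz : ∀ {χ E}, IsJetDerivative χ E → ∀ α, E (σ α) = 0 := fun hE α => by
    rw [hσ, map_add, map_smul, hE.contr₁_ghost2_eq_zero,
      hE.toIsLocalDer.contr₂_eq_zero hE.phi hE.ghost, smul_zero, add_zero]
  -- The ε̃-part is removed first. What is left is homogeneous in ε, so that its ε-derivatives
  -- determine its coefficients.
  have hM : ∀ μ, M α (ib μ) = 0 := fun μ => by
    obtain ⟨E, E', hE, hE', h⟩ := hN.exists_ghost2Derivative μ
    have := hE.closed_eq_zero h (hz hE) hc α
    rw [hσ, map_add, map_smul, hE'.toIsLocalDer.contr₂_eq_zero hE'.phi hE'.ghost, smul_zero,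
      add_zero, hE'.toIsLocalDer.contr₁ hE'.phi] at this
    simp only [contr₁, hE'.ghost2, ite_mul, one_mul, zero_mul, Finset.sum_ite_eq',
      Finset.mem_univ, if_true] at this
    exact pull_injective (this.trans (map_zero _).symm)
  refine ⟨hM, fun β γ => ?_⟩
  obtain ⟨E, E', hE, hE', h⟩ := hN.exists_ghostDerivative β
  refine coeff₂_eq_zero hN (hL α) β (fun F hF => ?_) γ
  have := hE.closed_eq_zero h (hz hE) hc α
  rw [hσ, contr₁_ghost2_eq_zero hM, zero_add, map_smul, smul_eq_zero_iff_right (by norm_num),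
    hE'.contr₂ (hL α)] at this
  rw [hF.contr₂ (hL α), this]

/-- Covariantly constant expressions in the ghosts of ghost number three vanish. -/
theorem closed₃_eq_zero (hN : K.IsOnShellDifferential N)
    {M : Idx n r → Idx n r → Idx n r → Target U r}
    {L : Idx n r → Idx n r → Idx n r → Idx n r → Target U r} (hL : IsGradedSymm₃ L)
    {σ : Idx n r → LocalForms U r}
    (hσ : ∀ α, σ α = contrMixed (M α) + (1 / 6 : ℝ) • contr₃ (L α))
    {R : Idx n r → Idx n r → Target U r} (hc : ∀ α, N (σ α) + contr₁ σ (R α) = 0) (α : Idx n r) :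
    (∀ μ γ, M α (ib μ) (Sum.inr γ) = 0) ∧
      ∀ β γ δ, L α (Sum.inr β) (Sum.inr γ) (Sum.inr δ) = 0 := by
  have hz : ∀ {χ E}, IsJetDerivative χ E → ∀ α, E (σ α) = 0 := fun hE α => by
    rw [hσ, map_add, map_smul, hE.contrMixed_eq_zero,
      hE.toIsLocalDer.contr₃_eq_zero hE.phi hE.ghost, smul_zero, add_zero]
  have hM : ∀ μ γ, M α (ib μ) (Sum.inr γ) = 0 := fun μ γ => by
    obtain ⟨E, E', hE, hE', h⟩ := hN.exists_ghost2Derivative μ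
    have := hE.closed_eq_zero h (hz hE) hc α
    rw [hσ, map_add, map_smul, hE'.toIsLocalDer.contr₃_eq_zero hE'.phi hE'.ghost, smul_zero,
      add_zero, hE'.toIsLocalDer.contrMixed hE'.phi hE'.ghost] at this
    simp only [hE'.ghost2, ite_mul, one_mul, zero_mul, Finset.sum_ite_eq',
      Finset.mem_univ, if_true] at this
    exact contr₁_eq_zero_iff hN this γ
  refine ⟨hM, fun β => ?_⟩
  obtain ⟨E, E', hE, hE', h⟩ := hN.exists_ghostDerivative β
  refine coeff₃_eq_zero hN (fun β γ δ => (hL α β γ δ).1) (fun β γ δ => (hL α β γ δ).2) β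
    fun F hF => ?_
  have := hE.closed_eq_zero h (hz hE) hc α
  rw [hσ, contrMixed_eq_zero hM, zero_add, map_smul, smul_eq_zero_iff_right (by norm_num),
    hE'.contr₃ (fun β γ δ => (hL α β γ δ).1) (fun β γ δ => (hL α β γ δ).2)] at this
  rw [hF.contr₃ (fun β γ δ => (hL α β γ δ).1) (fun β γ δ => (hL α β γ δ).2), this]

namespace TwistedCourantAlgebroid

theorem onShell_onShell (x : LocalForms U r) : K.onShell (K.onShell x) = K.onShell x := by
  have := (K.weaklyZero_iff _).mp (K.sub_onShell_mem x)
  rw [map_sub, sub_eq_zero] at this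
  exact this.symm

/-- A derivation that annihilates the fields and their exterior derivatives preserves weak
equality. -/
theorem onShell_vertical {χ : ℤ × ℤ} {D : LocalForms U r →ₗ[ℝ] LocalForms U r}
    (hD : IsLocalDer χ D) (hφ : ∀ α, D (phi U α) = 0) (hdφ : ∀ α, D (extd U r (phi U α)) = 0)
    (x : LocalForms U r) : K.onShell (D x) = K.onShell (D (K.onShell x)) := by
  let P : LocalForms U r →ₗ[ℝ] LocalForms U r := K.onShell.toLinearMap.restrictScalars ℝ
  have h : P ∘ₗ D = P ∘ₗ D ∘ₗ P := local_ext K.onShell (fun x => twist χ (K.onShell x))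
    (fun x y => ?_) (fun x y => ?_) (fun f => ?_) (fun α => ?_) (fun α => ?_) (fun α => ?_)
    (fun α => ?_) (fun α => ?_) (fun α => ?_)
  · exact DFunLike.congr_fun h x
  · change K.onShell (D (x * y)) = K.onShell (D x) * K.onShell y + _ * K.onShell (D y)
    rw [hD.leibniz, map_add, map_mul, map_mul, twist_onShell]
  · change K.onShell (D (K.onShell (x * y))) =
      K.onShell (D (K.onShell x)) * K.onShell y + _ * K.onShell (D (K.onShell y))
    rw [map_mul, hD.leibniz, map_add, map_mul, map_mul, ← twist_onShell, onShell_onShell,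
      onShell_onShell]
  · change K.onShell (D _) = K.onShell (D (K.onShell _))
    rw [AlgHom.commutes]
  · change K.onShell (D _) = K.onShell (D (K.onShell _))
    rw [onShell_phi]
  · change K.onShell (D _) = K.onShell (D (K.onShell _))
    rw [onShell_extd_phi, hdφ, hD.pull_eq_zero hφ]
  · change K.onShell (D _) = K.onShell (D (K.onShell _))
    rw [onShell_ghost]
  · change K.onShell (D _) = K.onShell (D (K.onShell _))
    rw [onShell_extd_ghost]
  · change K.onShell (D _) = K.onShell (D (K.onShell _))
    rw [onShell_ghost2]
  · change K.onShell (D _) = K.onShell (D (K.onShell _))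
    rw [onShell_extd_ghost2]

end TwistedCourantAlgebroid

end

/-! ### Weak nilpotency determines the coefficients. -/

noncomputable section

variable {n r : ℕ} {U : TopologicalSpace.Opens (Fin n → ℝ)}

theorem gradedSymm₂_tder (Q : Idx n r → Target U r) :
    IsGradedSymm₂ fun α β γ => tder (U := U) β (tder (U := U) γ (Q α)) :=
  fun α β γ => tder_comm β γ (Q α)

theorem gradedSymm₃_tder (Q : Idx n r → Target U r) :
    IsGradedSymm₃ fun α β γ δ => tder (U := U) β (tder (U := U) γ (tder (U := U) δ (Q α))) :=
  fun α β γ δ => ⟨tder_comm β γ _, by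
    dsimp only
    rw [tder_comm γ δ, map_units_smul']⟩

theorem IsGradedSymm₂.add {L L' : Idx n r → Idx n r → Idx n r → Target U r}
    (h : IsGradedSymm₂ L) (h' : IsGradedSymm₂ L') :
    IsGradedSymm₂ fun α β γ => L α β γ + L' α β γ := fun α β γ => by
  dsimp only
  rw [h α β γ, h' α β γ, smul_add]

theorem IsGradedSymm₃.sub {L L' : Idx n r → Idx n r → Idx n r → Idx n r → Target U r}
    (h : IsGradedSymm₃ L) (h' : IsGradedSymm₃ L') :
    IsGradedSymm₃ fun α β γ δ => L α β γ δ - L' α β γ δ := fun α β γ δ => by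
  dsimp only
  constructor
  · rw [(h α β γ δ).1, (h' α β γ δ).1, smul_sub]
  · rw [(h α β γ δ).2, (h' α β γ δ).2, smul_sub]

namespace TwistedCourantAlgebroid

variable {K : TwistedCourantAlgebroid U r} {N : LocalForms U r →ₗ[ℝ] LocalForms U r}

section Difference

variable {s s₀ : LocalForms U r →ₗ[ℝ] LocalForms U r} (hs : IsBRSTOperator s)
  (hs₀ : IsBRSTOperator s₀) (hφ : ∀ α, s (phi U α) = s₀ (phi U α))

include hs hs₀ in
theorem isLocalDer_difference : IsLocalDer (0, 1) (s - s₀) := hs.isLocalDer.sub hs₀.isLocalDer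

include hs hs₀ in
theorem difference_comm_d (x : LocalForms U r) : (s - s₀) (extd U r x) = extd U r ((s - s₀) x) := by
  simp only [LinearMap.sub_apply, hs.comm_d, hs₀.comm_d, map_sub]

include hφ in
theorem difference_phi (α : Idx n r) : (s - s₀) (phi U α) = 0 := by
  rw [LinearMap.sub_apply, hφ, sub_self]

include hs hs₀ hφ

/-- The two operators agree on the fields and therefore on their differentials. Their difference
kills both, hence preserves the stationary ideal. In this way unspecified trivial terms drop out of
the comparison. -/
theorem difference_weaklyZero {x : LocalForms U r} (hx : K.WeaklyZero x) :
    K.onShell ((s - s₀) x) = 0 := by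
  rw [onShell_vertical (isLocalDer_difference hs hs₀) (difference_phi hφ)
    (fun α => by rw [difference_comm_d hs hs₀, difference_phi hφ, map_zero]),
    (K.weaklyZero_iff _).mp hx, map_zero, map_zero]

theorem difference_del₁ (f : Target U r) :
    (s - s₀) (del₁ f) = contr₁ (fun β => (s - s₀) (ghost U β)) fun β => tder (U := U) β f :=
  (isLocalDer_difference hs hs₀).contr₁ (difference_phi hφ) _ _

theorem difference_del₂ (hε : ∀ α, s (ghost U α) = s₀ (ghost U α)) (f : Target U r) :
    (s - s₀) (del₂ f) = contr₁ (fun β => (s - s₀) (ghost2 U β)) fun β => tder (U := U) β f := by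
  rw [del₂, map_add, map_smul, (isLocalDer_difference hs hs₀).contr₂_eq_zero
    (difference_phi hφ) (fun α => by rw [LinearMap.sub_apply, hε, sub_self]), smul_zero,
    add_zero]
  exact (isLocalDer_difference hs hs₀).contr₁ (difference_phi hφ) _ _

end Difference

theorem onShell_contr₁' (σ : Idx n r → LocalForms U r) (M : Idx n r → Target U r) :
    K.onShell (contr₁ σ M) = contr₁ (fun β => K.onShell (σ β)) M := by
  simp only [contr₁, map_sum, map_mul, onShell_pull]

theorem contr₁_neg (σ : Idx n r → LocalForms U r) (M : Idx n r → Target U r) :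
    contr₁ σ (fun β => -M β) = -contr₁ σ M := by
  simp only [contr₁, map_neg, mul_neg, Finset.sum_neg_distrib]

/-- Weak nilpotency determines the coefficients in the transformation of the ghosts. -/
theorem ghost_coefficients {s : LocalForms U r →ₗ[ℝ] LocalForms U r}
    {τφ τε : Idx n r → LocalForms U r} {k : Idx n r → Idx n r → Target U r}
    {l : Idx n r → Idx n r → Idx n r → Target U r} (hs : IsBRSTOperator s)
    (hτφ : K.IsFieldTriv τφ) (hτε : K.IsGhostTriv τε) (hφ : K.FieldLaw s τφ)
    (hl : IsGradedSymm₂ l)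
    (hε : ∀ α, s (ghost U α) = extd U r (ghost2 U α) + contr₁ (ghost2 U) (k α)
      + (1 / 2 : ℝ) • contr₂ (l α) + τε α)
    (h : ∀ α, K.WeaklyZero (s (s (phi U α)))) :
    (∀ α μ, k α (ib μ) = -tder (U := U) (ib μ) (K.Q α)) ∧
      (∀ α β γ, l α (Sum.inr β) (Sum.inr γ) =
        -tder (U := U) (Sum.inr β) (tder (U := U) (Sum.inr γ) (K.Q α))) ∧ K.GhostLaw s τε := by
  obtain ⟨s₀, hs₀, l₁, l₂, -, h₀, -⟩ := exists_unique_brst hτφ hτε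
  obtain ⟨N, hN⟩ := K.exists_onShellDifferential
  have hφ' : ∀ α, s (phi U α) = s₀ (phi U α) := fun α => (hφ α).trans (l₁ α).symm
  have hσ : ∀ α, (s - s₀) (ghost U α) =
      contr₁ (ghost2 U) (fun β => k α β + tder (U := U) β (K.Q α)) +
      (1 / 2 : ℝ) • contr₂ fun β γ => l α β γ + tder (U := U) β (tder (U := U) γ (K.Q α)) :=
    fun α => by
    rw [LinearMap.sub_apply, hε, ghostLaw_iff.mp l₂, contr₁_add, contr₂_add, del₂]
    module
  -- As s²φ ≈ 0, s₀²φ ≈ 0 and sφ = s₀φ, also (s - s₀)sφ ≈ 0. Inserting the law of the fields and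
  -- projecting gives the closedness equation.
  have hc : ∀ α, N ((s - s₀) (ghost U α)) +
      contr₁ (fun β => (s - s₀) (ghost U β)) (fun β => tder (U := U) β (K.Q α)) = 0 := fun α => by
    have hp : ∀ α, K.onShell ((s - s₀) (ghost U α)) = (s - s₀) (ghost U α) := fun α => by
      rw [hσ, map_add, onShell_real_smul, onShell_contr₂, K.onShell_contr₁ K.onShell_ghost2]
    have e : K.onShell ((s - s₀) (s (phi U α))) = 0 := by
      rw [LinearMap.sub_apply, map_sub, (K.weaklyZero_iff _).mp (h α), hφ',
        (K.weaklyZero_iff _).mp (h₀ _), sub_zero]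
    rw [hφ.apply, map_add, map_add, map_add, map_add,
      difference_weaklyZero hs hs₀ hφ' (hτφ α).1, difference_comm_d hs hs₀,
      difference_del₁ hs hs₀ hφ', hN.onShell_extd, onShell_contr₁', add_zero] at e
    simpa only [hp] using e
  have key := closed₂_eq_zero hN (hl.add (gradedSymm₂_tder K.Q)) hσ hc
  refine ⟨fun α μ => eq_neg_of_add_eq_zero_left ((key α).1 μ),
    fun α β γ => eq_neg_of_add_eq_zero_left ((key α).2 β γ), fun α => ?_⟩
  have e := hσ α
  rw [contr₁_ghost2_eq_zero (key α).1, contr₂_eq_zero (key α).2, smul_zero, add_zero,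
    LinearMap.sub_apply, sub_eq_zero] at e
  exact e.trans (l₂ α)

/-- Weak nilpotency determines the coefficients in the transformation of the ghosts for ghosts. -/
theorem ghost2_coefficients {s : LocalForms U r →ₗ[ℝ] LocalForms U r}
    {τφ τε : Idx n r → LocalForms U r} {k : Idx n r → Idx n r → Idx n r → Target U r}
    {l : Idx n r → Idx n r → Idx n r → Idx n r → Target U r} (hs : IsBRSTOperator s)
    (hτφ : K.IsFieldTriv τφ) (hτε : K.IsGhostTriv τε) (hφ : K.FieldLaw s τφ)
    (hε : K.GhostLaw s τε) (hl : IsGradedSymm₃ l)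
    (hg : ∀ α, s (ghost2 U α) = contrMixed (k α) + (1 / 6 : ℝ) • contr₃ (l α))
    (h : ∀ α, K.WeaklyZero (s (s (ghost U α)))) :
    (∀ α μ γ, k α (ib μ) (Sum.inr γ) =
        tder (U := U) (ib μ) (tder (U := U) (Sum.inr γ) (K.Q α))) ∧
      (∀ α β γ δ, l α (Sum.inr β) (Sum.inr γ) (Sum.inr δ) = tder (U := U) (Sum.inr β)
        (tder (U := U) (Sum.inr γ) (tder (U := U) (Sum.inr δ) (K.Q α)))) ∧ K.Ghost2Law s := by
  obtain ⟨s₀, hs₀, l₁, l₂, l₃, h₀, -⟩ := exists_unique_brst hτφ hτε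
  obtain ⟨N, hN⟩ := K.exists_onShellDifferential
  have hφ' : ∀ α, s (phi U α) = s₀ (phi U α) := fun α => (hφ α).trans (l₁ α).symm
  have hε' : ∀ α, s (ghost U α) = s₀ (ghost U α) := fun α => (hε α).trans (l₂ α).symm
  have hσ : ∀ α, (s - s₀) (ghost2 U α) =
      contrMixed (fun β γ => k α β γ - tder (U := U) β (tder (U := U) γ (K.Q α))) +
      (1 / 6 : ℝ) • contr₃ fun β γ δ => l α β γ δ -
        tder (U := U) β (tder (U := U) γ (tder (U := U) δ (K.Q α))) := fun α => by
    rw [LinearMap.sub_apply, hg, ghost2Law_iff.mp l₃, contrMixed_sub, contr₃_sub, del₃]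
    module
  -- The same argument one level up, with (s - s₀)sε ≈ 0. The minus sign stems from the term -ε̃^β
  -- ∂_β Q^α in the law of the ghosts.
  have hc : ∀ α, N ((s - s₀) (ghost2 U α)) +
      contr₁ (fun β => (s - s₀) (ghost2 U β)) (fun β => -tder (U := U) β (K.Q α)) = 0 := fun α => by
    have hp : ∀ α, K.onShell ((s - s₀) (ghost2 U α)) = (s - s₀) (ghost2 U α) := fun α => by
      rw [hσ, map_add, onShell_real_smul, onShell_contr₃, onShell_contrMixed]
    have e : K.onShell ((s - s₀) (s (ghost U α))) = 0 := by
      rw [LinearMap.sub_apply, map_sub, (K.weaklyZero_iff _).mp (h α), hε',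
        (K.weaklyZero_iff _).mp (h₀ _), sub_zero]
    rw [ghostLaw_iff.mp hε, map_add, map_sub, map_add, map_sub,
      difference_weaklyZero hs hs₀ hφ' (hτε α).1, difference_comm_d hs hs₀,
      difference_del₂ hs hs₀ hφ' hε', hN.onShell_extd, onShell_contr₁', add_zero] at e
    rw [contr₁_neg, ← sub_eq_add_neg]
    simpa only [hp] using e
  have key := closed₃_eq_zero hN (hl.sub (gradedSymm₃_tder K.Q)) hσ hc
  refine ⟨fun α μ γ => sub_eq_zero.mp ((key α).1 μ γ),
    fun α β γ δ => sub_eq_zero.mp ((key α).2 β γ δ), fun α => ?_⟩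
  have e := hσ α
  rw [contrMixed_eq_zero (key α).1, contr₃_eq_zero (key α).2, smul_zero, add_zero,
    LinearMap.sub_apply, sub_eq_zero] at e
  exact e.trans (l₃ α)

end TwistedCourantAlgebroid

end

/-! ### Variation of the Wess-Zumino term. -/

noncomputable section

variable {n r : ℕ} {U : TopologicalSpace.Opens (Fin n → ℝ)}

section Contraction

variable {R A ι : Type} [CommRing R] [Ring A] [Algebra R A] [Fintype ι] {C : ι → ι → ι → R}

theorem tri_comm₁ (hC : ∀ a b c, C b a c = -C a b c) {x y : ι → A}
    (h : ∀ a b, x a * y b = (-1 : ℤˣ) • (y b * x a)) (z : ι → A) : tri C x y z = tri C y x z := by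
  rw [tri_swap₁ C z h, show (fun a b c => C b a c) = fun a b c => -C a b c by
    funext a b c; exact hC a b c, tri_neg]
  simp

theorem tri_comm₂ (hC : ∀ a b c, C a c b = -C a b c) (x : ι → A) {y z : ι → A}
    (h : ∀ a b, y a * z b = (-1 : ℤˣ) • (z b * y a)) : tri C x y z = tri C x z y := by
  rw [tri_swap₂ C x h, show (fun a b c => C a c b) = fun a b c => -C a b c by
    funext a b c; exact hC a b c, tri_neg]
  simp

/-- Inside an antisymmetric tensor, anticommuting families behave like commuting variables, which
gives the binomial coefficients. -/
theorem tri_add_cube [Module ℝ A] (h₁ : ∀ a b c, C b a c = -C a b c)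
    (h₂ : ∀ a b c, C a c b = -C a b c) {x y : ι → A}
    (h : ∀ a b, x a * y b = (-1 : ℤˣ) • (y b * x a)) :
    tri C (fun a => x a + y a) (fun a => x a + y a) (fun a => x a + y a) =
      tri C x x x + (3 : ℝ) • tri C y x x + (3 : ℝ) • tri C x y y + tri C y y y := by
  have h' : ∀ a b, y a * x b = (-1 : ℤˣ) • (x b * y a) := fun a b => by simp [h]
  have e : tri C (fun a => x a + y a) (fun a => x a + y a) (fun a => x a + y a) =
      tri C x x x + tri C x x y + tri C x y x + tri C x y y + tri C y x x + tri C y x y +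
        tri C y y x + tri C y y y := by
    simp only [tri, mul_add, add_mul, smul_add, Finset.sum_add_distrib]
    abel
  rw [e, tri_comm₂ h₂ x h, tri_comm₁ h₁ h x, tri_comm₂ h₂ y h', tri_comm₁ h₁ h' y]
  module

theorem sum_last₃ {ι κ M : Type} [Fintype ι] [Fintype κ] [AddCommMonoid M]
    (f : κ → ι → ι → ι → M) :
    ∑ a, ∑ b, ∑ c, ∑ x, f x a b c = ∑ x, ∑ a, ∑ b, ∑ c, f x a b c := by
  have h := Finset.sum_comm (s := (Finset.univ : Finset (ι × ι × ι)))
    (t := (Finset.univ : Finset κ)) (f := fun i x => f x i.1 i.2.1 i.2.2)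
  simpa only [Fintype.sum_prod_type] using h

theorem sum_last₄ {ι κ M : Type} [Fintype ι] [Fintype κ] [AddCommMonoid M]
    (f : κ → ι → ι → ι → ι → M) :
    ∑ a, ∑ b, ∑ c, ∑ d, ∑ x, f x a b c d = ∑ x, ∑ a, ∑ b, ∑ c, ∑ d, f x a b c d := by
  have h := Finset.sum_comm (s := (Finset.univ : Finset (ι × ι × ι × ι)))
    (t := (Finset.univ : Finset κ)) (f := fun i x => f x i.1 i.2.1 i.2.2.1 i.2.2.2)
  simpa only [Fintype.sum_prod_type] using h

end Contraction

namespace TwistedCourantAlgebroid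

variable (K : TwistedCourantAlgebroid U r)

/-- The variation `(1/3!) H_{μνκl} w^μ dX^ν dX^κ dX^l` of the Wess-Zumino term. -/
def wzVariation (w : Fin n → LocalForms U r) : LocalForms U r :=
  (1 / 6 : ℝ) • quad K.H w (fun ν => extd U r (phi U (ix ν))) (fun ν => extd U r (phi U (ix ν)))
    (fun ν => extd U r (phi U (ix ν)))

theorem bideg_extd_phi (α : Idx n r) : extd U r (phi U α) ∈ bideg fieldDeg (tdeg α + 1, 0) := by
  have := isGDer_extd.degree (bideg_phi (U := U) α)
  rwa [show ((tdeg α, 0) + (1, 0) : ℤ × ℤ) = (tdeg α + 1, 0) by ext <;> simp] at this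

/-- This is dH = 0 in the form used by Cartan's formula: the derivative of H along w equals, after
antisymmetrisation, four times the derivative along q with w in the first slot. -/
theorem closed_variation {q w : Fin n → LocalForms U r}
    (hq : ∀ μ, q μ ∈ bideg fieldDeg ((1, 0) : ℤ × ℤ))
    (hw : ∀ μ, w μ ∈ bideg fieldDeg ((0, 1) : ℤ × ℤ)) :
    ∑ a, ∑ b, ∑ c, ∑ d, (∑ μ, pd μ (K.H a b c d) • w μ) * (q a * q b * q c * q d) =
      (4 : ℝ) • ∑ a, ∑ b, ∑ c, ∑ d, (∑ μ, pd μ (K.H a b c d) • q μ) *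
        (w a * q b * q c * q d) := by
  have hqw : ∀ μ ν, q μ * w ν = w ν * q μ := fun μ ν => by
    rw [mul_comm_of_mem (hq μ) (hw ν)]
    simp [sgn]
  have hqq : ∀ μ ν, q μ * q ν = (-1 : ℤˣ) • (q ν * q μ) := fun μ ν =>
    mul_comm_of_mem (hq μ) (hq ν)
  have e₁ : ∑ a, ∑ b, ∑ c, ∑ d, (∑ μ, pd μ (K.H a b c d) • w μ) * (q a * q b * q c * q d) =
      ∑ μ, w μ * quad (fun a b c d => pd μ (K.H a b c d)) q q q q := by
    simp only [Finset.sum_mul, smul_mul_assoc]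
    rw [sum_last₄]
    simp only [quad, Finset.mul_sum, mul_smul_comm]
  have e₂ : ∑ a, ∑ b, ∑ c, ∑ d, (∑ μ, pd μ (K.H a b c d) • q μ) * (w a * q b * q c * q d) =
      ∑ a, w a * quad (fun μ b c d => pd μ (K.H a b c d)) q q q q := by
    refine Finset.sum_congr rfl fun a _ => ?_
    simp only [Finset.sum_mul, smul_mul_assoc]
    rw [sum_last₃]
    simp only [quad, Finset.mul_sum, mul_smul_comm, mul_assoc]
    simp only [← mul_assoc (q _) (w a), hqw, mul_assoc]
  rw [e₁, e₂, Finset.smul_sum]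
  exact Finset.sum_congr rfl fun μ _ => by rw [K.quad_pd_H hqq, mul_smul_comm]

/-- Cartan's formula for a closed form: the variation along sX is the differential of the
contraction of H with sX. Since s and d commute, the terms with d(sX) match directly, and the terms
with derivatives of H match by `closed_variation`. -/
theorem brst_wessZumino {s : LocalForms U r →ₗ[ℝ] LocalForms U r} (hs : IsBRSTOperator s) :
    s K.wessZumino = extd U r (K.wzVariation fun μ => s (phi U (ix μ))) := by
  have hw : ∀ μ, s (phi U (ix μ)) ∈ bideg fieldDeg ((0, 1) : ℤ × ℤ) := fun μ => by
    have := hs.isGDer.degree (bideg_phi (U := U) (r := r) (ix μ))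
    rwa [show ((tdeg (ix μ : Idx n r), 0) + (0, 1) : ℤ × ℤ) = (0, 1) by ext <;> simp [tdeg]] at this
  have hdX : ∀ μ, extd U r (phi U (ix μ)) ∈ bideg fieldDeg ((1, 0) : ℤ × ℤ) := fun μ =>
    by simpa [tdeg] using bideg_extd_phi (U := U) (r := r) (ix μ)
  have hWZ : K.wessZumino = (1 / 24 : ℝ) • quad K.H (fun ν => extd U r (phi U (ix ν)))
      (fun ν => extd U r (phi U (ix ν))) (fun ν => extd U r (phi U (ix ν)))
      (fun ν => extd U r (phi U (ix ν))) := by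
    simp only [wessZumino, quad, phi, extd_coord]
  have hsd : ∀ μ, s (extd U r (phi U (ix μ))) = extd U r (s (phi U (ix μ))) := fun μ =>
    hs.comm_d _
  have hsf : ∀ f : Smooth U, s (algebraMap _ _ f) = ∑ μ, pd μ f • s (phi U (ix μ)) := hs.chain
  rw [hWZ, wzVariation, map_smul, map_smul, hs.isGDer.map_quad_antisymm K.H_swap₁ K.H_swap₂
    K.H_swap₃ (p := (1, 0)) (by simp [sgn]) hdX, isGDer_extd.map_quad K.H _ hw hdX hdX]
  simp only [hsd, extd_extd, hsf, extd_chain]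
  have h0 : (∀ x z, quad K.H (fun μ => s (phi U (ix μ))) (fun _ => 0) x z = 0) ∧
      (∀ x z, quad K.H (fun μ => s (phi U (ix μ))) x (fun _ => 0) z = 0) ∧
      ∀ x z, quad K.H (fun μ => s (phi U (ix μ))) x z (fun _ => 0) = 0 := by
    simp only [quad, mul_zero, zero_mul, smul_zero, Finset.sum_const_zero, implies_true, and_self]
  rw [K.closed_variation hdX hw, h0.1, h0.2.1, h0.2.2]
  simp only [smul_zero]
  module

end TwistedCourantAlgebroid

end

/-! ### Variation of the Lagrangian, and the Bianchi identities. -/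

noncomputable section

variable {n r : ℕ} {U : TopologicalSpace.Opens (Fin n → ℝ)}

theorem del₁_add (f g : Target U r) : del₁ (f + g) = del₁ f + del₁ g := by
  simp only [del₁, contr₁, map_add, mul_add, Finset.sum_add_distrib]

theorem del₁_neg (f : Target U r) : del₁ (-f) = -del₁ f := by
  simp only [del₁, contr₁, map_neg, mul_neg, Finset.sum_neg_distrib]

theorem del₁_real_smul (c : ℝ) (f : Target U r) : del₁ (c • f) = c • del₁ f := by
  simp only [del₁, contr₁, map_smul, pull_real_smul, mul_smul_comm, Finset.smul_sum]

theorem del₁_sum {ι : Type} [Fintype ι] (f : ι → Target U r) :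
    del₁ (∑ i, f i) = ∑ i, del₁ (f i) := by
  simp only [del₁, contr₁, map_sum, Finset.mul_sum]
  exact Finset.sum_comm

namespace TwistedCourantAlgebroid

variable (K : TwistedCourantAlgebroid U r)

theorem sum_metric_Q (a : Fin r) :
    ∑ b, K.η a b • K.Q (ia b) = -tder (U := U) (ia a) K.theta := by
  have h : ∀ c, ∑ b, K.η a b * K.η⁻¹ b c = if a = c then 1 else 0 := fun c => by
    have := congrFun (congrFun (Matrix.mul_nonsing_inv K.η K.η_nondeg) a) c
    rwa [Matrix.mul_apply, Matrix.one_apply] at this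
  simp only [Q_ia, smul_neg, Finset.sum_neg_distrib, Finset.smul_sum, smul_smul]
  rw [Finset.sum_comm]
  simp only [← Finset.sum_smul, h, ite_smul, one_smul, zero_smul, Finset.sum_ite_eq,
    Finset.mem_univ, if_true]

/-- The Lagrangian is a kinetic term plus the pull-back of the Hamiltonian, so its variation needs
only the first derivatives of `theta`. -/
theorem lagrangian_eq : K.lagrangian =
    -∑ μ, phi U (ib μ) * extd U r (phi U (ix μ))
      + (1 / 2 : ℝ) • ∑ a, ∑ b, K.η a b • (phi U (ia a) * extd U r (phi U (ia b)))
      + pull U r K.theta := by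
  have h : pull U r K.theta =
      ∑ a, ∑ μ, K.ρ a μ • (fgen U (.B μ) * fgen U (.A a))
      + (1 / 6 : ℝ) • ∑ a, ∑ b, ∑ c, K.C a b c •
        (fgen U (.A a) * fgen U (.A b) * fgen U (.A c)) := by
    rw [theta, map_add, map_sum, cubic, pull_real_smul, map_tri, Finset.sum_comm]
    simp only [map_mul, Q_ix, map_sum, map_smul, pull_ta, pull_tb, Finset.mul_sum, mul_smul_comm,
      tri]
  rw [h, lagrangian, ← add_assoc]
  simp only [phi, extd_coord, extd_gen, dGen]

variable {s : LocalForms U r →ₗ[ℝ] LocalForms U r}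

theorem bideg_brst_phi (hs : IsBRSTOperator s) (α : Idx n r) :
    s (phi U α) ∈ bideg fieldDeg (tdeg α, 1) := by
  have := hs.isGDer.degree (bideg_phi (U := U) α)
  rwa [show ((tdeg α, 0) + (0, 1) : ℤ × ℤ) = (tdeg α, 1) by ext <;> simp] at this

theorem brst_phi_mul (hs : IsBRSTOperator s) (α : Idx n r) (y : LocalForms U r) :
    s (phi U α * y) = s (phi U α) * y + phi U α * s y := by
  rw [hs.isGDer.mul_of_mem' (bideg_phi α), show sgn (0, 1) (tdeg α, 0) = 1 by simp [sgn], one_smul]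

theorem brst_kinetic_anchor (hs : IsBRSTOperator s) :
    s (∑ μ, phi U (ib μ) * extd U r (phi U (ix μ))) =
      ∑ μ, s (phi U (ib μ)) * extd U r (phi U (ix μ))
      - ∑ μ, s (phi U (ix μ)) * extd U r (phi U (ib μ))
      + extd U r (∑ μ, phi U (ib μ) * s (phi U (ix μ))) := by
  rw [map_sum, map_sum, ← Finset.sum_sub_distrib, ← Finset.sum_add_distrib]
  refine Finset.sum_congr rfl fun μ _ => ?_
  rw [brst_phi_mul hs, hs.comm_d, isGDer_extd.mul_of_mem' (bideg_phi (ib μ)),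
    mul_comm_of_mem (bideg_extd_phi (ib μ)) (bideg_brst_phi hs (ix μ)),
    show sgn (tdeg (ib μ : Idx n r) + 1, 0) (tdeg (ix μ : Idx n r), 1) = 1 by simp [sgn, tdeg],
    show sgn (1, 0) (tdeg (ib μ : Idx n r), 0) = 1 from sgn_comm _ _ ▸
      sgn_of_even (by simp [tdeg]) Even.zero _, one_smul, one_smul]
  abel

theorem brst_kinetic_metric (hs : IsBRSTOperator s) :
    s ((1 / 2 : ℝ) • ∑ a, ∑ b, K.η a b • (phi U (ia a) * extd U r (phi U (ia b)))) =
      ∑ a, ∑ b, K.η a b • (s (phi U (ia a)) * extd U r (phi U (ia b)))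
      - extd U r ((1 / 2 : ℝ) • ∑ a, ∑ b, K.η a b • (phi U (ia a) * s (phi U (ia b)))) := by
  have h : ∀ a b, s (phi U (ia a) * extd U r (phi U (ia b))) =
      s (phi U (ia a)) * extd U r (phi U (ia b)) + s (phi U (ia b)) * extd U r (phi U (ia a))
        - extd U r (phi U (ia a) * s (phi U (ia b))) := fun a b => by
    rw [brst_phi_mul hs, hs.comm_d, isGDer_extd.mul_of_mem' (bideg_phi (ia a)),
      mul_comm_of_mem (bideg_extd_phi (ia a)) (bideg_brst_phi hs (ia b)),
      sgn_of_even (p := (tdeg (ia a : Idx n r) + 1, 0)) (by simp [tdeg]) Even.zero,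
      show sgn (1, 0) (tdeg (ia a : Idx n r), 0) = -1 by simp [sgn, tdeg], one_smul]
    simp only [Units.neg_smul, one_smul]
    abel
  have e : ∑ a, ∑ b, K.η a b • (s (phi U (ia b)) * extd U r (phi U (ia a))) =
      ∑ a, ∑ b, K.η a b • (s (phi U (ia a)) * extd U r (phi U (ia b))) := by
    rw [Finset.sum_comm]
    simp only [K.η_symm.apply]
  simp only [map_smul, map_sum, h, smul_add, smul_sub, Finset.sum_add_distrib,
    Finset.sum_sub_distrib]
  rw [← smul_add, e]
  simp only [← map_sum, ← map_smul]
  module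

/-- The derivatives of `theta` are the components of Q, lowered with η for the a-directions and
corrected by `hForm` for the x-directions. They later combine with the dφ of the kinetic terms to
field strengths. -/
theorem brst_theta (hs : IsBRSTOperator s) : s (pull U r K.theta) =
    -∑ μ, s (phi U (ix μ)) * (pull U r (K.Q (ib μ)) + pull U r (K.hForm μ))
      - ∑ a, ∑ b, K.η a b • (s (phi U (ia a)) * pull U r (K.Q (ia b)))
      + ∑ μ, s (phi U (ib μ)) * pull U r (K.Q (ix μ)) := by
  have h₁ : ∀ μ, pull U r (tder (U := U) (ix μ) K.theta) =
      -(pull U r (K.Q (ib μ)) + pull U r (K.hForm μ)) := fun μ => by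
    rw [Q_ib, map_sub, map_neg]
    abel
  have h₂ : ∀ a, pull U r (tder (U := U) (ia a) K.theta) =
      -∑ b, K.η a b • pull U r (K.Q (ia b)) := fun a => by
    rw [← neg_neg (tder (U := U) (ia a) K.theta), ← sum_metric_Q, map_neg, map_sum]
    simp only [pull_real_smul]
  rw [chain_rule hs.isGDer hs.chain, Fintype.sum_sum_type, Fintype.sum_sum_type]
  simp only [h₁, h₂, tder_ib_theta, mul_neg, Finset.sum_neg_distrib, Finset.mul_sum, mul_smul_comm]
  abel

/-- The variation of the Lagrangian without the Wess-Zumino term. -/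
theorem brst_lagrangian (hs : IsBRSTOperator s) : s K.lagrangian =
    extd U r (-∑ μ, phi U (ib μ) * s (phi U (ix μ))
      - (1 / 2 : ℝ) • ∑ a, ∑ b, K.η a b • (phi U (ia a) * s (phi U (ia b))))
    + (-∑ μ, s (phi U (ib μ)) * K.fieldStrength (ix μ)
      + ∑ a, ∑ b, K.η a b • (s (phi U (ia a)) * K.fieldStrength (ia b))
      + ∑ μ, s (phi U (ix μ)) * K.fieldStrength (ib μ))
    - ∑ μ, s (phi U (ix μ)) * pull U r (K.hForm μ) := by
  rw [lagrangian_eq, map_add, map_add, map_neg, brst_kinetic_anchor hs, K.brst_kinetic_metric hs,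
    K.brst_theta hs]
  simp only [fieldStrength, mul_sub, mul_add, smul_sub, Finset.sum_sub_distrib,
    Finset.sum_add_distrib, map_sub (extd U r), map_neg (extd U r)]
  abel

theorem bideg_fieldStrength (α : Idx n r) :
    K.fieldStrength α ∈ bideg fieldDeg (tdeg α + 1, 0) :=
  sub_mem (bideg_extd_phi α) (bideg_pull (K.bideg_Q α))

/-- The Bianchi identities. -/
theorem extd_fieldStrength (α : Idx n r) : extd U r (K.fieldStrength α) =
    -∑ β, K.fieldStrength β * pull U r (tder (U := U) β (K.Q α)) := by
  -- Subtracting the pull-back of Q² = 0 from the chain rule replaces each dφ^β by F^β.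
  have h := K.pull_vf (K.Q α)
  rw [vf_Q, map_zero] at h
  rw [fieldStrength, map_sub, extd_extd, zero_sub, chain_rule isGDer_extd extd_chain]
  simp only [fieldStrength, sub_mul, Finset.sum_sub_distrib]
  rw [← h, sub_zero]

/-- The sign `(-1)^{|α|}`. -/
def parity (α : Idx n r) : ℤˣ := Int.negOnePow (tdeg α)

/-- Both terms contain the same second derivative of `theta` up to order. The first comes from a
Bianchi identity after integration by parts, the second from ε^β ∂_β Q. That the signs are opposite
rests on |β|(|β| + 1) being even. -/
theorem bianchi_cancel (β γ : Idx n r) :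
    parity γ • (K.fieldStrength β * pull U r (tder (U := U) β (tder (U := U) γ K.theta))) +
      parity β • (pull U r (tder (U := U) γ (tder (U := U) β K.theta)) * K.fieldStrength β) =
        0 := by
  rw [tder_comm γ β, map_units_smul', smul_mul_assoc, mul_comm_of_mem
    (bideg_pull (bideg_tder₂ K.bideg_theta β γ)) (K.bideg_fieldStrength β), smul_smul, smul_smul]
  have h : parity β * (sgn (cdeg γ) (cdeg β) * sgn (3 - tdeg β - tdeg γ, 0) (tdeg β + 1, 0)) =
      -parity γ := by
    simp only [parity, sgn, cdeg]
    rw [← Int.negOnePow_add, ← Int.negOnePow_add, ← Int.negOnePow_succ, Int.negOnePow_eq_iff]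
    obtain ⟨k, hk⟩ := Int.even_mul_succ_self (tdeg β)
    exact ⟨2 * tdeg β + 1 - tdeg γ - k, by linear_combination -hk⟩
  rw [← mul_assoc] at h
  rw [h, Units.neg_smul, add_neg_cancel]

end TwistedCourantAlgebroid

end

/-! ### Gauge variation of the kinetic terms and the Hamiltonian. -/

noncomputable section

variable {n r : ℕ} {U : TopologicalSpace.Opens (Fin n → ℝ)}

theorem ghost_ix (μ : Fin n) : ghost U (ix μ : Idx n r) = 0 := rfl

namespace TwistedCourantAlgebroid

variable (K : TwistedCourantAlgebroid U r)

theorem bianchi_cancel_sum :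
    ∑ γ, parity γ • (ghost U γ * ∑ β, K.fieldStrength β *
        pull U r (tder (U := U) β (tder (U := U) γ K.theta))) +
      ∑ β, parity β • (del₁ (tder (U := U) β K.theta) * K.fieldStrength β) = 0 := by
  simp only [del₁, contr₁, Finset.sum_mul, Finset.mul_sum, Finset.smul_sum]
  rw [Finset.sum_comm (f := fun β γ => parity β • (ghost U γ *
    pull U r (tder (U := U) γ (tder (U := U) β K.theta)) * K.fieldStrength β)),
    ← Finset.sum_add_distrib]
  refine Finset.sum_eq_zero fun γ _ => ?_
  rw [← Finset.sum_add_distrib]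
  refine Finset.sum_eq_zero fun β _ => ?_
  have h := congrArg (ghost U γ * ·) (K.bianchi_cancel β γ)
  simpa only [mul_add, mul_smul_comm, mul_zero, mul_assoc] using h

/-- Integration by parts moves d from the ghost to the field strength. The Bianchi identity then
produces second derivatives of `theta`, the form required by `bianchi_cancel_sum`. -/
theorem extd_ghost_ib_mul (μ : Fin n) :
    extd U r (ghost U (ib μ)) * K.fieldStrength (ix μ) =
      extd U r (ghost U (ib μ) * K.fieldStrength (ix μ)) -
        ghost U (ib μ) * ∑ β, K.fieldStrength β *
          pull U r (tder (U := U) β (tder (U := U) (ib μ) K.theta)) := by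
  rw [isGDer_extd.mul_of_mem' (bideg_ghost (ib μ)), extd_fieldStrength, tder_ib_theta,
    show sgn (1, 0) (tdeg (ib μ : Idx n r) - 1, 1) = -1 by simp [sgn, tdeg], Units.neg_smul,
    one_smul, mul_neg, neg_neg, add_sub_cancel_right]

theorem extd_ghost_ia_mul (a : Fin r) :
    ∑ b, K.η a b • (extd U r (ghost U (ia a)) * K.fieldStrength (ia b)) =
      extd U r (∑ b, K.η a b • (ghost U (ia a) * K.fieldStrength (ia b))) -
        ghost U (ia a) * ∑ β, K.fieldStrength β *
          pull U r (tder (U := U) β (tder (U := U) (ia a) K.theta)) := by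
  have h : ∀ β, pull U r (tder (U := U) β (tder (U := U) (ia a) K.theta)) =
      -∑ b, K.η a b • pull U r (tder (U := U) β (K.Q (ia b))) := fun β => by
    rw [← neg_neg (tder (U := U) (ia a) K.theta), ← sum_metric_Q, map_neg, map_neg, map_sum,
      map_sum]
    simp only [map_smul, pull_real_smul]
  have e : ∑ β, K.fieldStrength β * pull U r (tder (U := U) β (tder (U := U) (ia a) K.theta)) =
      ∑ b, K.η a b • extd U r (K.fieldStrength (ia b)) := by
    simp only [h, extd_fieldStrength, mul_neg, Finset.mul_sum, mul_smul_comm, smul_neg,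
      Finset.smul_sum, Finset.sum_neg_distrib]
    rw [Finset.sum_comm]
  rw [e, map_sum, Finset.mul_sum, ← Finset.sum_sub_distrib]
  refine Finset.sum_congr rfl fun b _ => ?_
  rw [map_smul, isGDer_extd.mul_of_mem' (bideg_ghost (ia a)),
    show sgn (1, 0) (tdeg (ia a : Idx n r) - 1, 1) = 1 by simp [sgn, tdeg], one_smul, smul_add,
    mul_smul_comm, add_sub_cancel_right]

/-- The variation of the kinetic terms and the Hamiltonian under the gauge transformations without
trivial terms is exact up to the 4-form. -/
theorem gauge_variation :
    -∑ μ, (extd U r (ghost U (ib μ)) + del₁ (K.Q (ib μ))) * K.fieldStrength (ix μ)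
      + ∑ a, ∑ b, K.η a b • ((extd U r (ghost U (ia a)) + del₁ (K.Q (ia a))) *
          K.fieldStrength (ia b))
      + ∑ μ, del₁ (K.Q (ix μ)) * K.fieldStrength (ib μ) =
    extd U r (-∑ μ, ghost U (ib μ) * K.fieldStrength (ix μ)
      + ∑ a, ∑ b, K.η a b • (ghost U (ia a) * K.fieldStrength (ia b)))
      + ∑ μ, del₁ (K.hForm μ) * K.fieldStrength (ix μ) := by
  have h := K.bianchi_cancel_sum
  -- W γ is the Bianchi term left by integrating dε^γ by parts. It is treated as an atom from here
  -- on; for γ of type x it is zero, since there is no such ghost.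
  obtain ⟨W, hW⟩ : ∃ W : Idx n r → LocalForms U r, ∀ γ, ghost U γ * ∑ β, K.fieldStrength β *
      pull U r (tder (U := U) β (tder (U := U) γ K.theta)) = W γ := ⟨_, fun _ => rfl⟩
  have hW₀ : ∀ μ, W (ix μ) = 0 := fun μ => by rw [← hW, ghost_ix, zero_mul]
  simp only [hW] at h
  have p₀ : ∀ μ : Fin n, parity (ix μ : Idx n r) = 1 := fun _ => rfl
  have p₁ : ∀ a : Fin r, parity (ia a : Idx n r) = -1 := fun _ => by simp [parity, tdeg]
  have p₂ : ∀ μ : Fin n, parity (ib μ : Idx n r) = 1 := fun _ => rfl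
  have c₁ : ∀ μ, del₁ (tder (U := U) (ix μ) K.theta) =
      -del₁ (K.Q (ib μ)) - del₁ (K.hForm μ) := fun μ => by
    rw [show tder (U := U) (ix μ) K.theta = -K.Q (ib μ) + -K.hForm μ by rw [Q_ib]; abel, del₁_add,
      del₁_neg, del₁_neg, sub_eq_add_neg]
  have c₂ : ∑ b, del₁ (tder (U := U) (ia b) K.theta) * K.fieldStrength (ia b) =
      -∑ a, ∑ b, K.η a b • (del₁ (K.Q (ia a)) * K.fieldStrength (ia b)) := by
    rw [Finset.sum_comm, ← Finset.sum_neg_distrib]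
    refine Finset.sum_congr rfl fun b _ => ?_
    rw [← neg_neg (tder (U := U) (ia b) K.theta), ← sum_metric_Q, del₁_neg, del₁_sum, neg_mul,
      Finset.sum_mul]
    simp only [del₁_real_smul, smul_mul_assoc, K.η_symm.apply]
  simp only [Fintype.sum_sum_type, p₀, p₁, p₂, c₁, tder_ib_theta, one_smul, Units.neg_smul,
    Finset.sum_neg_distrib, c₂, hW₀, Finset.sum_const_zero, sub_mul, neg_mul,
    Finset.sum_sub_distrib] at h
  simp only [add_mul, smul_add, Finset.sum_add_distrib, extd_ghost_ia_mul, extd_ghost_ib_mul, hW,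
    map_add, map_neg, map_sum (extd U r), Finset.sum_sub_distrib]
  rw [← sub_eq_zero, ← h]
  abel

end TwistedCourantAlgebroid

end

/-! ### Cancellation of the 4-form terms by a trivial term of B. -/

noncomputable section

variable {n r : ℕ} {U : TopologicalSpace.Opens (Fin n → ℝ)}

namespace TwistedCourantAlgebroid

variable (K : TwistedCourantAlgebroid U r)

/-- The pull-back of `Q^μ`. -/
def qForm (μ : Fin n) : LocalForms U r := pull U r (K.Q (ix μ))

/-- `F^μ = dX^μ - Q^μ`. -/
def anchorStrength (μ : Fin n) : LocalForms U r := K.fieldStrength (ix μ)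

theorem bideg_qForm (μ : Fin n) : K.qForm μ ∈ bideg fieldDeg ((1, 0) : ℤ × ℤ) :=
  bideg_pull (K.bideg_Q_ix μ)

theorem bideg_anchorStrength (μ : Fin n) :
    K.anchorStrength μ ∈ bideg fieldDeg ((1, 0) : ℤ × ℤ) := by
  simpa [tdeg, anchorStrength] using K.bideg_fieldStrength (ix μ)

/-- There is no ghost in the x-directions, so H itself is not differentiated. The three equal
Q-slots give 3 · 1/6 = ½. -/
theorem del₁_hForm (μ : Fin n) : del₁ (K.hForm μ) =
    (1 / 2 : ℝ) • tri (K.H μ) (fun ν => del₁ (K.Q (ix ν))) K.qForm K.qForm := by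
  have h : ∀ γ : Idx n r, ghost U γ * pull U r (tder (U := U) γ (K.hForm μ)) = (1 / 2 : ℝ) •
      tri (K.H μ) (fun ν =>
        ghost U γ * pull U r (tder (U := U) γ (K.Q (ix ν)))) K.qForm K.qForm := by
    rintro (ν | γ)
    · simp only [ghost_ix, zero_mul, tri, smul_zero, Finset.sum_const_zero]
    · rw [hForm, map_smul, (isGDer_tder (Sum.inr γ)).map_tri_antisymm (K.H_swap₂ μ) (K.H_swap₃ μ)
        (p := (1, 0)) (by simp [sgn]) K.bideg_Q_ix]
      simp only [tder_inr_algebraMap, zero_mul, Finset.sum_const_zero, zero_add]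
      rw [smul_smul, pull_real_smul, map_tri, mul_smul_comm,
        show (1 / 6 * 3 : ℝ) = 1 / 2 by norm_num]
      simp only [tri, Finset.mul_sum, mul_smul_comm, mul_assoc]
      rfl
  rw [del₁, contr₁]
  simp only [h, ← Finset.smul_sum]
  refine congrArg _ ?_
  simp only [tri, del₁, contr₁, Finset.sum_mul, Finset.smul_sum]
  rw [← sum_last₃]

/-- F passes the two odd factors Q without sign. The minus sign comes from exchanging the first two
indices of H, which moves the index of the variation to the front. -/
theorem sum_del₁_hForm_mul : ∑ μ, del₁ (K.hForm μ) * K.anchorStrength μ =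
    -((1 / 2 : ℝ) • ∑ μ, del₁ (K.Q (ix μ)) *
      tri (K.H μ) K.anchorStrength K.qForm K.qForm) := by
  have hc : ∀ x y z, K.qForm y * (K.qForm z * K.anchorStrength x) =
      K.anchorStrength x * (K.qForm y * K.qForm z) := fun x y z => by
    rw [← mul_assoc, mul_comm_of_mem (bideg_mul (K.bideg_qForm y) (K.bideg_qForm z) rfl)
      (K.bideg_anchorStrength x)]
    simp [sgn, show Int.negOnePow 2 = 1 from rfl]
  simp only [del₁_hForm, tri, smul_mul_assoc, Finset.sum_mul, Finset.mul_sum, mul_smul_comm,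
    mul_assoc, hc]
  rw [Finset.sum_comm, Finset.smul_sum, ← Finset.sum_neg_distrib]
  refine Finset.sum_congr rfl fun μ _ => ?_
  rw [← smul_neg, ← Finset.sum_neg_distrib]
  refine congrArg _ (Finset.sum_congr rfl fun x _ => ?_)
  simp only [← Finset.sum_neg_distrib]
  refine Finset.sum_congr rfl fun b _ => Finset.sum_congr rfl fun c _ => ?_
  rw [K.H_swap₁ x μ b c, neg_smul]

/-- Trivial terms in the transformation of `B_μ` that compensate the 4-form. -/
def wzTriv : Idx n r → LocalForms U r
  | Sum.inr (Sum.inr κ) => ∑ μ, del₁ (K.Q (ix μ)) * ∑ a, ∑ b, K.H μ a b κ •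
      (((1 / 2 : ℝ) • K.qForm a + (1 / 6 : ℝ) • K.anchorStrength a) * K.anchorStrength b)
  | _ => 0

theorem isFieldTriv_wzTriv : K.IsFieldTriv K.wzTriv := by
  rintro (μ | a | κ)
  · exact ⟨K.weaklyZero_zero, zero_mem _⟩
  · exact ⟨K.weaklyZero_zero, zero_mem _⟩
  · refine ⟨(K.weaklyZero_iff _).mpr ?_, ?_⟩
    · simp only [wzTriv, map_sum, map_mul, map_smul, anchorStrength, onShell_fieldStrength,
        mul_zero, smul_zero, Finset.sum_const_zero]
    · exact sum_mem fun μ _ => bideg_mul (K.bideg_del₁_Q (ix μ)) (sum_mem fun a _ =>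
        sum_mem fun b _ => Submodule.smul_mem _ _ (bideg_mul (add_mem
          (bideg_real_smul _ (K.bideg_qForm a)) (bideg_real_smul _ (K.bideg_anchorStrength a)))
          (K.bideg_anchorStrength b) rfl)) rfl

theorem sum_wzTriv_mul : ∑ κ, K.wzTriv (ib κ) * K.anchorStrength κ =
    ∑ μ, del₁ (K.Q (ix μ)) *
      ((1 / 2 : ℝ) • tri (K.H μ) K.qForm K.anchorStrength K.anchorStrength +
        (1 / 6 : ℝ) • tri (K.H μ) K.anchorStrength K.anchorStrength K.anchorStrength) := by
  simp only [wzTriv, Finset.sum_mul, mul_assoc]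
  rw [Finset.sum_comm]
  refine Finset.sum_congr rfl fun μ _ => ?_
  rw [← Finset.mul_sum]
  refine congrArg _ ?_
  rw [← sum_rotate]
  simp only [tri, Finset.smul_sum, ← Finset.sum_add_distrib]
  refine Finset.sum_congr rfl fun a _ => Finset.sum_congr rfl fun b _ =>
    Finset.sum_congr rfl fun κ _ => ?_
  rw [smul_mul_assoc, smul_comm (1 / 2 : ℝ), smul_comm (1 / 6 : ℝ), ← smul_add, add_mul, add_mul,
    smul_mul_assoc, smul_mul_assoc, smul_mul_assoc, smul_mul_assoc]

/-- Expand the contraction of H with sX in dX = Q + F, with coefficients 1/6, 1/2, 1/2, 1/6. The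
term QQQ cancels the `hForm` left by the Lagrangian, and FQQ cancels the term from
`gauge_variation`. The terms QFF and FFF are quadratic and cubic in F, and fix the coefficients ½
and 1/6 in `wzTriv`. -/
theorem wz_cancel :
    ∑ μ, del₁ (K.hForm μ) * K.anchorStrength μ - ∑ κ, K.wzTriv (ib κ) * K.anchorStrength κ
      - ∑ μ, del₁ (K.Q (ix μ)) * pull U r (K.hForm μ)
      + K.wzVariation (fun μ => del₁ (K.Q (ix μ))) = 0 := by
  have hdX : (fun ν => extd U r (phi U (ix ν))) = fun ν => K.qForm ν + K.anchorStrength ν := by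
    funext ν
    rw [anchorStrength, fieldStrength, qForm, add_sub_cancel]
  have hh : ∀ μ, pull U r (K.hForm μ) = (1 / 6 : ℝ) • tri (K.H μ) K.qForm K.qForm K.qForm :=
    fun μ => by
      rw [hForm, pull_real_smul, map_tri]
      rfl
  rw [sum_del₁_hForm_mul, sum_wzTriv_mul, wzVariation, hdX, quad_eq_sum_tri]
  simp only [hh, Finset.smul_sum, ← Finset.sum_neg_distrib, ← Finset.sum_sub_distrib,
    ← Finset.sum_add_distrib]
  refine Finset.sum_eq_zero fun μ _ => ?_
  rw [tri_add_cube (K.H_swap₂ μ) (K.H_swap₃ μ) fun a b =>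
    mul_comm_of_mem (K.bideg_qForm a) (K.bideg_anchorStrength b)]
  simp only [← mul_smul_comm, ← mul_neg, ← mul_sub, ← mul_add]
  refine (congrArg _ ?_).trans (mul_zero _)
  module

/-- The classical action is invariant for suitable trivial terms. -/
theorem actionInvariant {s : LocalForms U r →ₗ[ℝ] LocalForms U r} (hs : IsBRSTOperator s)
    (h : K.FieldLaw s K.wzTriv) : K.ActionInvariant s := by
  have hx : ∀ μ, s (phi U (ix μ)) = del₁ (K.Q (ix μ)) := fun μ => by
    rw [h.apply, ghost_ix, map_zero, zero_add]
    exact add_zero _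
  have ha : ∀ a, s (phi U (ia a)) = extd U r (ghost U (ia a)) + del₁ (K.Q (ia a)) := fun a => by
    rw [h.apply]
    exact add_zero _
  -- The first half of J comes from integrating the kinetic terms by parts, the second from
  -- integrating the dε terms by parts.
  refine ⟨_, (-∑ μ, phi U (ib μ) * s (phi U (ix μ))
    - (1 / 2 : ℝ) • ∑ a, ∑ b, K.η a b • (phi U (ia a) * s (phi U (ia b)))) +
    (-∑ μ, ghost U (ib μ) * K.fieldStrength (ix μ)
      + ∑ a, ∑ b, K.η a b • (ghost U (ia a) * K.fieldStrength (ia b))), K.brst_wessZumino hs, ?_⟩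
  have g := K.gauge_variation
  have c := K.wz_cancel
  simp only [anchorStrength] at c
  rw [map_add, K.brst_lagrangian hs]
  simp only [hx, ha, h.apply (ib _), add_mul _ (K.wzTriv _), Finset.sum_add_distrib]
  rw [← sub_eq_zero] at g ⊢
  refine Eq.trans ?_ ((congrArg₂ HAdd.hAdd g c).trans (add_zero 0))
  abel

end TwistedCourantAlgebroid

end

end

end TwistedCourant

theorem proposition3p1 {n r : ℕ} (U : TopologicalSpace.Opens (Fin n → ℝ))
    (K : TwistedCourantAlgebroid U r) :
    -- existence, uniqueness and on-shell nilpotency, for arbitrary trivial terms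
    (∀ τφ τε : Idx n r → LocalForms U r, K.IsFieldTriv τφ → K.IsGhostTriv τε →
      ∃ s : LocalForms U r →ₗ[ℝ] LocalForms U r,
        IsBRSTOperator s ∧ K.FieldLaw s τφ ∧ K.GhostLaw s τε ∧ K.Ghost2Law s ∧
        (∀ x, K.WeaklyZero (s (s x))) ∧
        ∀ s' : LocalForms U r →ₗ[ℝ] LocalForms U r, IsBRSTOperator s' → K.FieldLaw s' τφ →
          K.GhostLaw s' τε → K.Ghost2Law s' → s' = s) ∧
    -- the law of the fields is a symmetry of the classical action for suitable trivial terms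
    (∃ τφ : Idx n r → LocalForms U r, K.IsFieldTriv τφ ∧
      ∀ s : LocalForms U r →ₗ[ℝ] LocalForms U r, IsBRSTOperator s → K.FieldLaw s τφ →
        K.ActionInvariant s) ∧
    -- weak nilpotency determines the coefficients in the laws of the ghosts
    (∀ (s : LocalForms U r →ₗ[ℝ] LocalForms U r) (τφ τε : Idx n r → LocalForms U r)
      (k : Idx n r → Idx n r → Target U r) (l : Idx n r → Idx n r → Idx n r → Target U r),
      IsBRSTOperator s → K.IsFieldTriv τφ → K.IsGhostTriv τε → K.FieldLaw s τφ →
      IsCoeff₁ k → IsCoeff₂ l → IsGradedSymm₂ l →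
      (∀ α, s (ghost U α) = extd U r (ghost2 U α) + contr₁ (ghost2 U) (k α)
        + (1 / 2 : ℝ) • contr₂ (l α) + τε α) →
      (∀ α, K.WeaklyZero (s (s (phi U α)))) →
      ((∀ α μ, k α (ib μ) = -tder (ib μ) (K.Q α)) ∧
        (∀ α β γ, l α (Sum.inr β) (Sum.inr γ) =
          -tder (Sum.inr β) (tder (Sum.inr γ) (K.Q α))) ∧
        K.GhostLaw s τε) ∧
      ∀ (k' : Idx n r → Idx n r → Idx n r → Target U r)
        (l' : Idx n r → Idx n r → Idx n r → Idx n r → Target U r),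
        IsCoeff₂ k' → IsCoeff₃ l' → IsGradedSymm₃ l' →
        (∀ α, s (ghost2 U α) = contrMixed (k' α) + (1 / 6 : ℝ) • contr₃ (l' α)) →
        (∀ α, K.WeaklyZero (s (s (ghost U α)))) →
        (∀ α μ γ, k' α (ib μ) (Sum.inr γ) = tder (ib μ) (tder (Sum.inr γ) (K.Q α))) ∧
          (∀ α β γ δ, l' α (Sum.inr β) (Sum.inr γ) (Sum.inr δ) =
            tder (Sum.inr β) (tder (Sum.inr γ) (tder (Sum.inr δ) (K.Q α)))) ∧
          K.Ghost2Law s) := by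
  refine ⟨fun τφ τε hφ hε => K.exists_unique_brst hφ hε,
    ⟨K.wzTriv, K.isFieldTriv_wzTriv, fun s hs h => K.actionInvariant hs h⟩,
    fun s τφ τε k l hs hτφ hτε hφ _ _ hl hε h => ?_⟩
  have hc := TwistedCourantAlgebroid.ghost_coefficients hs hτφ hτε hφ hl hε h
  exact ⟨hc, fun k' l' _ _ hl' hg h' =>
    TwistedCourantAlgebroid.ghost2_coefficients hs hτφ hτε hφ hc.2.2 hl' hg h'⟩
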